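/- Conventions. All objects are $C^\infty$; manifolds are connected. For a connection $\nabla$, $R(u,v)w=\nabla_v\nabla_u w-\nabla_u\nabla_v w+\nabla_{[u,v]}w$. For a metric $g$, $R_{jklp}$ are the components of $g(R(\cdot,\cdot)\,\cdot,\cdot)$, the Ricci tensor is $R_{jl}=g^{kp}R_{jklp}$, and the Weyl tensor $W$ acts on $2$-forms by $2(W\omega)_{jk}=W_{jklp}\,\omega^{lp}$. Put $2\langle\omega,\sigma\rangle=\omega_{jk}\sigma^{jk}$ for $2$-forms. A twice-covariant tensor $b$ acts on vectors by $g(bu,\cdot)=b(u,\cdot)$. Let $(M,g)$ be an oriented pseudo-Riemannian Einstein four-manifold of the neutral signature $(--++)$, and let $\Lambda^\pm M$ be the bundles of self-dual and anti-self-dual $2$-forms. Suppose that $(M,g)$ is self-dual of Petrov type III, that is, $W$ vanishes on $\Lambda^-M$ and, at every point, the restriction $W^+$ of $W$ to $\Lambda^+M$, which is self-adjoint, sends some ordered basis $(X,Y,Z)$ of the fibre of $\Lambda^+M$ to $(0,X,Y)$. Then there is a unique system consisting of sections $\zeta,\eta,\theta$ of $\Lambda^+M$ and $1$-forms $\alpha,\beta,\gamma$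 on $M$ such that $$W\zeta=0,\quad W\eta=-\zeta,\quad W\theta=\eta,\qquad \langle\zeta,\theta\rangle=2=-\langle\eta,\eta\rangle,\quad \langle\zeta,\zeta\rangle=\langle\zeta,\eta\rangle=\langle\eta,\theta\rangle=\langle\theta,\theta\rangle=0,$$ $\eta v=v$ for $v\in\mathrm{Ker}\,\zeta$, $\eta w=-w$ for $w\in\mathrm{Ker}\,\theta$, and, for the Levi-Civita connection $\nabla$, $$\nabla\zeta=2\alpha\otimes\zeta+2\beta\otimes\eta,\qquad \nabla\eta=2\gamma\otimes\zeta+2\beta\otimes\theta,\qquad \nabla\theta=2\gamma\otimes\eta-2\alpha\otimes\theta .$$ Let $\mathcal V=\mathrm{Ker}\,\zeta$, let $\mathrm D$ be the restriction of $\nabla$ to the leaves of $\mathcal V$ (so that $\mathrm D_uv=\nabla_uv$ for sections $u,v$ of $\mathcal V$), let $h$ be the restriction of $g$ to $\mathcal V\times TM$, and restrict $\alpha,\theta$ to $\mathcal V$. If $\beta\neq0$ everywhere in $M$, then $(M,\mathcal V,\mathrm D,h,\alpha,\beta,\theta,\zeta)$ is a basic octuple. This means the following. (1) $(\mathcal V,\mathrm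 D)$ is a two-dimensional affine foliation: $\mathcal V$ is an integrable two-dimensional distribution, and $\mathrm D$ is a smooth family of flat torsionfree connections on the leaves of $\mathcal V$. A section $v$ of $\mathcal V$ over an open set is called $\mathcal V$-parallel if $\mathrm D_uv=0$ for all sections $u$ of $\mathcal V$ over that set, and a vector field $w$ on an open set is called $\mathcal V$-projectable if $[w,v]$ is a section of $\mathcal V$ for all sections $v$ of $\mathcal V$ over that set. (2) $h$ is a skew-affine partial metric: it is a smooth pairing of $\mathcal V$ and $TM$; for every $x\in M$, the vectors $w\in T_xM$ with $h(v,w)=0$ for all $v\in\mathcal V_x$ are exactly those in $\mathcal V_x$; and $d_v[h(v,w)]=0$ for all $\mathcal V$-parallel $v$ and $\mathcal V$-projectable $w$. (3) $\alpha,\beta,\zeta,\theta$ are smooth sections of $\mathcal V^*$, $T^*M$, $[T^*M]^{\wedge2}$ and $[\mathcal V^*]^{\wedge2}$, respectively, with $\beta\ne0$ and $\mathrm{rank}\,\zeta=2$ everywhere. (4) For all $\mathcal V$-parallel sections $u,v,v'$ of $\mathcal V$ and $\mathcal V$-projectable vector fields $w,w'$, defined on the same open set, $$d_u[h(v,w)]=\beta(w)\theta(u,v),\quad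 d_u[\alpha(v)]=\alpha(u)\alpha(v),\quad d_u[\zeta(w,w')]=\alpha(u)\zeta(w,w'),$$ $$d_u[\beta(w)]=2\alpha(u)\beta(w),\quad d_u[\theta(v,v')]=-2\alpha(u)\theta(v,v'),$$ $$\theta(v,\zeta w)=2h(v,w),\quad \alpha(\zeta w)=2\beta(w),\quad \mathcal V=\mathrm{Ker}\,\zeta,$$ where $\zeta w$ is the unique section of $\mathcal V$ with $h(\zeta w,\cdot)=\zeta(w,\cdot)$. -/

import Mathlib

open scoped Manifold ContDiff Topology

noncomputable section

namespace NeutralGeometry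

/-- The model space of four-manifolds. -/
abbrev E4 : Type := EuclideanSpace ℝ (Fin 4)

section Basics

variable {M : Type*} [TopologicalSpace M] [ChartedSpace E4 M] [IsManifold (𝓡 4) ∞ M]

/-- The tangent space at a point of a four-manifold. -/
abbrev Tan (x : M) : Type := TangentSpace (𝓡 4) x

/-- Not necessarily smooth vector fields.  A vector field on an open set `U` is represented by any
extension of it to `M`: only its values on `U` are ever used. -/
abbrev VField (M : Type*) [TopologicalSpace M] [ChartedSpace E4 M] : Type _ := (x : M) → Tan x

/-- Bilinear forms on the tangent space at `x`. -/
abbrev Bilin (x : M) : Type := Tan x →L[ℝ] Tan x →L[ℝ] ℝ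

/-- The vector field `X` is of class `C^∞` on `U`. -/
def SmoothFieldOn (U : Set M) (X : VField M) : Prop :=
  ContMDiffOn (𝓡 4) (𝓡 4).tangent ∞ (fun x => (⟨x, X x⟩ : TangentBundle (𝓡 4) M)) U

/-- The function `f` is of class `C^∞` on `U`. -/
def SmoothFunOn (U : Set M) (f : M → ℝ) : Prop :=
  ContMDiffOn (𝓡 4) 𝓘(ℝ, ℝ) ∞ f U

/-- The directional derivative `d_v f` at `x`, for a tangent vector `v` at `x`. -/
def dirDeriv (f : M → ℝ) (x : M) (v : Tan x) : ℝ := mvfderiv (𝓡 4) f x v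

/-- The Lie bracket of vector fields. -/
def bracket (X Y : VField M) : VField M := VectorField.mlieBracket (𝓡 4) X Y

/-- A `1`-form is smooth if its values on smooth local vector fields are smooth. -/
def SmoothOneForm (ξ : (x : M) → Tan x →L[ℝ] ℝ) : Prop :=
  ∀ (U : Set M) (X : VField M), IsOpen U → SmoothFieldOn U X →
    SmoothFunOn U (fun x => ξ x (X x))

/-- A twice-covariant tensor field is smooth if its values on smooth local vector fields are
smooth. -/
def SmoothBilin (b : (x : M) → Bilin x) : Prop :=
  ∀ (U : Set M) (X Y : VField M), IsOpen U → SmoothFieldOn U X → SmoothFieldOn U Y →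
    SmoothFunOn U (fun x => b x (X x) (Y x))

/-- The basis of the tangent space at `x` given by the preferred chart at `x`.  It serves to write
out the contractions below, which do not depend on the choice of a basis. -/
def coordBasis (x : M) : Module.Basis (Fin 4) ℝ (Tan x) :=
  (EuclideanSpace.basisFun (Fin 4) ℝ).toBasis

end Basics

/-! ### Metrics, orientations -/

/-- Pseudo-Riemannian metrics of the neutral signature `(--++)` on a four-manifold. -/
structure NeutralMetric (M : Type*) [TopologicalSpace M] [ChartedSpace E4 M]
    [IsManifold (𝓡 4) ∞ M] where
  /-- The inner product in each tangent space. -/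
  inner : (x : M) → Bilin x
  symm : ∀ (x : M) (v w : Tan x), inner x v w = inner x w v
  /-- There is a `(--++)`-orthonormal basis at each point. -/
  neutral : ∀ x : M, ∃ e : Module.Basis (Fin 4) ℝ (Tan x), ∀ i j,
    inner x (e i) (e j) = if i = j then (if i < 2 then -1 else 1) else 0
  smooth : ContMDiff (𝓡 4) ((𝓡 4).prod 𝓘(ℝ, E4 →L[ℝ] E4 →L[ℝ] ℝ)) ∞
    (fun x : M => Bundle.TotalSpace.mk' (E4 →L[ℝ] E4 →L[ℝ] ℝ)
      (E := fun x : M => TangentSpace (𝓡 4) x →L[ℝ] TangentSpace (𝓡 4) x →L[ℝ] ℝ) x (inner x))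

/-- Orientations of a four-manifold: orientations of the tangent spaces, which near each point are
represented by some smooth local frame. -/
structure MOrientation (M : Type*) [TopologicalSpace M] [ChartedSpace E4 M]
    [IsManifold (𝓡 4) ∞ M] where
  /-- The orientation of each tangent space. -/
  orient : (x : M) → Orientation ℝ (Tan x) (Fin 4)
  coherent : ∀ x₀ : M, ∃ (U : Set M) (s : Fin 4 → VField M), IsOpen U ∧ x₀ ∈ U ∧
    (∀ i, SmoothFieldOn U (s i)) ∧
    ∀ x ∈ U, ∃ b : Module.Basis (Fin 4) ℝ (Tan x), (∀ i, b i = s i x) ∧ b.orientation = orient x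

section Curvature

variable {M : Type*} [TopologicalSpace M] [ChartedSpace E4 M] [IsManifold (𝓡 4) ∞ M]
variable (g : NeutralMetric M)

/-- The right-hand side of the Koszul formula for `2 g(∇_v u, w)`. -/
def koszul (v u w : VField M) (x : M) : ℝ :=
  dirDeriv (fun y => g.inner y (u y) (w y)) x (v x)
  + dirDeriv (fun y => g.inner y (v y) (w y)) x (u x)
  - dirDeriv (fun y => g.inner y (v y) (u y)) x (w x)
  + g.inner x (u x) (bracket w v x)
  + g.inner x (w x) (bracket v u x)
  - g.inner x (v x) (bracket u w x)

/-- The Levi-Civita connection: for vector fields `v, u` that are smooth near `x`, the vector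
`(∇_v u)(x)` is the unique one satisfying the Koszul formula. -/
def nabla (v u : VField M) : VField M := fun x =>
  Classical.epsilon (fun z : Tan x =>
    ∀ (U : Set M) (w : VField M), IsOpen U → x ∈ U → SmoothFieldOn U w →
      2 * g.inner x z (w x) = koszul g v u w x)

/-- The curvature operator `R(u,v)w = ∇_v ∇_u w - ∇_u ∇_v w + ∇_{[u,v]} w` on vector fields. -/
def curvField (u v w : VField M) : VField M := fun x =>
  nabla g v (nabla g u w) x - nabla g u (nabla g v w) x + nabla g (bracket u v) w x

/-- The curvature tensor at a point, `R(a,b)c`.  As `curvField` is tensorial, any smooth local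
extensions of the vectors may be used. -/
def curv (x : M) (a b c : Tan x) : Tan x :=
  curvField g (FiberBundle.extend E4 a) (FiberBundle.extend E4 b) (FiberBundle.extend E4 c) x

/-- The four-times covariant curvature tensor `R(a,b,c,d) = g(R(a,b)c,d)`. -/
def curv4 (x : M) (a b c d : Tan x) : ℝ := g.inner x (curv g x a b c) d

/-- The components `g^{ij}` of the inverse metric in the basis `coordBasis x`. -/
def gInv (x : M) : Matrix (Fin 4) (Fin 4) ℝ :=
  (Matrix.of fun i j => g.inner x (coordBasis x i) (coordBasis x j))⁻¹

/-- The Ricci tensor, `Ric_{jl} = g^{kp} R_{jklp}`. -/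
def ricci (x : M) (a c : Tan x) : ℝ :=
  ∑ k, ∑ p, gInv g x k p * curv4 g x a (coordBasis x k) c (coordBasis x p)

/-- The scalar curvature, `g^{jl} Ric_{jl}`. -/
def scal (x : M) : ℝ :=
  ∑ j, ∑ l, gInv g x j l * ricci g x (coordBasis x j) (coordBasis x l)

/-- The (four-times covariant) Weyl tensor in dimension four. -/
def weyl (x : M) (a b c d : Tan x) : ℝ :=
  curv4 g x a b c d
  - (1 / 2) * (g.inner x a c * ricci g x b d + g.inner x b d * ricci g x a c
      - g.inner x b c * ricci g x a d - g.inner x a d * ricci g x b c)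
  + (scal g x / 6) * (g.inner x a c * g.inner x b d - g.inner x b c * g.inner x a d)

/-- `g` is an Einstein metric: the Ricci tensor is a constant multiple of `g`. -/
def IsEinstein : Prop :=
  ∃ c : ℝ, ∀ (x : M) (a b : Tan x), ricci g x a b = c * g.inner x a b

/-- `τ` is a `2`-form at `x`. -/
def IsTwoForm {x : M} (τ : Bilin x) : Prop := ∀ a b, τ a b = -τ b a

/-- The contravariant components `τ^{lp}` of `τ`. -/
def raised {x : M} (τ : Bilin x) (l p : Fin 4) : ℝ :=
  ∑ i, ∑ j, gInv g x l i * gInv g x p j * τ (coordBasis x i) (coordBasis x j)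

/-- The inner product of `2`-forms, `2⟨τ,σ⟩ = τ_{lp} σ^{lp}`. -/
def formInner {x : M} (τ σ : Bilin x) : ℝ :=
  (1 / 2) * ∑ l, ∑ p, τ (coordBasis x l) (coordBasis x p) * raised g σ l p

/-- The Weyl tensor acting on `2`-forms, `2(Wτ)_{jk} = W_{jklp} τ^{lp}`. -/
def weylOp {x : M} (τ : Bilin x) (a b : Tan x) : ℝ :=
  (1 / 2) * ∑ l, ∑ p, weyl g x a b (coordBasis x l) (coordBasis x p) * raised g τ l p

variable (o : MOrientation M)

open Classical in
/-- The volume form: the `4`-form with value `1` on positive orthonormal bases. -/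
def vol (x : M) : Tan x [⋀^Fin 4]→ₗ[ℝ] ℝ :=
  ((if (coordBasis x).orientation = o.orient x then 1 else -1) *
    Real.sqrt |(Matrix.of fun i j => g.inner x (coordBasis x i) (coordBasis x j)).det|) •
    (coordBasis x).det

/-- The Hodge star on `2`-forms, `2(*τ)_{jk} = vol_{jklp} τ^{lp}`. -/
def hodge {x : M} (τ : Bilin x) (a b : Tan x) : ℝ :=
  (1 / 2) * ∑ l, ∑ p, vol g o x ![a, b, coordBasis x l, coordBasis x p] * raised g τ l p

/-- `τ` lies in the fibre of `Λ⁺M`, that is, `τ` is a `2`-form with `*τ = τ`. -/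
def IsSD {x : M} (τ : Bilin x) : Prop := IsTwoForm τ ∧ ∀ a b, hodge g o τ a b = τ a b

/-- `τ` lies in the fibre of `Λ⁻M`, that is, `τ` is a `2`-form with `*τ = -τ`. -/
def IsASD {x : M} (τ : Bilin x) : Prop := IsTwoForm τ ∧ ∀ a b, hodge g o τ a b = -τ a b

/-- `(M,g)` is self-dual: `W⁻ = 0`. -/
def IsSelfDual : Prop :=
  ∀ (x : M) (τ : Bilin x), IsASD g o τ → ∀ a b, weylOp g τ a b = 0

/-- `W⁺` is of Petrov type III at `x`: it is self-adjoint and sends some ordered basis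
`(X, Y, Z)` of `Λ⁺` at `x` to `(0, X, Y)`. -/
def IsPetrovIIIAt (x : M) : Prop :=
  (∀ τ τ' σ σ' : Bilin x, IsSD g o τ → IsSD g o σ → IsSD g o τ' → IsSD g o σ' →
    (∀ a b, weylOp g τ a b = τ' a b) → (∀ a b, weylOp g σ a b = σ' a b) →
    formInner g τ' σ = formInner g τ σ') ∧
  ∃ X Y Z : Bilin x, IsSD g o X ∧ IsSD g o Y ∧ IsSD g o Z ∧
    LinearIndependent ℝ ![X, Y, Z] ∧
    (∀ τ : Bilin x, IsSD g o τ → τ ∈ Submodule.span ℝ {X, Y, Z}) ∧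
    (∀ a b, weylOp g X a b = 0) ∧ (∀ a b, weylOp g Y a b = X a b) ∧
    (∀ a b, weylOp g Z a b = Y a b)

/-- The covariant derivative `(∇_u b)(w,w')` of a twice-covariant tensor field. -/
def nablaBilin (b : (x : M) → Bilin x) (u w w' : VField M) (x : M) : ℝ :=
  dirDeriv (fun y => b y (w y) (w' y)) x (u x)
  - b x (nabla g u w x) (w' x) - b x (w x) (nabla g u w' x)

end Curvature

/-! ### The forms determined by a type III metric -/

/-- Systems of three fields of bilinear forms and three `1`-forms. -/
structure FormData (M : Type*) [TopologicalSpace M] [ChartedSpace E4 M] where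
  ζ : (x : M) → Bilin x
  η : (x : M) → Bilin x
  θ : (x : M) → Bilin x
  α : (x : M) → Tan x →L[ℝ] ℝ
  β : (x : M) → Tan x →L[ℝ] ℝ
  γ : (x : M) → Tan x →L[ℝ] ℝ

/-- The conditions that define `ζ, η, θ, α, β, γ` for an oriented neutral four-manifold. -/
structure FormData.IsAssociated {M : Type*} [TopologicalSpace M] [ChartedSpace E4 M]
    [IsManifold (𝓡 4) ∞ M] (d : FormData M) (g : NeutralMetric M) (o : MOrientation M) :
    Prop where
  smooth_ζ : SmoothBilin d.ζ
  smooth_η : SmoothBilin d.η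
  smooth_θ : SmoothBilin d.θ
  smooth_α : SmoothOneForm d.α
  smooth_β : SmoothOneForm d.β
  smooth_γ : SmoothOneForm d.γ
  sd_ζ : ∀ x, IsSD g o (d.ζ x)
  sd_η : ∀ x, IsSD g o (d.η x)
  sd_θ : ∀ x, IsSD g o (d.θ x)
  weyl_ζ : ∀ x a b, weylOp g (d.ζ x) a b = 0
  weyl_η : ∀ x a b, weylOp g (d.η x) a b = -d.ζ x a b
  weyl_θ : ∀ x a b, weylOp g (d.θ x) a b = d.η x a b
  inner_ζθ : ∀ x, formInner g (d.ζ x) (d.θ x) = 2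
  inner_ηη : ∀ x, formInner g (d.η x) (d.η x) = -2
  inner_ζζ : ∀ x, formInner g (d.ζ x) (d.ζ x) = 0
  inner_ζη : ∀ x, formInner g (d.ζ x) (d.η x) = 0
  inner_ηθ : ∀ x, formInner g (d.η x) (d.θ x) = 0
  inner_θθ : ∀ x, formInner g (d.θ x) (d.θ x) = 0
  /-- `ηv = v` for `v` in `Ker ζ`, where `g(ηv, ·) = η(v, ·)`. -/
  eig_ker_ζ : ∀ (x : M) (v : Tan x), d.ζ x v = 0 → d.η x v = g.inner x v
  /-- `ηw = -w` for `w` in `Ker θ`. -/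
  eig_ker_θ : ∀ (x : M) (w : Tan x), d.θ x w = 0 → d.η x w = -g.inner x w
  /-- `∇ζ = 2 α ⊗ ζ + 2 β ⊗ η`. -/
  nabla_ζ : ∀ (U : Set M) (u w w' : VField M), IsOpen U → SmoothFieldOn U u →
    SmoothFieldOn U w → SmoothFieldOn U w' → ∀ x ∈ U,
    nablaBilin g d.ζ u w w' x =
      2 * d.α x (u x) * d.ζ x (w x) (w' x) + 2 * d.β x (u x) * d.η x (w x) (w' x)
  /-- `∇η = 2 γ ⊗ ζ + 2 β ⊗ θ`. -/
  nabla_η : ∀ (U : Set M) (u w w' : VField M), IsOpen U → SmoothFieldOn U u →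
    SmoothFieldOn U w → SmoothFieldOn U w' → ∀ x ∈ U,
    nablaBilin g d.η u w w' x =
      2 * d.γ x (u x) * d.ζ x (w x) (w' x) + 2 * d.β x (u x) * d.θ x (w x) (w' x)
  /-- `∇θ = 2 γ ⊗ η - 2 α ⊗ θ`. -/
  nabla_θ : ∀ (U : Set M) (u w w' : VField M), IsOpen U → SmoothFieldOn U u →
    SmoothFieldOn U w → SmoothFieldOn U w' → ∀ x ∈ U,
    nablaBilin g d.θ u w w' x =
      2 * d.γ x (u x) * d.η x (w x) (w' x) - 2 * d.α x (u x) * d.θ x (w x) (w' x)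

/-! ### Affine foliations, partial metrics, basic octuples -/

section Foliations

variable {M : Type*} [TopologicalSpace M] [ChartedSpace E4 M] [IsManifold (𝓡 4) ∞ M]

/-- Fields of subspaces of the tangent spaces. -/
abbrev Plane (M : Type*) [TopologicalSpace M] [ChartedSpace E4 M] : Type _ :=
  (x : M) → Submodule ℝ (Tan x)

/-- Operators `(u, v) ↦ D_u v`. -/
abbrev PartialConn (M : Type*) [TopologicalSpace M] [ChartedSpace E4 M] : Type _ :=
  VField M → VField M → VField M

/-- `V` is a smooth distribution of dimension two. -/
def IsTwoDistribution (V : Plane M) : Prop :=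
  ∀ x₀ : M, ∃ (U : Set M) (X Y : VField M), IsOpen U ∧ x₀ ∈ U ∧
    SmoothFieldOn U X ∧ SmoothFieldOn U Y ∧
    ∀ x ∈ U, LinearIndependent ℝ ![X x, Y x] ∧ V x = Submodule.span ℝ {X x, Y x}

/-- `v` is a smooth section of `V` over `U`. -/
def IsSectionOn (V : Plane M) (U : Set M) (v : VField M) : Prop :=
  SmoothFieldOn U v ∧ ∀ x ∈ U, v x ∈ V x

/-- A family of vectors `v x ∈ V x`, viewed as a vector field. -/
def toField {V : Plane M} (v : (x : M) → V x) : VField M := fun x => (v x : Tan x)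

/-- `(V, D)` is a two-dimensional affine foliation: `V` is an integrable distribution (closed under
the Lie bracket), and `D` is a smooth family of flat torsionfree connections on its leaves, that
is, an operation sending smooth sections `u, v` of `V` over any open set to a smooth section
`D_u v` of `V` over the same set, compatible with restrictions to smaller open sets, and having the
algebraic properties of a connection that is flat and torsionfree. -/
structure IsAffineFoliation (V : Plane M) (D : PartialConn M) : Prop where
  distribution : IsTwoDistribution V
  integrable : ∀ (U : Set M) (u v : VField M), IsOpen U → IsSectionOn V U u → IsSectionOn V U v →
    ∀ x ∈ U, bracket u v x ∈ V x
  isSection : ∀ (U : Set M) (u v : VField M), IsOpen U → IsSectionOn V U u → IsSectionOn V U v →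
    IsSectionOn V U (D u v)
  congr : ∀ (U : Set M) (u v u' v' : VField M), IsOpen U → IsSectionOn V U u →
    IsSectionOn V U v → (∀ x ∈ U, u x = u' x) → (∀ x ∈ U, v x = v' x) →
    ∀ x ∈ U, D u v x = D u' v' x
  add_left : ∀ (U : Set M) (u u' v : VField M), IsOpen U → IsSectionOn V U u →
    IsSectionOn V U u' → IsSectionOn V U v → ∀ x ∈ U, D (u + u') v x = D u v x + D u' v x
  smul_left : ∀ (U : Set M) (f : M → ℝ) (u v : VField M), IsOpen U → SmoothFunOn U f →
    IsSectionOn V U u → IsSectionOn V U v →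
    ∀ x ∈ U, D (fun y => f y • u y) v x = f x • D u v x
  add_right : ∀ (U : Set M) (u v v' : VField M), IsOpen U → IsSectionOn V U u →
    IsSectionOn V U v → IsSectionOn V U v' → ∀ x ∈ U, D u (v + v') x = D u v x + D u v' x
  leibniz : ∀ (U : Set M) (f : M → ℝ) (u v : VField M), IsOpen U → SmoothFunOn U f →
    IsSectionOn V U u → IsSectionOn V U v →
    ∀ x ∈ U, D u (fun y => f y • v y) x = f x • D u v x + dirDeriv f x (u x) • v x
  torsionfree : ∀ (U : Set M) (u v : VField M), IsOpen U → IsSectionOn V U u →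
    IsSectionOn V U v → ∀ x ∈ U, D u v x - D v u x = bracket u v x
  flat : ∀ (U : Set M) (u v w : VField M), IsOpen U → IsSectionOn V U u →
    IsSectionOn V U v → IsSectionOn V U w →
    ∀ x ∈ U, D v (D u w) x - D u (D v w) x + D (bracket u v) w x = 0

/-- `v` is a `V`-parallel section of `V` over `U`: it is `D`-parallel along each leaf. -/
def IsParallelOn (V : Plane M) (D : PartialConn M) (U : Set M) (v : VField M) : Prop :=
  IsSectionOn V U v ∧ ∀ u : VField M, IsSectionOn V U u → ∀ x ∈ U, D u v x = 0

/-- `w` is a `V`-projectable vector field on `U`. -/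
def IsProjectableOn (V : Plane M) (U : Set M) (w : VField M) : Prop :=
  SmoothFieldOn U w ∧ ∀ v : VField M, IsSectionOn V U v → IsSectionOn V U (bracket w v)

/-- `h` is a partial metric for `(M, V)`: a smooth pairing of `V` and `TM` such that the induced
morphism `TM → V^*` has the kernel `V`. -/
structure IsPartialMetric (V : Plane M) (h : (x : M) → V x →ₗ[ℝ] Tan x →L[ℝ] ℝ) : Prop where
  smooth : ∀ (U : Set M) (v : (x : M) → V x) (w : VField M), IsOpen U →
    IsSectionOn V U (toField v) → SmoothFieldOn U w → SmoothFunOn U (fun x => h x (v x) (w x))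
  kernel : ∀ (x : M) (w : Tan x), (∀ v : V x, h x v w = 0) ↔ w ∈ V x

/-- The partial metric `h` is skew-affine. -/
def IsSkewAffine (V : Plane M) (D : PartialConn M)
    (h : (x : M) → V x →ₗ[ℝ] Tan x →L[ℝ] ℝ) : Prop :=
  ∀ (U : Set M) (v : (x : M) → V x) (w : VField M), IsOpen U →
    IsParallelOn V D U (toField v) → IsProjectableOn V U w →
    ∀ x ∈ U, dirDeriv (fun y => h y (v y) (w y)) x (v x) = 0

/-- `(M, V, D, h, α, β, θ, ζ)` is a basic octuple.  The forms `α` and `θ` are only defined on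
vectors in `V`. -/
structure IsBasicOctuple (V : Plane M) (D : PartialConn M)
    (h : (x : M) → V x →ₗ[ℝ] Tan x →L[ℝ] ℝ) (α : (x : M) → V x →ₗ[ℝ] ℝ)
    (β : (x : M) → Tan x →L[ℝ] ℝ) (θ : (x : M) → V x →ₗ[ℝ] V x →ₗ[ℝ] ℝ)
    (ζ : (x : M) → Bilin x) : Prop where
  foliation : IsAffineFoliation V D
  partialMetric : IsPartialMetric V h
  skewAffine : IsSkewAffine V D h
  smooth_α : ∀ (U : Set M) (v : (x : M) → V x), IsOpen U → IsSectionOn V U (toField v) →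
    SmoothFunOn U (fun x => α x (v x))
  smooth_β : SmoothOneForm β
  smooth_θ : ∀ (U : Set M) (v v' : (x : M) → V x), IsOpen U → IsSectionOn V U (toField v) →
    IsSectionOn V U (toField v') → SmoothFunOn U (fun x => θ x (v x) (v' x))
  smooth_ζ : SmoothBilin ζ
  skew_θ : ∀ (x : M) (v v' : V x), θ x v v' = -θ x v' v
  skew_ζ : ∀ (x : M) (w w' : Tan x), ζ x w w' = -ζ x w' w
  β_ne_zero : ∀ x, β x ≠ 0
  rank_ζ : ∀ x, Module.finrank ℝ (LinearMap.range (ζ x).toLinearMap) = 2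
  /-- `d_u [h(v,w)] = β(w) θ(u,v)`. -/
  d_h : ∀ (U : Set M) (u v : (x : M) → V x) (w : VField M), IsOpen U →
    IsParallelOn V D U (toField u) → IsParallelOn V D U (toField v) → IsProjectableOn V U w →
    ∀ x ∈ U, dirDeriv (fun y => h y (v y) (w y)) x (u x) = β x (w x) * θ x (u x) (v x)
  /-- `d_u [α(v)] = α(u) α(v)`. -/
  d_α : ∀ (U : Set M) (u v : (x : M) → V x), IsOpen U →
    IsParallelOn V D U (toField u) → IsParallelOn V D U (toField v) →
    ∀ x ∈ U, dirDeriv (fun y => α y (v y)) x (u x) = α x (u x) * α x (v x)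
  /-- `d_u [ζ(w,w')] = α(u) ζ(w,w')`. -/
  d_ζ : ∀ (U : Set M) (u : (x : M) → V x) (w w' : VField M), IsOpen U →
    IsParallelOn V D U (toField u) → IsProjectableOn V U w → IsProjectableOn V U w' →
    ∀ x ∈ U, dirDeriv (fun y => ζ y (w y) (w' y)) x (u x) = α x (u x) * ζ x (w x) (w' x)
  /-- `d_u [β(w)] = 2 α(u) β(w)`. -/
  d_β : ∀ (U : Set M) (u : (x : M) → V x) (w : VField M), IsOpen U →
    IsParallelOn V D U (toField u) → IsProjectableOn V U w →
    ∀ x ∈ U, dirDeriv (fun y => β y (w y)) x (u x) = 2 * α x (u x) * β x (w x)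
  /-- `d_u [θ(v,v')] = -2 α(u) θ(v,v')`. -/
  d_θ : ∀ (U : Set M) (u v v' : (x : M) → V x), IsOpen U →
    IsParallelOn V D U (toField u) → IsParallelOn V D U (toField v) →
    IsParallelOn V D U (toField v') →
    ∀ x ∈ U, dirDeriv (fun y => θ y (v y) (v' y)) x (u x) = -2 * α x (u x) * θ x (v x) (v' x)
  /-- For each `w` there is a unique vector `z = ζw` in `V` with `h(z, w') = ζ(w,w')` for all
  `w'`. -/
  sharp_exists : ∀ (x : M) (w : Tan x), ∃! z : V x, ∀ w' : Tan x, h x z w' = ζ x w w'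
  /-- `θ(v, ζw) = 2 h(v,w)`. -/
  θ_sharp : ∀ (x : M) (v : V x) (w : Tan x) (z : V x), (∀ w' : Tan x, h x z w' = ζ x w w') →
    θ x v z = 2 * h x v w
  /-- `α(ζw) = 2 β(w)`. -/
  α_sharp : ∀ (x : M) (w : Tan x) (z : V x), (∀ w' : Tan x, h x z w' = ζ x w w') →
    α x z = 2 * β x w
  /-- `V = Ker ζ`. -/
  ker_ζ : ∀ (x : M) (v : Tan x), v ∈ V x ↔ ζ x v = 0

end Foliations

section Restrictions

variable {M : Type*} [TopologicalSpace M] [ChartedSpace E4 M] [IsManifold (𝓡 4) ∞ M]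

/-- The field of kernels of bilinear forms. -/
def kerField (b : (x : M) → Bilin x) : Plane M := fun x => LinearMap.ker (b x).toLinearMap

/-- The restriction of a field of bilinear forms to `V` and `TM`. -/
def restrictLeft (b : (x : M) → Bilin x) (V : Plane M) (x : M) :
    V x →ₗ[ℝ] Tan x →L[ℝ] ℝ := (b x).toLinearMap.domRestrict (V x)

/-- The restriction of a field of bilinear forms to `V`. -/
def restrictBoth (b : (x : M) → Bilin x) (V : Plane M) (x : M) :
    V x →ₗ[ℝ] V x →ₗ[ℝ] ℝ := (b x).toLinearMap₁₂.domRestrict₁₂ (V x) (V x)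

/-- The restriction of a `1`-form to `V`. -/
def restrictForm (ξ : (x : M) → Tan x →L[ℝ] ℝ) (V : Plane M) (x : M) :
    V x →ₗ[ℝ] ℝ := (ξ x).toLinearMap.domRestrict (V x)

end Restrictions

end NeutralGeometry

end

/-!
The metric identifies `2`-forms with skew-adjoint endomorphisms of the tangent spaces, and the inner
product of forms with `-tr(AB)/2`.  In these terms self-dual forms `A, B` satisfy
`AB + BA = -⟨A,B⟩` and commute with the anti-self-dual ones, so that the problem at each point is
one of algebra.  For a type III operator `W` and any form `T` with `W(WT) ≠ 0`, the forms `ζ, η, θ`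
are given by explicit expressions in `T`, `WT`, `W(WT)` and the reciprocal of the factor `ν` in
`(WT)(W(WT)) = ν W(WT)` (`IsTypeIII.isTriple`), and they are unique (`IsTriple.unique`); the
condition on `Ker ζ` amounts to `ηζ = ζ` and fixes the sign.  As a form `T` can be chosen smoothly
near a given point, the pointwise unique triple is smooth (`exists_tripleField`).

Differentiating the anticommutators of `ζ, η, θ`, one sees that `∇ζ, ∇η, ∇θ` have no anti-self-dual
parts and are as required, which defines `α, β, γ` (`IsTriple.derivative`, `TripleField.endDer_eq`).

For an Einstein metric with `W⁻ = 0`, the curvature tensor is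
`R(a,b)c = k(g(a,c)b - g(b,c)a) + (ζ(a,b)ηc + η(a,b)ζc)/2` (`TripleField.curv_eq_triple`).  The
second Bianchi identity, with the `θ` and `η` components taken separately, gives `β ∧ ζ = 0` and
`α ∧ ζ + 2β ∧ η = 0` (`TripleField.bianchi`).  Hence `β = 0` on `V = Ker ζ` and `α(ζw) = 2β(w)`.
For a section `v` of `V` one has `ζ∇_w v = -2β(w)v`; as a consequence `∇` restricts to the leaves of
`V`, where it is flat by the formula for `R`.  Evaluating `ζR(u,w)v = 0` for sections `u, v` of `V`
yields the derivative of `β(w)` along `V` (`TripleField.dirDeriv_β`), and the other equations of a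
basic octuple follow from those for `∇ζ`, `∇θ` and `β`.
-/

set_option linter.unusedSectionVars false

noncomputable section

namespace NeutralGeometry

/-! ### Germs of smooth functions and vector fields -/

section Germs

variable {M : Type*} [TopologicalSpace M] [ChartedSpace E4 M] [IsManifold (𝓡 4) ∞ M]

/-- The vector field `X` is of class `C^∞` in some neighbourhood of `x`. -/
def SmoothFieldNear (X : VField M) (x : M) : Prop :=
  ∀ᶠ y in 𝓝 x, ContMDiffAt (𝓡 4) (𝓡 4).tangent ∞
    (fun z => (⟨z, X z⟩ : TangentBundle (𝓡 4) M)) y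

/-- The function `f` is of class `C^∞` in some neighbourhood of `x`. -/
def SmoothFunNear (f : M → ℝ) (x : M) : Prop :=
  ∀ᶠ y in 𝓝 x, ContMDiffAt (𝓡 4) 𝓘(ℝ, ℝ) ∞ f y

variable {x : M} {X Y Z : VField M} {f h : M → ℝ} {U : Set M}

theorem SmoothFieldOn.near (hX : SmoothFieldOn U X) (hU : IsOpen U) (hx : x ∈ U) :
    SmoothFieldNear X x :=
  Filter.eventually_of_mem (hU.mem_nhds hx) fun _ hy => hX.contMDiffAt (hU.mem_nhds hy)

theorem SmoothFunOn.near (hf : SmoothFunOn U f) (hU : IsOpen U) (hx : x ∈ U) :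
    SmoothFunNear f x :=
  Filter.eventually_of_mem (hU.mem_nhds hx) fun _ hy => hf.contMDiffAt (hU.mem_nhds hy)

theorem smoothFieldOn_of_near (hX : ∀ y ∈ U, SmoothFieldNear X y) : SmoothFieldOn U X :=
  fun y hy => (hX y hy).self_of_nhds.contMDiffWithinAt

theorem smoothFunOn_of_near (hf : ∀ y ∈ U, SmoothFunNear f y) : SmoothFunOn U f :=
  fun y hy => (hf y hy).self_of_nhds.contMDiffWithinAt

theorem SmoothFieldNear.eventually (hX : SmoothFieldNear X x) :
    ∀ᶠ y in 𝓝 x, SmoothFieldNear X y := eventually_eventually_nhds.2 hX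

theorem SmoothFunNear.eventually (hf : SmoothFunNear f x) :
    ∀ᶠ y in 𝓝 x, SmoothFunNear f y := eventually_eventually_nhds.2 hf

theorem SmoothFieldNear.exists_open (hX : SmoothFieldNear X x) :
    ∃ U : Set M, IsOpen U ∧ x ∈ U ∧ SmoothFieldOn U X := by
  obtain ⟨U, hU, hUo, hx⟩ := eventually_nhds_iff.1 hX
  exact ⟨U, hUo, hx, fun y hy => (hU y hy).contMDiffWithinAt⟩

theorem SmoothFieldNear.mdiff (hX : SmoothFieldNear X x) :
    MDifferentiableAt (𝓡 4) (𝓡 4).tangent (fun z => (⟨z, X z⟩ : TangentBundle (𝓡 4) M)) x :=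
  hX.self_of_nhds.mdifferentiableAt (by simp)

theorem SmoothFunNear.mdiff (hf : SmoothFunNear f x) :
    MDifferentiableAt (𝓡 4) 𝓘(ℝ, ℝ) f x :=
  hf.self_of_nhds.mdifferentiableAt (by simp)

theorem SmoothFunNear.continuousAt (hf : SmoothFunNear f x) : ContinuousAt f x :=
  hf.self_of_nhds.continuousAt

theorem SmoothFieldNear.congr (hX : SmoothFieldNear X x) (hXY : ∀ᶠ y in 𝓝 x, Y y = X y) :
    SmoothFieldNear Y x := by
  filter_upwards [hX, hXY.eventually_nhds] with y hy hy'
  exact hy.congr_of_eventuallyEq (hy'.mono fun z hz => by simp [hz])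

theorem SmoothFunNear.congr (hf : SmoothFunNear f x) (hfh : ∀ᶠ y in 𝓝 x, h y = f y) :
    SmoothFunNear h x := by
  filter_upwards [hf, hfh.eventually_nhds] with y hy hy'
  exact hy.congr_of_eventuallyEq hy'

theorem SmoothFieldNear.add (hX : SmoothFieldNear X x) (hY : SmoothFieldNear Y x) :
    SmoothFieldNear (X + Y) x := by
  filter_upwards [hX, hY] with y h1 h2 using h1.add_section h2

theorem SmoothFieldNear.sub (hX : SmoothFieldNear X x) (hY : SmoothFieldNear Y x) :
    SmoothFieldNear (X - Y) x := by
  filter_upwards [hX, hY] with y h1 h2 using h1.sub_section h2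

theorem SmoothFieldNear.neg (hX : SmoothFieldNear X x) : SmoothFieldNear (-X) x := by
  filter_upwards [hX] with y h1 using h1.neg_section

theorem SmoothFunNear.smul (hf : SmoothFunNear f x) (hX : SmoothFieldNear X x) :
    SmoothFieldNear (f • X) x := by
  filter_upwards [hf, hX] with y h1 h2 using h1.smul_section h2

theorem SmoothFieldNear.sum {ι : Type*} {s : Finset ι} {F : ι → VField M}
    (hF : ∀ i, SmoothFieldNear (F i) x) : SmoothFieldNear (fun y => ∑ i ∈ s, F i y) x := by
  have : ∀ᶠ y in 𝓝 x, ∀ i ∈ s, ContMDiffAt (𝓡 4) (𝓡 4).tangent ∞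
    (fun z => (⟨z, F i z⟩ : TangentBundle (𝓡 4) M)) y :=
    (Filter.eventually_all_finset s).2 fun i _ => hF i
  filter_upwards [this] with y h1 using ContMDiffAt.sum_section h1

theorem smoothFunNear_const (c : ℝ) : SmoothFunNear (fun _ : M => c) x :=
  Filter.Eventually.of_forall fun _ => contMDiffAt_const

theorem SmoothFunNear.add (hf : SmoothFunNear f x) (hh : SmoothFunNear h x) :
    SmoothFunNear (fun y => f y + h y) x := by
  filter_upwards [hf, hh] with y h1 h2 using h1.add h2

theorem SmoothFunNear.sub (hf : SmoothFunNear f x) (hh : SmoothFunNear h x) :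
    SmoothFunNear (fun y => f y - h y) x := by
  filter_upwards [hf, hh] with y h1 h2 using h1.sub h2

theorem SmoothFunNear.mul (hf : SmoothFunNear f x) (hh : SmoothFunNear h x) :
    SmoothFunNear (fun y => f y * h y) x := by
  filter_upwards [hf, hh] with y h1 h2 using h1.mul h2

theorem SmoothFunNear.neg (hf : SmoothFunNear f x) : SmoothFunNear (fun y => -f y) x := by
  filter_upwards [hf] with y h1 using h1.neg

theorem SmoothFunNear.inv (hf : SmoothFunNear f x) (h0 : f x ≠ 0) :
    SmoothFunNear (fun y => (f y)⁻¹) x := by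
  filter_upwards [hf, hf.continuousAt.eventually_ne h0] with y h1 h2 using h1.inv₀ h2

theorem SmoothFunNear.sum {ι : Type*} {s : Finset ι} {F : ι → M → ℝ}
    (hF : ∀ i, SmoothFunNear (F i) x) : SmoothFunNear (fun y => ∑ i ∈ s, F i y) x := by
  have : ∀ᶠ y in 𝓝 x, ∀ i ∈ s, ContMDiffAt (𝓡 4) 𝓘(ℝ, ℝ) ∞ (F i) y :=
    (Filter.eventually_all_finset s).2 fun i _ => hF i
  filter_upwards [this] with y h1 using contMDiffAt_finsetSum h1

theorem SmoothFunNear.prod {ι : Type*} {s : Finset ι} {F : ι → M → ℝ}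
    (hF : ∀ i, SmoothFunNear (F i) x) : SmoothFunNear (fun y => ∏ i ∈ s, F i y) x := by
  have : ∀ᶠ y in 𝓝 x, ∀ i ∈ s, ContMDiffAt (𝓡 4) 𝓘(ℝ, ℝ) ∞ (F i) y :=
    (Filter.eventually_all_finset s).2 fun i _ => hF i
  filter_upwards [this] with y h1 using contMDiffAt_finsetProd h1

theorem SmoothFieldNear.bracket (hX : SmoothFieldNear X x) (hY : SmoothFieldNear Y x) :
    SmoothFieldNear (bracket X Y) x := by
  filter_upwards [hX, hY] with y h1 h2
  have : IsManifold (𝓡 4) ((⊤ : ℕ∞) + 1) M := by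
    simpa using (inferInstance : IsManifold (𝓡 4) ∞ M)
  have : IsManifold (𝓡 4) (minSmoothness ℝ 2) M := by
    simp only [minSmoothness_of_isRCLikeNormedField]
    exact IsManifold.of_le (n := ∞) (WithTop.coe_le_coe.2 le_top)
  exact ContMDiffAt.mlieBracket_vectorField (m := ⊤) (n := ⊤) h1 h2 (by simp)

/-! ### Directional derivatives and brackets -/

theorem dirDeriv_add (hf : SmoothFunNear f x) (hh : SmoothFunNear h x) (v : Tan x) :
    dirDeriv (fun y => f y + h y) x v = dirDeriv f x v + dirDeriv h x v := by
  simp [dirDeriv, mvfderiv_fun_add hf.mdiff hh.mdiff]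

theorem dirDeriv_neg (v : Tan x) : dirDeriv (fun y => -f y) x v = -dirDeriv f x v := by
  simp [dirDeriv, mvfderiv_fun_neg]

theorem dirDeriv_mul (hf : SmoothFunNear f x) (hh : SmoothFunNear h x) (v : Tan x) :
    dirDeriv (fun y => f y * h y) x v = f x * dirDeriv h x v + h x * dirDeriv f x v := by
  simp [dirDeriv, mvfderiv_fun_mul hf.mdiff hh.mdiff]

theorem dirDeriv_const (c : ℝ) (v : Tan x) : dirDeriv (fun _ : M => c) x v = 0 := by
  simp [dirDeriv, mvfderiv_const]

theorem dirDeriv_const_mul (c : ℝ) (hf : SmoothFunNear f x) (v : Tan x) :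
    dirDeriv (fun y => c * f y) x v = c * dirDeriv f x v := by
  rw [dirDeriv_mul (smoothFunNear_const c) hf, dirDeriv_const]; ring

theorem dirDeriv_congr (hfh : ∀ᶠ y in 𝓝 x, f y = h y) (v : Tan x) :
    dirDeriv f x v = dirDeriv h x v := by
  have : f =ᶠ[𝓝 x] h := hfh
  simp only [dirDeriv, mvfderiv, ContinuousLinearMap.comp_apply]
  rw [this.mfderiv_eq]
  rfl

theorem dirDeriv_add_vec (v w : Tan x) : dirDeriv f x (v + w) = dirDeriv f x v + dirDeriv f x w :=
  map_add _ _ _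

theorem dirDeriv_smul_vec (c : ℝ) (v : Tan x) : dirDeriv f x (c • v) = c * dirDeriv f x v :=
  map_smul _ _ _

theorem bracket_swap (X Y : VField M) (x : M) : bracket X Y x = -bracket Y X x :=
  VectorField.mlieBracket_swap_apply

theorem bracket_add_left (hX : SmoothFieldNear X x) (hY : SmoothFieldNear Y x) :
    bracket (X + Y) Z x = bracket X Z x + bracket Y Z x :=
  VectorField.mlieBracket_add_left hX.mdiff hY.mdiff

theorem bracket_add_right (hX : SmoothFieldNear X x) (hY : SmoothFieldNear Y x) :
    bracket Z (X + Y) x = bracket Z X x + bracket Z Y x :=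
  VectorField.mlieBracket_add_right hX.mdiff hY.mdiff

theorem bracket_smul_right (hf : SmoothFunNear f x) (hX : SmoothFieldNear X x) :
    bracket Z (f • X) x = dirDeriv f x (Z x) • X x + f x • bracket Z X x :=
  VectorField.mlieBracket_smul_right hf.mdiff hX.mdiff

theorem bracket_smul_left (hf : SmoothFunNear f x) (hX : SmoothFieldNear X x) :
    bracket (f • X) Z x = -(dirDeriv f x (Z x)) • X x + f x • bracket X Z x :=
  VectorField.mlieBracket_smul_left hf.mdiff hX.mdiff

theorem bracket_congr {X' Y' : VField M} (hX : ∀ᶠ y in 𝓝 x, X y = X' y)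
    (hY : ∀ᶠ y in 𝓝 x, Y y = Y' y) : bracket X Y x = bracket X' Y' x :=
  Filter.EventuallyEq.mlieBracket_vectorField_eq hX hY

theorem jacobi (hX : SmoothFieldNear X x) (hY : SmoothFieldNear Y x) (hZ : SmoothFieldNear Z x) :
    bracket X (bracket Y Z) x = bracket (bracket X Y) Z x + bracket Y (bracket X Z) x := by
  have : IsManifold (𝓡 4) (minSmoothness ℝ 3) M := by
    simp only [minSmoothness_of_isRCLikeNormedField]
    exact IsManifold.of_le (n := ∞) (WithTop.coe_le_coe.2 le_top)
  have key : ∀ {V : VField M}, SmoothFieldNear V x → ContMDiffAt (𝓡 4) (𝓡 4).tangent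
      (minSmoothness ℝ 2) (fun z => (⟨z, V z⟩ : TangentBundle (𝓡 4) M)) x := fun hV => by
    simp only [minSmoothness_of_isRCLikeNormedField]
    exact hV.self_of_nhds.of_le (WithTop.coe_le_coe.2 le_top)
  exact VectorField.leibniz_identity_mlieBracket_apply (key hX) (key hY) (key hZ)

/-! ### Local frames and tensoriality -/

/-- The local frame of the tangent bundle given by the chart at `x₀`. -/
def frame (x₀ : M) (i : Fin 4) : VField M :=
  (trivializationAt E4 (TangentSpace (𝓡 4)) x₀).localFrame
    (EuclideanSpace.basisFun (Fin 4) ℝ).toBasis i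

/-- The domain of the frame `frame x₀`. -/
def frameDom (x₀ : M) : Set M := (trivializationAt E4 (TangentSpace (𝓡 4) (M := M)) x₀).baseSet

theorem frameDom_mem (x₀ : M) : frameDom x₀ ∈ 𝓝 x₀ :=
  (trivializationAt E4 (TangentSpace (𝓡 4)) x₀).open_baseSet.mem_nhds
    (FiberBundle.mem_baseSet_trivializationAt E4 _ x₀)

/-- The basis of the tangent space at `y` consisting of the values of the frame. -/
def frameBasis {x₀ y : M} (hy : y ∈ frameDom x₀) : Module.Basis (Fin 4) ℝ (Tan y) :=
  (trivializationAt E4 (TangentSpace (𝓡 4)) x₀).basisAt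
    (EuclideanSpace.basisFun (Fin 4) ℝ).toBasis hy

theorem frameBasis_apply {x₀ y : M} (hy : y ∈ frameDom x₀) (i : Fin 4) :
    frameBasis hy i = frame x₀ i y :=
  (Bundle.Trivialization.localFrame_apply_of_mem_baseSet _ _ hy).symm

/-- The components of a vector in the frame `frame x₀`. -/
def frameCoeff (x₀ : M) (i : Fin 4) (y : M) : Tan y →ₗ[ℝ] ℝ :=
  (trivializationAt E4 (TangentSpace (𝓡 4)) x₀).localFrameCoeff (𝓡 4)
    (EuclideanSpace.basisFun (Fin 4) ℝ).toBasis i y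

theorem frameCoeff_eq {x₀ y : M} (hy : y ∈ frameDom x₀) (i : Fin 4) (v : Tan y) :
    frameCoeff x₀ i y v = (frameBasis hy).repr v i := by
  have := Bundle.Trivialization.localFrameCoeff_apply_of_mem_baseSet (I := 𝓡 4)
    (trivializationAt E4 (TangentSpace (𝓡 4)) x₀)
    (EuclideanSpace.basisFun (Fin 4) ℝ).toBasis hy (FiberBundle.extend E4 v) i
  rw [FiberBundle.extend_apply_self] at this
  exact this

theorem smooth_frame (x₀ : M) (i : Fin 4) : SmoothFieldNear (frame x₀ i) x₀ :=
  Filter.eventually_of_mem (frameDom_mem x₀) fun _ hy => contMDiffAt_localFrame_of_mem ∞ _ _ _ hy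

theorem smooth_frameCoeff (x₀ : M) (i : Fin 4) (hX : SmoothFieldNear X x₀) :
    SmoothFunNear (fun y => frameCoeff x₀ i y (X y)) x₀ := by
  filter_upwards [frameDom_mem x₀, hX] with y hy hXy
  exact contMDiffAt_localFrameCoeff _ hy hXy i

theorem eq_sum_frame (X : VField M) {x₀ y : M} (hy : y ∈ frameDom x₀) :
    X y = ∑ i, frameCoeff x₀ i y (X y) • frame x₀ i y :=
  Bundle.Trivialization.eq_sum_localFrameCoeff_smul hy

theorem smoothFieldNear_of_coeff {x₀ : M}
    (hX : ∀ i, SmoothFunNear (fun y => frameCoeff x₀ i y (X y)) x₀) : SmoothFieldNear X x₀ :=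
  (SmoothFieldNear.sum fun i => (hX i).smul (smooth_frame x₀ i)).congr
    (Filter.eventually_of_mem (frameDom_mem x₀) fun _ hy => eq_sum_frame X hy)

theorem smooth_extend (v : Tan x) :
    SmoothFieldNear (FiberBundle.extend E4 v : VField M) x := by
  obtain ⟨s, hs, h⟩ := FiberBundle.exists_contMDiffOn_extend (k := ∞) (𝓡 4) E4 v
  filter_upwards [eventually_mem_nhds_iff.2 hs] with y hy using h.contMDiffAt hy

/-- The derivative of a function along a field is read off from `[X, fY] = f[X,Y] + (d_X f)Y`,
for a field `Y` of a local frame. -/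
theorem SmoothFunNear.dirDeriv (hf : SmoothFunNear f x) (hX : SmoothFieldNear X x) :
    SmoothFunNear (fun y => dirDeriv f y (X y)) x := by
  have hY := smooth_frame x 0
  have h1 := (hX.bracket (hf.smul hY)).sub (SmoothFunNear.smul hf (hX.bracket hY))
  refine (smooth_frameCoeff x 0 h1).congr ?_
  filter_upwards [hf.eventually, hY.eventually, frameDom_mem x] with y hfy hYy hy
  have : (NeutralGeometry.bracket X (f • frame x 0) - f • NeutralGeometry.bracket X (frame x 0)) y
      = NeutralGeometry.dirDeriv f y (X y) • frame x 0 y := by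
    simp only [Pi.sub_apply, bracket_smul_right hfy hYy, Pi.smul_apply']
    abel
  rw [this, map_smul, frameCoeff_eq hy, ← frameBasis_apply hy]
  simp

/-- An operation on germs at `x` of smooth vector fields that is additive and linear over functions
depends on the value at `x` only. -/
theorem tensorial_pointwise {A : Type*} [AddCommGroup A] [Module ℝ A] (Φ : VField M → A)
    (hadd : ∀ X Y, SmoothFieldNear X x → SmoothFieldNear Y x → Φ (X + Y) = Φ X + Φ Y)
    (hsmul : ∀ (f : M → ℝ) X, SmoothFunNear f x → SmoothFieldNear X x → Φ (f • X) = f x • Φ X)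
    (hX : SmoothFieldNear X x) (hY : SmoothFieldNear Y x) (hXY : X x = Y x) : Φ X = Φ Y := by
  classical
  have hloc : ∀ {X Y : VField M}, SmoothFieldNear X x → SmoothFieldNear Y x →
      (∀ᶠ y in 𝓝 x, X y = Y y) → Φ X = Φ Y := by
    intro X Y hX hY hXY
    -- a function that equals `1` near `x`; being smooth near `x`, it need not be smooth elsewhere
    let ψ : M → ℝ := fun y => if X y = Y y then 1 else 0
    have hψ : SmoothFunNear ψ x :=
      (smoothFunNear_const 1).congr (hXY.mono fun y hy => by simp [ψ, hy])
    have hψx : ψ x = 1 := by simp [ψ, hXY.self_of_nhds]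
    have : ψ • X = ψ • Y := by
      funext y
      simp only [ψ, Pi.smul_apply']
      split_ifs with h <;> simp [h]
    calc Φ X = Φ (ψ • X) := by rw [hsmul ψ X hψ hX, hψx, one_smul]
      _ = Φ (ψ • Y) := by rw [this]
      _ = Φ Y := by rw [hsmul ψ Y hψ hY, hψx, one_smul]
  have hsum : ∀ (s : Finset (Fin 4)) (F : Fin 4 → VField M), (∀ i, SmoothFieldNear (F i) x) →
      Φ (fun y => ∑ i ∈ s, F i y) = ∑ i ∈ s, Φ (F i) := by
    intro s F hF
    induction s using Finset.induction_on with
    | empty =>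
      have := hsmul 0 (F 0) (smoothFunNear_const 0) (hF 0)
      simp only [zero_smul, Pi.zero_apply] at this
      rw [Finset.sum_empty]
      exact this
    | insert a s ha ih =>
      simp only [Finset.sum_insert ha, ← ih]
      exact hadd _ _ (hF a) (SmoothFieldNear.sum hF)
  have hexp : ∀ {X : VField M}, SmoothFieldNear X x →
      Φ X = ∑ i, frameCoeff x i x (X x) • Φ (frame x i) := by
    intro X hX
    have hF : ∀ i, SmoothFieldNear ((fun y => frameCoeff x i y (X y)) • frame x i) x :=
      fun i => SmoothFunNear.smul (smooth_frameCoeff x i hX) (smooth_frame x i)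
    rw [hloc hX (SmoothFieldNear.sum hF) (Filter.eventually_of_mem (frameDom_mem x)
      fun y hy => eq_sum_frame X hy), hsum _ _ hF]
    exact Finset.sum_congr rfl fun i _ =>
      hsmul _ _ (smooth_frameCoeff x i hX) (smooth_frame x i)
  rw [hexp hX, hexp hY, hXY]

/-- The linear map defined by a tensorial operation on germs of vector fields. -/
def tensorialMap {A : Type*} [AddCommGroup A] [Module ℝ A] (Φ : VField M → A)
    (hadd : ∀ X Y, SmoothFieldNear X x → SmoothFieldNear Y x → Φ (X + Y) = Φ X + Φ Y)
    (hsmul : ∀ (f : M → ℝ) X, SmoothFunNear f x → SmoothFieldNear X x → Φ (f • X) = f x • Φ X) :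
    Tan x →ₗ[ℝ] A where
  toFun v := Φ (FiberBundle.extend E4 v)
  map_add' v w := by
    rw [← hadd _ _ (smooth_extend v) (smooth_extend w)]
    exact tensorial_pointwise Φ hadd hsmul (smooth_extend _)
      ((smooth_extend v).add (smooth_extend w)) (by simp)
  map_smul' c v := by
    have h := hsmul (fun _ => c) _ (smoothFunNear_const c) (smooth_extend v)
    simp only [RingHom.id_apply]
    rw [← h]
    exact tensorial_pointwise Φ hadd hsmul (smooth_extend _)
      (SmoothFunNear.smul (smoothFunNear_const c) (smooth_extend v)) (by simp)

theorem tensorialMap_apply {A : Type*} [AddCommGroup A] [Module ℝ A] (Φ : VField M → A)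
    (hadd : ∀ X Y, SmoothFieldNear X x → SmoothFieldNear Y x → Φ (X + Y) = Φ X + Φ Y)
    (hsmul : ∀ (f : M → ℝ) X, SmoothFunNear f x → SmoothFieldNear X x → Φ (f • X) = f x • Φ X)
    (hX : SmoothFieldNear X x) : tensorialMap Φ hadd hsmul (X x) = Φ X :=
  tensorial_pointwise Φ hadd hsmul (smooth_extend _) hX (by simp)

end Germs

section LeviCivita

variable {M : Type*} [TopologicalSpace M] [ChartedSpace E4 M] [IsManifold (𝓡 4) ∞ M]
variable {x : M} {X Y Z u v w : VField M} {f h : M → ℝ} {U : Set M}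

/-! ### Determinants and inverses of matrices of smooth functions -/

theorem SmoothFunNear.det {A : M → Matrix (Fin 4) (Fin 4) ℝ}
    (hA : ∀ i j, SmoothFunNear (fun y => A y i j) x) : SmoothFunNear (fun y => (A y).det) x := by
  simp only [Matrix.det_apply']
  exact SmoothFunNear.sum fun σ => (smoothFunNear_const _).mul (SmoothFunNear.prod fun i => hA _ _)

theorem SmoothFunNear.matrix_inv {A : M → Matrix (Fin 4) (Fin 4) ℝ}
    (hA : ∀ i j, SmoothFunNear (fun y => A y i j) x) (h0 : (A x).det ≠ 0) (i j : Fin 4) :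
    SmoothFunNear (fun y => (A y)⁻¹ i j) x := by
  simp only [Matrix.inv_def, Ring.inverse_eq_inv', Matrix.smul_apply, smul_eq_mul,
    Matrix.adjugate_apply]
  refine ((SmoothFunNear.det hA).inv h0).mul (SmoothFunNear.det fun k l => ?_)
  by_cases hk : k = j
  · subst hk
    simpa using smoothFunNear_const _
  · simpa [Matrix.updateRow_ne hk] using hA k l

/-! ### Nondegeneracy of the metric -/

variable (g : NeutralMetric M)

theorem inner_nondegenerate {z : Tan x} (hz : ∀ a, g.inner x z a = 0) : z = 0 := by
  obtain ⟨e, he⟩ := g.neutral x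
  rw [← e.sum_repr z]
  refine Finset.sum_eq_zero fun i _ => ?_
  have h := hz (e i)
  rw [← e.sum_repr z] at h
  simp only [map_sum, map_smul, sum_apply, smul_apply, he,
    smul_eq_mul] at h
  simp only [mul_ite, mul_zero, Finset.sum_ite_eq', Finset.mem_univ, if_true] at h
  have : e.repr z i = 0 := by split_ifs at h <;> simpa using h
  rw [this, zero_smul]

theorem inner_ext {z z' : Tan x} (hz : ∀ a, g.inner x z a = g.inner x z' a) : z = z' :=
  sub_eq_zero.1 <| inner_nondegenerate g fun a => by simp [hz a]

theorem inner_ext_fields {z z' : Tan x}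
    (hz : ∀ w, SmoothFieldNear w x → g.inner x z (w x) = g.inner x z' (w x)) : z = z' :=
  inner_ext g fun a => by simpa using hz _ (smooth_extend a)

theorem exists_inner_eq (φ : Tan x →ₗ[ℝ] ℝ) : ∃ z : Tan x, ∀ a, g.inner x z a = φ a := by
  obtain ⟨e, he⟩ := g.neutral x
  refine ⟨∑ i, ((if i < 2 then -1 else 1) * φ (e i)) • e i, fun a => ?_⟩
  have : ((g.inner x (∑ i, ((if i < 2 then -1 else 1) * φ (e i)) • e i)).toLinearMap) = φ := by
    refine e.ext fun j => ?_
    simp only [map_sum, map_smul, ContinuousLinearMap.coe_coe, sum_apply,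
      smul_apply, he, smul_eq_mul]
    simp only [mul_ite, mul_zero, Finset.sum_ite_eq', Finset.mem_univ, if_true]
    split_ifs <;> simp
  exact LinearMap.congr_fun this a

/-- The vector representing a linear functional. -/
def sharp (φ : Tan x →ₗ[ℝ] ℝ) : Tan x := (exists_inner_eq g φ).choose

theorem inner_sharp (φ : Tan x →ₗ[ℝ] ℝ) (a : Tan x) : g.inner x (sharp g φ) a = φ a :=
  (exists_inner_eq g φ).choose_spec a

theorem SmoothFieldNear.inner (hX : SmoothFieldNear X x) (hY : SmoothFieldNear Y x) :
    SmoothFunNear (fun y => g.inner y (X y) (Y y)) x := by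
  filter_upwards [hX, hY] with y h1 h2
  have := ContMDiffAt.clm_bundle_apply₂ (F₁ := E4) (F₂ := E4) (F₃ := ℝ)
    (E₁ := fun x : M => TangentSpace (𝓡 4) x) (E₂ := fun x : M => TangentSpace (𝓡 4) x)
    (E₃ := Bundle.Trivial M ℝ) (g.smooth y) h1 h2
  exact (Bundle.contMDiffAt_section (E := Bundle.Trivial M ℝ) (F := ℝ) y).1 this

/-- A vector field is smooth if its inner products with smooth fields are. -/
theorem smoothFieldNear_of_inner
    (hX : ∀ Y, SmoothFieldNear Y x → SmoothFunNear (fun y => g.inner y (X y) (Y y)) x) :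
    SmoothFieldNear X x := by
  let G : M → Matrix (Fin 4) (Fin 4) ℝ := fun y =>
    Matrix.of fun i j => g.inner y (frame x j y) (frame x i y)
  have hG : ∀ i j, SmoothFunNear (fun y => G y i j) x := fun i j =>
    (smooth_frame x j).inner g (smooth_frame x i)
  have hdet : ∀ y ∈ frameDom x, (G y).det ≠ 0 := by
    intro y hy h0
    obtain ⟨c, hc, hc0⟩ := Matrix.exists_mulVec_eq_zero_iff.2 h0
    have hz : ∑ j, c j • frameBasis hy j = 0 := by
      refine inner_nondegenerate g fun a => ?_
      rw [← (frameBasis hy).sum_repr a, map_sum]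
      refine Finset.sum_eq_zero fun i _ => ?_
      have := congrFun hc0 i
      simp only [Matrix.mulVec, dotProduct, G, Matrix.of_apply, Pi.zero_apply] at this
      simp only [map_sum, map_smul, sum_apply, smul_apply,
        smul_eq_mul, frameBasis_apply]
      rw [show ∑ j, c j * g.inner y (frame x j y) (frame x i y) = 0 by
        rw [← this]; exact Finset.sum_congr rfl fun _ _ => mul_comm _ _, mul_zero]
    exact hc (funext fun j => by
      have := (Fintype.linearIndependent_iff.1 (frameBasis hy).linearIndependent) c hz j
      simpa using this)
  refine smoothFieldNear_of_coeff fun i => ?_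
  have h := SmoothFunNear.sum (s := Finset.univ) fun j : Fin 4 =>
    (SmoothFunNear.matrix_inv hG (hdet x (mem_of_mem_nhds (frameDom_mem x))) i j).mul
      (hX _ (smooth_frame x j))
  refine h.congr (Filter.eventually_of_mem (frameDom_mem x) fun y hy => ?_)
  have hb : (G y).mulVec (fun k => frameCoeff x k y (X y)) =
      fun j => g.inner y (X y) (frame x j y) := by
    funext j
    conv_rhs => rw [eq_sum_frame X hy]
    simp only [Matrix.mulVec, dotProduct, G, Matrix.of_apply, map_sum, map_smul,
      sum_apply, smul_apply, smul_eq_mul]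
    exact Finset.sum_congr rfl fun _ _ => mul_comm _ _
  have hinv : (G y)⁻¹.mulVec ((G y).mulVec (fun k => frameCoeff x k y (X y))) =
      fun k => frameCoeff x k y (X y) := by
    rw [Matrix.mulVec_mulVec, Matrix.nonsing_inv_mul _ (isUnit_iff_ne_zero.2 (hdet y hy)),
      Matrix.one_mulVec]
  rw [hb] at hinv
  exact (congrFun hinv i).symm

/-! ### The Levi-Civita connection -/

theorem koszul_add (hv : SmoothFieldNear v x) (hu : SmoothFieldNear u x)
    (hX : SmoothFieldNear X x) (hY : SmoothFieldNear Y x) :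
    koszul g v u (X + Y) x = koszul g v u X x + koszul g v u Y x := by
  simp only [koszul, Pi.add_apply, map_add, add_apply,
    bracket_add_left hX hY, bracket_add_right hX hY, dirDeriv_add_vec,
    dirDeriv_add (hu.inner g hX) (hu.inner g hY), dirDeriv_add (hv.inner g hX) (hv.inner g hY)]
  ring

theorem koszul_smul (hv : SmoothFieldNear v x) (hu : SmoothFieldNear u x)
    (hf : SmoothFunNear f x) (hX : SmoothFieldNear X x) :
    koszul g v u (f • X) x = f x * koszul g v u X x := by
  simp only [koszul, Pi.smul_apply', map_smul, smul_apply, smul_eq_mul,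
    bracket_smul_left hf hX, bracket_smul_right hf hX, dirDeriv_smul_vec, map_add,
    dirDeriv_mul hf (hu.inner g hX), dirDeriv_mul hf (hv.inner g hX)]
  ring

/-- The Koszul formula holds for `nabla`: its right-hand side is tensorial in `w`, so that a vector
as in the definition of `nabla` exists. -/
theorem nabla_spec (hv : SmoothFieldNear v x) (hu : SmoothFieldNear u x)
    (hw : SmoothFieldNear w x) : 2 * g.inner x (nabla g v u x) (w x) = koszul g v u w x := by
  let φ : Tan x →ₗ[ℝ] ℝ := tensorialMap (fun w => koszul g v u w x)
    (fun X Y hX hY => koszul_add g hv hu hX hY)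
    (fun f X hf hX => by rw [koszul_smul g hv hu hf hX, smul_eq_mul])
  have hφ : ∀ w, SmoothFieldNear w x → φ (w x) = koszul g v u w x := fun w hw =>
    tensorialMap_apply _ _ _ hw
  have hex : ∃ z : Tan x, ∀ (U : Set M) (w : VField M), IsOpen U → x ∈ U → SmoothFieldOn U w →
      2 * g.inner x z (w x) = koszul g v u w x := by
    refine ⟨sharp g ((1 / 2 : ℝ) • φ), fun U w hU hx hw => ?_⟩
    rw [inner_sharp, LinearMap.smul_apply, hφ w (hw.near hU hx), smul_eq_mul]
    ring
  obtain ⟨U, hU, hx, hwU⟩ := hw.exists_open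
  exact Classical.epsilon_spec hex U w hU hx hwU

theorem nabla_congr {u' v' : VField M} (hu : ∀ᶠ y in 𝓝 x, u y = u' y)
    (hv : ∀ᶠ y in 𝓝 x, v y = v' y) : nabla g v u x = nabla g v' u' x := by
  have : ∀ w, koszul g v u w x = koszul g v' u' w x := by
    intro w
    have hw : ∀ᶠ y in 𝓝 x, w y = w y := Filter.Eventually.of_forall fun _ => rfl
    simp only [koszul, hu.self_of_nhds, hv.self_of_nhds, bracket_congr hu hw, bracket_congr hw hv,
      bracket_congr hv hu]
    rw [dirDeriv_congr (f := fun y => g.inner y (u y) (w y)) (hu.mono fun y hy => by rw [hy]),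
      dirDeriv_congr (f := fun y => g.inner y (v y) (w y)) (hv.mono fun y hy => by rw [hy]),
      dirDeriv_congr (f := fun y => g.inner y (v y) (u y))
        ((hu.and hv).mono fun y hy => by rw [hy.1, hy.2])]
  simp only [nabla, this]

theorem nabla_add_right (hv : SmoothFieldNear v x) (hX : SmoothFieldNear X x)
    (hY : SmoothFieldNear Y x) : nabla g v (X + Y) x = nabla g v X x + nabla g v Y x := by
  refine inner_ext_fields g fun w hw => ?_
  have h1 := nabla_spec g hv (hX.add hY) hw
  have h2 := nabla_spec g hv hX hw
  have h3 := nabla_spec g hv hY hw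
  simp only [koszul, Pi.add_apply, map_add, add_apply,
    bracket_add_left hX hY, bracket_add_right hX hY, dirDeriv_add_vec,
    dirDeriv_add (hX.inner g hw) (hY.inner g hw),
    dirDeriv_add (hv.inner g hX) (hv.inner g hY)] at h1 h2 h3 ⊢
  linarith

theorem nabla_leibniz (hv : SmoothFieldNear v x) (hf : SmoothFunNear f x)
    (hX : SmoothFieldNear X x) :
    nabla g v (f • X) x = f x • nabla g v X x + dirDeriv f x (v x) • X x := by
  refine inner_ext_fields g fun w hw => ?_
  have h1 := nabla_spec g hv (hf.smul hX) hw
  have h2 := nabla_spec g hv hX hw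
  simp only [koszul, Pi.smul_apply', map_smul, smul_apply, smul_eq_mul,
    bracket_smul_left hf hX, bracket_smul_right hf hX, dirDeriv_smul_vec, map_add,
    add_apply,
    dirDeriv_mul hf (hX.inner g hw), dirDeriv_mul hf (hv.inner g hX)] at h1 h2 ⊢
  have h3 := g.symm x (w x) (X x)
  rw [h3] at h1
  linear_combination h1 / 2 - f x * h2 / 2

theorem nabla_add_left (hX : SmoothFieldNear X x) (hY : SmoothFieldNear Y x)
    (hu : SmoothFieldNear u x) : nabla g (X + Y) u x = nabla g X u x + nabla g Y u x := by
  refine inner_ext_fields g fun w hw => ?_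
  have h1 := nabla_spec g (hX.add hY) hu hw
  have h2 := nabla_spec g hX hu hw
  have h3 := nabla_spec g hY hu hw
  simp only [koszul, Pi.add_apply, map_add, add_apply,
    bracket_add_left hX hY, bracket_add_right hX hY, dirDeriv_add_vec,
    dirDeriv_add (hX.inner g hw) (hY.inner g hw),
    dirDeriv_add (hX.inner g hu) (hY.inner g hu)] at h1 h2 h3 ⊢
  linarith

theorem nabla_smul_left (hf : SmoothFunNear f x) (hX : SmoothFieldNear X x)
    (hu : SmoothFieldNear u x) : nabla g (f • X) u x = f x • nabla g X u x := by
  refine inner_ext_fields g fun w hw => ?_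
  have h1 := nabla_spec g (hf.smul hX) hu hw
  have h2 := nabla_spec g hX hu hw
  simp only [koszul, Pi.smul_apply', map_smul, smul_apply, smul_eq_mul,
    bracket_smul_left hf hX, bracket_smul_right hf hX, dirDeriv_smul_vec, map_add,
    dirDeriv_mul hf (hX.inner g hw), dirDeriv_mul hf (hX.inner g hu)] at h1 h2 ⊢
  have h3 := g.symm x (w x) (X x)
  have h4 := g.symm x (u x) (X x)
  rw [h3, h4] at h1
  linear_combination h1 / 2 - f x * h2 / 2

theorem nabla_congr_left {v' : VField M} (hv : SmoothFieldNear v x) (hv' : SmoothFieldNear v' x)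
    (hu : SmoothFieldNear u x) (h : v x = v' x) : nabla g v u x = nabla g v' u x :=
  tensorial_pointwise (fun v => nabla g v u x) (fun _ _ hX hY => nabla_add_left g hX hY hu)
    (fun _ _ hf hX => nabla_smul_left g hf hX hu) hv hv' h

theorem nabla_torsionfree (hX : SmoothFieldNear X x) (hY : SmoothFieldNear Y x) :
    nabla g X Y x - nabla g Y X x = bracket X Y x := by
  refine inner_ext_fields g fun w hw => ?_
  have h1 := nabla_spec g hX hY hw
  have h2 := nabla_spec g hY hX hw
  have h3 : (fun y => g.inner y (Y y) (X y)) = fun y => g.inner y (X y) (Y y) :=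
    funext fun y => g.symm y _ _
  simp only [koszul, h3, bracket_swap w Y, bracket_swap w X, bracket_swap Y X, map_neg,
    map_sub, sub_apply] at h1 h2 ⊢
  have h4 := g.symm x (w x) (bracket X Y x)
  linear_combination h1 / 2 - h2 / 2 + h4

theorem nabla_metric (hv : SmoothFieldNear v x) (hX : SmoothFieldNear X x)
    (hY : SmoothFieldNear Y x) :
    dirDeriv (fun y => g.inner y (X y) (Y y)) x (v x) =
      g.inner x (nabla g v X x) (Y x) + g.inner x (X x) (nabla g v Y x) := by
  have h1 := nabla_spec g hv hX hY
  have h2 := nabla_spec g hv hY hX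
  have h3 : (fun y => g.inner y (Y y) (X y)) = fun y => g.inner y (X y) (Y y) :=
    funext fun y => g.symm y _ _
  simp only [koszul, h3, bracket_swap Y v, bracket_swap X v, bracket_swap Y X, map_neg] at h1 h2
  rw [g.symm x (X x) (nabla g v Y x)]
  linear_combination -h1 / 2 - h2 / 2

theorem SmoothFieldNear.nabla (hv : SmoothFieldNear v x) (hu : SmoothFieldNear u x) :
    SmoothFieldNear (nabla g v u) x := by
  refine smoothFieldNear_of_inner g fun w hw => ?_
  have h : SmoothFunNear (fun y => (1 / 2 : ℝ) * koszul g v u w y) x := by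
    refine (smoothFunNear_const _).mul ?_
    exact ((((((hu.inner g hw).dirDeriv hv).add ((hv.inner g hw).dirDeriv hu)).sub
      ((hv.inner g hu).dirDeriv hw)).add (hu.inner g (hw.bracket hv))).add
      (hw.inner g (hv.bracket hu))).sub (hv.inner g (hu.bracket hw))
  refine h.congr ?_
  filter_upwards [hv.eventually, hu.eventually, hw.eventually] with y h1 h2 h3
  rw [← nabla_spec g h1 h2 h3]
  ring

end LeviCivita

/-! ### The curvature tensor -/

section CurvatureTensor

variable {M : Type*} [TopologicalSpace M] [ChartedSpace E4 M] [IsManifold (𝓡 4) ∞ M]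
variable {x : M} {X Y Z u v w : VField M} {f h : M → ℝ} {U : Set M}

/-- The derivative along a bracket is read off from the Jacobi identity for `X`, `Y` and `fZ`,
with `Z` a field of a local frame. -/
theorem dirDeriv_bracket (hX : SmoothFieldNear X x) (hY : SmoothFieldNear Y x)
    (hf : SmoothFunNear f x) :
    dirDeriv f x (bracket X Y x) = dirDeriv (fun y => dirDeriv f y (Y y)) x (X x)
      - dirDeriv (fun y => dirDeriv f y (X y)) x (Y x) := by
  have hZ := smooth_frame x 0
  set Z := frame x 0
  have key : ∀ {V : VField M}, SmoothFieldNear V x → ∀ᶠ y in 𝓝 x, bracket V (f • Z) y =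
      (f • bracket V Z + (fun y => dirDeriv f y (V y)) • Z) y := by
    intro V hV
    filter_upwards [hf.eventually, hZ.eventually] with y h1 h2
    simp only [bracket_smul_right h1 h2, Pi.add_apply, Pi.smul_apply']
    abel
  have hrfl : ∀ V : VField M, ∀ᶠ y in 𝓝 x, V y = V y := fun V => Filter.Eventually.of_forall
    fun _ => rfl
  have h1 := jacobi hX hY (hf.smul hZ)
  have h2 := jacobi hX hY hZ
  rw [bracket_congr (hrfl X) (key hY), bracket_congr (hrfl Y) (key hX),
    bracket_smul_right hf hZ,
    bracket_add_right (hf.smul (hY.bracket hZ)) ((hf.dirDeriv hY).smul hZ),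
    bracket_add_right (hf.smul (hX.bracket hZ)) ((hf.dirDeriv hX).smul hZ),
    bracket_smul_right hf (hY.bracket hZ), bracket_smul_right hf (hX.bracket hZ),
    bracket_smul_right (hf.dirDeriv hY) hZ, bracket_smul_right (hf.dirDeriv hX) hZ, h2] at h1
  have h3 : (dirDeriv f x (bracket X Y x) - (dirDeriv (fun y => dirDeriv f y (Y y)) x (X x)
      - dirDeriv (fun y => dirDeriv f y (X y)) x (Y x))) • Z x = 0 := by
    linear_combination (norm := module) -h1
  have hne : Z x ≠ 0 := by
    simp only [Z, ← frameBasis_apply (mem_of_mem_nhds (frameDom_mem x))]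
    exact (frameBasis _).ne_zero 0
  exact sub_eq_zero.1 ((smul_eq_zero.1 h3).resolve_right hne)

variable (g : NeutralMetric M)

theorem nabla_neg_left (hX : SmoothFieldNear X x) (hu : SmoothFieldNear u x) :
    nabla g (-X) u x = -nabla g X u x := by
  have := nabla_smul_left g (smoothFunNear_const (-1)) hX hu
  have h2 : (fun _ : M => (-1 : ℝ)) • X = -X := by funext y; simp
  rw [h2] at this
  simpa using this

theorem nabla_sub_left (hX : SmoothFieldNear X x) (hY : SmoothFieldNear Y x)
    (hu : SmoothFieldNear u x) : nabla g (X - Y) u x = nabla g X u x - nabla g Y u x := by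
  rw [sub_eq_add_neg, nabla_add_left g hX hY.neg hu, nabla_neg_left g hY hu, sub_eq_add_neg]

theorem nabla_neg_right (hv : SmoothFieldNear v x) (hX : SmoothFieldNear X x) :
    nabla g v (-X) x = -nabla g v X x := by
  have := nabla_leibniz g hv (smoothFunNear_const (-1)) hX
  have h2 : (fun _ : M => (-1 : ℝ)) • X = -X := by funext y; simp
  rw [h2, dirDeriv_const] at this
  simpa using this

theorem nabla_sub_right (hv : SmoothFieldNear v x) (hX : SmoothFieldNear X x)
    (hY : SmoothFieldNear Y x) : nabla g v (X - Y) x = nabla g v X x - nabla g v Y x := by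
  rw [sub_eq_add_neg, nabla_add_right g hv hX hY.neg, nabla_neg_right g hv hY, sub_eq_add_neg]

theorem nabla_congr_right {X' : VField M} (hX : ∀ᶠ y in 𝓝 x, X y = X' y) :
    nabla g v X x = nabla g v X' x :=
  nabla_congr g hX (Filter.Eventually.of_forall fun _ => rfl)

theorem curvField_swap (hu : SmoothFieldNear u x) (hv : SmoothFieldNear v x)
    (hw : SmoothFieldNear w x) : curvField g u v w x = -curvField g v u w x := by
  simp only [curvField]
  rw [nabla_congr_left g (hu.bracket hv) (hv.bracket hu).neg hw (bracket_swap u v x),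
    nabla_neg_left g (hv.bracket hu) hw]
  abel

theorem curvField_add_left (hX : SmoothFieldNear X x) (hY : SmoothFieldNear Y x)
    (hv : SmoothFieldNear v x) (hw : SmoothFieldNear w x) :
    curvField g (X + Y) v w x = curvField g X v w x + curvField g Y v w x := by
  simp only [curvField]
  rw [nabla_congr_left g ((hX.add hY).bracket hv) ((hX.bracket hv).add (hY.bracket hv)) hw
      (bracket_add_left hX hY), nabla_add_left g (hX.bracket hv) (hY.bracket hv) hw,
    nabla_add_left g hX hY (hv.nabla g hw),
    nabla_congr_right g (X := nabla g (X + Y) w) (X' := nabla g X w + nabla g Y w) (by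
      filter_upwards [hX.eventually, hY.eventually, hw.eventually] with y h1 h2 h3
      exact nabla_add_left g h1 h2 h3),
    nabla_add_right g hv (hX.nabla g hw) (hY.nabla g hw)]
  abel

theorem curvField_smul_left (hf : SmoothFunNear f x) (hX : SmoothFieldNear X x)
    (hv : SmoothFieldNear v x) (hw : SmoothFieldNear w x) :
    curvField g (f • X) v w x = f x • curvField g X v w x := by
  simp only [curvField]
  have hb : bracket (f • X) v x = (f • bracket X v - (fun y => dirDeriv f y (v y)) • X) x := by
    simp only [bracket_smul_left hf hX, Pi.sub_apply, Pi.smul_apply']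
    module
  rw [nabla_congr_left g ((hf.smul hX).bracket hv)
      ((hf.smul (hX.bracket hv)).sub ((hf.dirDeriv hv).smul hX)) hw hb,
    nabla_sub_left g (hf.smul (hX.bracket hv)) ((hf.dirDeriv hv).smul hX) hw,
    nabla_smul_left g hf (hX.bracket hv) hw, nabla_smul_left g (hf.dirDeriv hv) hX hw,
    nabla_smul_left g hf hX (hv.nabla g hw),
    nabla_congr_right g (X := nabla g (f • X) w) (X' := f • nabla g X w) (by
      filter_upwards [hf.eventually, hX.eventually, hw.eventually] with y h1 h2 h3
      exact nabla_smul_left g h1 h2 h3),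
    nabla_leibniz g hv hf (hX.nabla g hw)]
  module

theorem curvField_add_right (hu : SmoothFieldNear u x) (hv : SmoothFieldNear v x)
    (hX : SmoothFieldNear X x) (hY : SmoothFieldNear Y x) :
    curvField g u v (X + Y) x = curvField g u v X x + curvField g u v Y x := by
  have key : ∀ {V : VField M}, SmoothFieldNear V x →
      ∀ᶠ y in 𝓝 x, nabla g V (X + Y) y = (nabla g V X + nabla g V Y) y := by
    intro V hV
    filter_upwards [hV.eventually, hX.eventually, hY.eventually] with y h1 h2 h3
    exact nabla_add_right g h1 h2 h3
  simp only [curvField]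
  rw [nabla_congr_right g (key hu), nabla_congr_right g (key hv),
    nabla_add_right g hv (hu.nabla g hX) (hu.nabla g hY),
    nabla_add_right g hu (hv.nabla g hX) (hv.nabla g hY),
    nabla_add_right g (hu.bracket hv) hX hY]
  abel

theorem curvField_smul_right (hf : SmoothFunNear f x) (hu : SmoothFieldNear u x)
    (hv : SmoothFieldNear v x) (hX : SmoothFieldNear X x) :
    curvField g u v (f • X) x = f x • curvField g u v X x := by
  have key : ∀ {V : VField M}, SmoothFieldNear V x →
      ∀ᶠ y in 𝓝 x, nabla g V (f • X) y =
        (f • nabla g V X + (fun y => dirDeriv f y (V y)) • X) y := by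
    intro V hV
    filter_upwards [hV.eventually, hX.eventually, hf.eventually] with y h1 h2 h3
    exact nabla_leibniz g h1 h3 h2
  simp only [curvField]
  rw [nabla_congr_right g (key hu), nabla_congr_right g (key hv),
    nabla_add_right g hv (hf.smul (hu.nabla g hX)) ((hf.dirDeriv hu).smul hX),
    nabla_add_right g hu (hf.smul (hv.nabla g hX)) ((hf.dirDeriv hv).smul hX),
    nabla_leibniz g hv hf (hu.nabla g hX), nabla_leibniz g hu hf (hv.nabla g hX),
    nabla_leibniz g hv (hf.dirDeriv hu) hX, nabla_leibniz g hu (hf.dirDeriv hv) hX,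
    nabla_leibniz g (hu.bracket hv) hf hX, dirDeriv_bracket hu hv hf]
  module

theorem curvField_congr_left (hX : SmoothFieldNear X x) (hY : SmoothFieldNear Y x)
    (hv : SmoothFieldNear v x) (hw : SmoothFieldNear w x) (hXY : X x = Y x) :
    curvField g X v w x = curvField g Y v w x :=
  tensorial_pointwise (fun X => curvField g X v w x)
    (fun _ _ hX hY => curvField_add_left g hX hY hv hw)
    (fun _ _ hf hX => curvField_smul_left g hf hX hv hw) hX hY hXY

theorem curvField_congr_right (hX : SmoothFieldNear X x) (hY : SmoothFieldNear Y x)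
    (hu : SmoothFieldNear u x) (hv : SmoothFieldNear v x) (hXY : X x = Y x) :
    curvField g u v X x = curvField g u v Y x :=
  tensorial_pointwise (fun X => curvField g u v X x)
    (fun _ _ hX hY => curvField_add_right g hu hv hX hY)
    (fun _ _ hf hX => curvField_smul_right g hf hu hv hX) hX hY hXY

/-- The curvature tensor at a point does not depend on the extensions of the vectors. -/
theorem curv_eq (hu : SmoothFieldNear u x) (hv : SmoothFieldNear v x) (hw : SmoothFieldNear w x) :
    curv g x (u x) (v x) (w x) = curvField g u v w x := by
  have hu' := smooth_extend (u x)
  have hv' := smooth_extend (v x)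
  have hw' := smooth_extend (w x)
  simp only [curv]
  rw [curvField_congr_left g hu' hu hv' hw' (by simp),
    curvField_swap g hu hv' hw', curvField_congr_left g hv' hv hu hw' (by simp),
    ← curvField_swap g hu hv hw', curvField_congr_right g hw' hw hu hv (by simp)]

theorem curv_swap (a b c : Tan x) : curv g x a b c = -curv g x b a c :=
  curvField_swap g (smooth_extend a) (smooth_extend b) (smooth_extend c)

theorem curv_add_left (a a' b c : Tan x) :
    curv g x (a + a') b c = curv g x a b c + curv g x a' b c := by
  have h := curvField_add_left g (smooth_extend a) (smooth_extend a') (smooth_extend b)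
    (smooth_extend c)
  rw [← curv_eq g ((smooth_extend a).add (smooth_extend a')) (smooth_extend b)
    (smooth_extend c)] at h
  simp only [Pi.add_apply, FiberBundle.extend_apply_self] at h
  exact h

theorem curv_smul_left (r : ℝ) (a b c : Tan x) :
    curv g x (r • a) b c = r • curv g x a b c := by
  have h := curvField_smul_left g (smoothFunNear_const r) (smooth_extend a) (smooth_extend b)
    (smooth_extend c)
  rw [← curv_eq g ((smoothFunNear_const r).smul (smooth_extend a)) (smooth_extend b)
    (smooth_extend c)] at h
  simp only [Pi.smul_apply', FiberBundle.extend_apply_self] at h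
  exact h

theorem curv_add_mid (a b b' c : Tan x) :
    curv g x a (b + b') c = curv g x a b c + curv g x a b' c := by
  rw [curv_swap, curv_add_left, curv_swap g b, curv_swap g b']; abel

theorem curv_smul_mid (r : ℝ) (a b c : Tan x) :
    curv g x a (r • b) c = r • curv g x a b c := by
  rw [curv_swap, curv_smul_left, curv_swap g b]; simp

theorem curv_add_right (a b c c' : Tan x) :
    curv g x a b (c + c') = curv g x a b c + curv g x a b c' := by
  have h := curvField_add_right g (smooth_extend a) (smooth_extend b) (smooth_extend c)
    (smooth_extend c')
  rw [← curv_eq g (smooth_extend a) (smooth_extend b)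
    ((smooth_extend c).add (smooth_extend c'))] at h
  simp only [Pi.add_apply, FiberBundle.extend_apply_self] at h
  exact h

theorem curv_smul_right (r : ℝ) (a b c : Tan x) :
    curv g x a b (r • c) = r • curv g x a b c := by
  have h := curvField_smul_right g (smoothFunNear_const r) (smooth_extend a) (smooth_extend b)
    (smooth_extend c)
  rw [← curv_eq g (smooth_extend a) (smooth_extend b)
    ((smoothFunNear_const r).smul (smooth_extend c))] at h
  simp only [Pi.smul_apply', FiberBundle.extend_apply_self] at h
  exact h

theorem SmoothFieldNear.curvField (hu : SmoothFieldNear u x) (hv : SmoothFieldNear v x)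
    (hw : SmoothFieldNear w x) : SmoothFieldNear (curvField g u v w) x :=
  ((hv.nabla g (hu.nabla g hw)).sub (hu.nabla g (hv.nabla g hw))).add
    ((hu.bracket hv).nabla g hw)

/-- The curvature operators are skew-adjoint, since the connection is metric. -/
theorem inner_curv_skew (a b c d : Tan x) :
    g.inner x (curv g x a b c) d = -g.inner x c (curv g x a b d) := by
  obtain ⟨u, hua, hu⟩ : ∃ u : VField M, u x = a ∧ SmoothFieldNear u x :=
    ⟨_, FiberBundle.extend_apply_self E4 a, smooth_extend a⟩
  obtain ⟨v, hva, hv⟩ : ∃ u : VField M, u x = b ∧ SmoothFieldNear u x :=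
    ⟨_, FiberBundle.extend_apply_self E4 b, smooth_extend b⟩
  obtain ⟨X, hXa, hX⟩ : ∃ u : VField M, u x = c ∧ SmoothFieldNear u x :=
    ⟨_, FiberBundle.extend_apply_self E4 c, smooth_extend c⟩
  obtain ⟨Y, hYa, hY⟩ : ∃ u : VField M, u x = d ∧ SmoothFieldNear u x :=
    ⟨_, FiberBundle.extend_apply_self E4 d, smooth_extend d⟩
  subst hua hva hXa hYa
  rw [curv_eq g hu hv hX, curv_eq g hu hv hY]
  have key : ∀ {V : VField M}, SmoothFieldNear V x →
      ∀ᶠ y in 𝓝 x, dirDeriv (fun y => g.inner y (X y) (Y y)) y (V y) =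
        g.inner y (nabla g V X y) (Y y) + g.inner y (X y) (nabla g V Y y) := by
    intro V hV
    filter_upwards [hV.eventually, hX.eventually, hY.eventually] with y h1 h2 h3
    exact nabla_metric g h1 h2 h3
  have h := dirDeriv_bracket hu hv (hX.inner g hY)
  rw [dirDeriv_congr (key hu), dirDeriv_congr (key hv),
    dirDeriv_add ((hu.nabla g hX).inner g hY) (hX.inner g (hu.nabla g hY)),
    dirDeriv_add ((hv.nabla g hX).inner g hY) (hX.inner g (hv.nabla g hY)),
    nabla_metric g (hu.bracket hv) hX hY, nabla_metric g hv (hu.nabla g hX) hY,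
    nabla_metric g hu (hv.nabla g hX) hY, nabla_metric g hv hX (hu.nabla g hY),
    nabla_metric g hu hX (hv.nabla g hY)] at h
  simp only [curvField, map_add, map_sub, add_apply, sub_apply]
  linear_combination h

/-- The second Bianchi identity, stated for vector fields. -/
theorem second_bianchi (hX : SmoothFieldNear X x) (hY : SmoothFieldNear Y x)
    (hZ : SmoothFieldNear Z x) (hw : SmoothFieldNear w x) :
    (nabla g X (curvField g Y Z w) x - curvField g Y Z (nabla g X w) x
        - curvField g (bracket X Y) Z w x)
      + (nabla g Y (curvField g Z X w) x - curvField g Z X (nabla g Y w) x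
        - curvField g (bracket Y Z) X w x)
      + (nabla g Z (curvField g X Y w) x - curvField g X Y (nabla g Z w) x
        - curvField g (bracket Z X) Y w x) = 0 := by
  have key : ∀ {A B C : VField M}, SmoothFieldNear A x → SmoothFieldNear B x →
      SmoothFieldNear C x → nabla g A (curvField g B C w) x =
        nabla g A (nabla g C (nabla g B w)) x - nabla g A (nabla g B (nabla g C w)) x
          + nabla g A (nabla g (bracket B C) w) x := by
    intro A B C hA hB hC
    rw [nabla_congr_right g (X := curvField g B C w) (X' := nabla g C (nabla g B w)
        - nabla g B (nabla g C w) + nabla g (bracket B C) w)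
        (Filter.Eventually.of_forall fun _ => rfl),
      nabla_add_right g hA ((hC.nabla g (hB.nabla g hw)).sub (hB.nabla g (hC.nabla g hw)))
        ((hB.bracket hC).nabla g hw),
      nabla_sub_right g hA (hC.nabla g (hB.nabla g hw)) (hB.nabla g (hC.nabla g hw))]
  rw [key hX hY hZ, key hY hZ hX, key hZ hX hY]
  have hJ : nabla g (bracket (bracket X Y) Z) w x + nabla g (bracket (bracket Y Z) X) w x
      + nabla g (bracket (bracket Z X) Y) w x = 0 := by
    have h1 := (hX.bracket hY).bracket hZ
    have h2 := (hY.bracket hZ).bracket hX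
    have h3 := (hZ.bracket hX).bracket hY
    rw [← nabla_add_left g h1 h2 hw, ← nabla_add_left g (h1.add h2) h3 hw]
    have h0 : (bracket (bracket X Y) Z + bracket (bracket Y Z) X + bracket (bracket Z X) Y) x
        = ((fun _ : M => (0 : ℝ)) • X) x := by
      have hj := jacobi hX hY hZ
      have e1 : bracket (bracket Y Z) X x = -bracket X (bracket Y Z) x := bracket_swap _ _ _
      have e2 : bracket (bracket Z X) Y x = bracket Y (bracket X Z) x := by
        rw [bracket_swap, bracket_congr (X := Y) (X' := Y) (Y := bracket Z X)
          (Y' := (fun _ : M => (-1 : ℝ)) • bracket X Z)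
          (Filter.Eventually.of_forall fun _ => rfl)
          (Filter.Eventually.of_forall fun y => by
            simp only [Pi.smul_apply', neg_smul, one_smul]; exact bracket_swap _ _ _),
          bracket_smul_right (smoothFunNear_const _) (hX.bracket hZ), dirDeriv_const]
        simp
      simp only [Pi.add_apply, e1, e2, hj, Pi.smul_apply', zero_smul]
      abel
    rw [nabla_congr_left g ((h1.add h2).add h3) ((smoothFunNear_const 0).smul hX) hw h0,
      nabla_smul_left g (smoothFunNear_const 0) hX hw, zero_smul]
  simp only [curvField]
  linear_combination (norm := module) -hJ

end CurvatureTensor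

/-! ### Endomorphisms and `2`-forms at a point -/

section PointwiseAlgebra

variable {M : Type*} [TopologicalSpace M] [ChartedSpace E4 M] [IsManifold (𝓡 4) ∞ M]
variable (g : NeutralMetric M) (o : MOrientation M) {x : M}

instance (x : M) : FiniteDimensional ℝ (Tan x) :=
  Module.Basis.finiteDimensional_of_finite (coordBasis x)

instance (x : M) : T2Space (Tan x) := inferInstanceAs (T2Space E4)

theorem finrank_tan (x : M) : Module.finrank ℝ (Tan x) = 4 := by
  simpa using Module.finrank_eq_card_basis (coordBasis x)

/-- The endomorphism of the tangent space corresponding to a bilinear form. -/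
def op (b : Bilin x) : Module.End ℝ (Tan x) where
  toFun v := sharp g (b v).toLinearMap
  map_add' v w := inner_ext g fun a => by simp [inner_sharp]
  map_smul' c v := inner_ext g fun a => by simp [inner_sharp]

@[simp] theorem inner_op (b : Bilin x) (v w : Tan x) : g.inner x (op g b v) w = b v w :=
  inner_sharp g _ _

/-- The bilinear form `g(A·, ·)` of an endomorphism `A`. -/
def form (A : Module.End ℝ (Tan x)) : Bilin x :=
  (g.inner x).comp (LinearMap.toContinuousLinearMap A)

@[simp] theorem form_apply (A : Module.End ℝ (Tan x)) (v w : Tan x) :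
    form g A v w = g.inner x (A v) w := rfl

@[simp] theorem op_form (A : Module.End ℝ (Tan x)) : op g (form g A) = A :=
  LinearMap.ext fun v => inner_ext g fun a => by simp

@[simp] theorem form_op (b : Bilin x) : form g (op g b) = b := by
  ext v w; simp

theorem op_add (b c : Bilin x) : op g (b + c) = op g b + op g c :=
  LinearMap.ext fun v => inner_ext g fun a => by simp

theorem op_smul (r : ℝ) (b : Bilin x) : op g (r • b) = r • op g b :=
  LinearMap.ext fun v => inner_ext g fun a => by simp

/-- Components in the coordinate basis in terms of inner products. -/
theorem coord_repr (z : Tan x) (k : Fin 4) :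
    (coordBasis x).repr z k = ∑ p, gInv g x k p * g.inner x z (coordBasis x p) := by
  set G : Matrix (Fin 4) (Fin 4) ℝ :=
    Matrix.of fun i j => g.inner x (coordBasis x i) (coordBasis x j) with hG
  have hdet : IsUnit G.det := by
    rw [isUnit_iff_ne_zero]
    intro h0
    obtain ⟨c, hc, hc0⟩ := Matrix.exists_mulVec_eq_zero_iff.2 h0
    have hz : ∑ j, c j • coordBasis x j = 0 := by
      refine inner_nondegenerate g fun a => ?_
      rw [← (coordBasis x).sum_repr a, map_sum]
      refine Finset.sum_eq_zero fun i _ => ?_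
      have := congrFun hc0 i
      simp only [Matrix.mulVec, dotProduct, hG, Matrix.of_apply, Pi.zero_apply] at this
      simp only [map_sum, map_smul, sum_apply, smul_apply, smul_eq_mul]
      rw [show ∑ j, c j * g.inner x (coordBasis x j) (coordBasis x i) = 0 by
        rw [← this]
        exact Finset.sum_congr rfl fun j _ => by rw [g.symm x (coordBasis x j), mul_comm], mul_zero]
    exact hc (funext fun j =>
      (Fintype.linearIndependent_iff.1 (coordBasis x).linearIndependent) c hz j)
  have hb : G.mulVec (fun k => (coordBasis x).repr z k) =
      fun p => g.inner x z (coordBasis x p) := by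
    funext p
    conv_rhs => rw [← (coordBasis x).sum_repr z]
    simp only [Matrix.mulVec, dotProduct, hG, Matrix.of_apply, map_sum, map_smul, sum_apply,
      smul_apply, smul_eq_mul]
    exact Finset.sum_congr rfl fun j _ => by rw [g.symm x (coordBasis x j), mul_comm]
  have hinv : G⁻¹.mulVec (G.mulVec (fun k => (coordBasis x).repr z k)) =
      fun k => (coordBasis x).repr z k := by
    rw [Matrix.mulVec_mulVec, Matrix.nonsing_inv_mul _ hdet, Matrix.one_mulVec]
  rw [hb] at hinv
  exact (congrFun hinv k).symm

/-- Contraction with the inverse metric is a trace. -/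
theorem contraction_eq_trace (A : Module.End ℝ (Tan x)) :
    ∑ k, ∑ p, gInv g x k p * g.inner x (A (coordBasis x k)) (coordBasis x p) =
      LinearMap.trace ℝ _ A := by
  rw [LinearMap.trace_eq_matrix_trace ℝ (coordBasis x), Matrix.trace]
  refine Finset.sum_congr rfl fun k _ => ?_
  rw [Matrix.diag_apply, LinearMap.toMatrix_apply, coord_repr g]

/-- The inner product of endomorphisms corresponding to the one of `2`-forms. -/
def ip (A B : Module.End ℝ (Tan x)) : ℝ := -(1 / 2) * LinearMap.trace ℝ _ (A * B)

theorem ip_comm (A B : Module.End ℝ (Tan x)) : ip A B = ip B A := by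
  simp only [ip, LinearMap.trace_mul_comm]

theorem ip_add_left (A B C : Module.End ℝ (Tan x)) : ip (A + B) C = ip A C + ip B C := by
  simp only [ip, add_mul, map_add]; ring

theorem ip_smul_left (r : ℝ) (A C : Module.End ℝ (Tan x)) : ip (r • A) C = r * ip A C := by
  simp only [ip, smul_mul_assoc, map_smul, smul_eq_mul]; ring

theorem ip_add_right (A B C : Module.End ℝ (Tan x)) : ip C (A + B) = ip C A + ip C B := by
  simp only [ip_comm C, ip_add_left]

theorem ip_smul_right (r : ℝ) (A C : Module.End ℝ (Tan x)) : ip C (r • A) = r * ip C A := by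
  simp only [ip_comm C, ip_smul_left]

/-- The inner product of forms in terms of endomorphisms; the skew-symmetry of `t` accounts for the
sign in the definition of `ip`. -/
theorem formInner_eq_ip (b t : Bilin x) (ht : IsTwoForm t) :
    formInner g b t = ip (op g b) (op g t) := by
  have h1 : ∀ l, ∑ p, b (coordBasis x l) (coordBasis x p) * raised g t l p =
      ∑ i, gInv g x l i *
        (-g.inner x ((op g t * op g b) (coordBasis x l)) (coordBasis x i)) := by
    intro l
    have h2 : ∀ i, -g.inner x ((op g t * op g b) (coordBasis x l)) (coordBasis x i) =
        ∑ j, (∑ p, gInv g x j p * b (coordBasis x l) (coordBasis x p)) *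
          t (coordBasis x i) (coordBasis x j) := by
      intro i
      rw [Module.End.mul_apply, inner_op, ← ht]
      conv_lhs => rw [← (coordBasis x).sum_repr (op g b (coordBasis x l))]
      simp only [map_sum, map_smul, smul_eq_mul, coord_repr g, inner_op]
    have hsym : ∀ i j, gInv g x i j = gInv g x j i := by
      intro i j
      have : (gInv g x).transpose = gInv g x := by
        rw [gInv, Matrix.transpose_nonsing_inv]
        congr 1
        ext i j
        exact g.symm x _ _
      conv_lhs => rw [← this]
      rfl
    simp only [h2, raised, Finset.mul_sum, Finset.sum_mul]
    rw [Finset.sum_comm]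
    refine Finset.sum_congr rfl fun i _ => ?_
    rw [Finset.sum_comm]
    refine Finset.sum_congr rfl fun j _ => Finset.sum_congr rfl fun p _ => ?_
    rw [hsym j p]
    ring
  rw [formInner, ip_comm, ip, ← contraction_eq_trace g]
  simp only [h1, mul_neg, Finset.sum_neg_distrib]
  ring

/-- Skew-adjoint endomorphisms, which correspond to `2`-forms. -/
def IsSkew (A : Module.End ℝ (Tan x)) : Prop := IsTwoForm (form g A)

theorem isSkew_iff (A : Module.End ℝ (Tan x)) :
    IsSkew g A ↔ ∀ v w, g.inner x (A v) w = -g.inner x v (A w) := by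
  simp only [IsSkew, IsTwoForm, form_apply]
  exact forall₂_congr fun v w => by rw [g.symm x (A w) v]

/-! ### Positive orthonormal bases -/

/-- The signs `(--++)`. -/
def sgn (i : Fin 4) : ℝ := if i < 2 then -1 else 1

theorem sgn_mul_self (i : Fin 4) : sgn i * sgn i = 1 := by
  unfold sgn; split_ifs <;> norm_num

/-- `f` is a positively oriented `(--++)`-orthonormal basis. -/
structure IsAdapted (f : Module.Basis (Fin 4) ℝ (Tan x)) : Prop where
  inner_eq : ∀ i j, g.inner x (f i) (f j) = if i = j then sgn i else 0
  orient_eq : f.orientation = o.orient x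

theorem exists_adapted (x : M) : ∃ f : Module.Basis (Fin 4) ℝ (Tan x), IsAdapted g o f := by
  obtain ⟨e, he⟩ := g.neutral x
  refine ⟨e.adjustToOrientation (o.orient x), fun i j => ?_, e.orientation_adjustToOrientation _⟩
  have h1 : g.inner x (e i) (e j) = if i = j then sgn i else 0 := he i j
  rcases eq_or_ne i j with rfl | hij
  · rcases e.adjustToOrientation_apply_eq_or_eq_neg (o.orient x) i with h | h <;> simp [h, h1]
  · rcases e.adjustToOrientation_apply_eq_or_eq_neg (o.orient x) i with h | h <;>
    rcases e.adjustToOrientation_apply_eq_or_eq_neg (o.orient x) j with h' | h' <;>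
    simp [h, h', h1, hij]

variable {g o} {f : Module.Basis (Fin 4) ℝ (Tan x)} (hf : IsAdapted g o f)
include hf

theorem IsAdapted.repr_eq (z : Tan x) (i : Fin 4) : f.repr z i = sgn i * g.inner x z (f i) := by
  conv_rhs => rw [← f.sum_repr z]
  simp only [map_sum, map_smul, sum_apply, smul_apply, smul_eq_mul, hf.inner_eq]
  simp only [mul_ite, mul_zero, Finset.sum_ite_eq', Finset.mem_univ, if_true]
  rw [mul_comm, mul_assoc, sgn_mul_self, mul_one]

open Classical in
/-- The volume form takes the value `1` on positive orthonormal bases. -/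
theorem IsAdapted.vol_eq (a b c d : Tan x) :
    vol g o x ![a, b, c, d] = f.det ![a, b, c, d] := by
  set e := coordBasis x
  set A := e.toMatrix f with hA
  set G : Matrix (Fin 4) (Fin 4) ℝ := Matrix.of fun i j => g.inner x (e i) (e j) with hG
  have hAG : A.transpose * G * A = Matrix.of fun i j => g.inner x (f i) (f j) := by
    ext i j
    have h1 : ∀ k, f k = ∑ l, A l k • e l := fun k => by
      simp [A, Module.Basis.toMatrix_apply, e.sum_repr (f k)]
    simp only [Matrix.of_apply, Matrix.mul_apply, Matrix.transpose_apply, hG]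
    rw [h1 i, h1 j]
    simp only [map_sum, map_smul, sum_apply, smul_apply, smul_eq_mul, Finset.sum_mul,
      Finset.mul_sum]
    exact Finset.sum_congr rfl fun k _ => Finset.sum_congr rfl fun l _ => by ring
  have hdet1 : (Matrix.of fun i j => g.inner x (f i) (f j)).det = 1 := by
    have : (Matrix.of fun i j => g.inner x (f i) (f j)) = Matrix.diagonal sgn := by
      ext i j
      simp only [Matrix.of_apply, hf.inner_eq, Matrix.diagonal_apply]
    rw [this, Matrix.det_diagonal]
    simp [Fin.prod_univ_four, sgn]
  have hdet : A.det ^ 2 * G.det = 1 := by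
    rw [← hdet1, ← hAG, Matrix.det_mul, Matrix.det_mul, Matrix.det_transpose]
    ring
  have hA0 : A.det ≠ 0 := by
    intro h
    rw [h] at hdet
    simp at hdet
  have hsqrt : Real.sqrt |G.det| = |A.det|⁻¹ := by
    have : G.det = (A.det⁻¹) ^ 2 := by field_simp; linarith
    rw [this, abs_of_nonneg (sq_nonneg _), Real.sqrt_sq_eq_abs, abs_inv]
  have hchange : e.det ![a, b, c, d] = A.det * f.det ![a, b, c, d] := by
    have := congrFun (congrArg DFunLike.coe (e.det.eq_smul_basis_det f)) ![a, b, c, d]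
    simpa [Module.Basis.det_apply, A] using this
  have horient : e.orientation = o.orient x ↔ 0 < A.det := by
    rw [← hf.orient_eq, Module.Basis.orientation_eq_iff_det_pos, Module.Basis.det_apply]
  have : vol g o x ![a, b, c, d] = ((if e.orientation = o.orient x then 1 else -1) *
    Real.sqrt |G.det|) * e.det ![a, b, c, d] := by
    rw [vol]; rfl
  rw [this, hsqrt, hchange]
  by_cases hpos : 0 < A.det
  · rw [if_pos (horient.2 hpos), abs_of_pos hpos]
    field_simp
  · rw [if_neg (fun h => hpos (horient.1 h)), abs_of_neg (lt_of_le_of_ne (not_lt.1 hpos) hA0)]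
    field_simp

theorem IsAdapted.trace_eq (A : Module.End ℝ (Tan x)) :
    LinearMap.trace ℝ _ A = ∑ i, sgn i * g.inner x (A (f i)) (f i) := by
  rw [LinearMap.trace_eq_matrix_trace ℝ f, Matrix.trace]
  refine Finset.sum_congr rfl fun k _ => ?_
  rw [Matrix.diag_apply, LinearMap.toMatrix_apply, hf.repr_eq]

theorem IsAdapted.formInner_eq (b t : Bilin x) (ht : IsTwoForm t) :
    formInner g b t = (1 / 2) * ∑ i, ∑ j, sgn i * sgn j * (b (f i) (f j) * t (f i) (f j)) := by
  rw [formInner_eq_ip g b t ht, ip_comm, ip, hf.trace_eq, neg_mul, ← mul_neg,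
    ← Finset.sum_neg_distrib]
  congr 1
  refine Finset.sum_congr rfl fun i _ => ?_
  rw [Module.End.mul_apply, inner_op, ht, ← f.sum_repr (op g b (f i))]
  simp only [map_sum, map_smul, smul_eq_mul, hf.repr_eq, inner_op, Finset.mul_sum, mul_neg, neg_neg]
  exact Finset.sum_congr rfl fun j _ => by ring

theorem IsAdapted.hodge_eq (t : Bilin x) (ht : IsTwoForm t) (a b : Tan x) :
    hodge g o t a b =
      (f.repr a 2 * f.repr b 3 - f.repr a 3 * f.repr b 2) * t (f 0) (f 1)
      + (f.repr a 1 * f.repr b 3 - f.repr a 3 * f.repr b 1) * t (f 0) (f 2)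
      - (f.repr a 1 * f.repr b 2 - f.repr a 2 * f.repr b 1) * t (f 0) (f 3)
      - (f.repr a 0 * f.repr b 3 - f.repr a 3 * f.repr b 0) * t (f 1) (f 2)
      + (f.repr a 0 * f.repr b 2 - f.repr a 2 * f.repr b 0) * t (f 1) (f 3)
      + (f.repr a 0 * f.repr b 1 - f.repr a 1 * f.repr b 0) * t (f 2) (f 3) := by
  have e2 : ∀ c d z, Function.update (![a, b, c, d] : Fin 4 → Tan x) 2 z = ![a, b, z, d] := by
    intro c d z; ext1 i; fin_cases i <;> rfl
  have e3 : ∀ c d z, Function.update (![a, b, c, d] : Fin 4 → Tan x) 3 z = ![a, b, c, z] := by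
    intro c d z; ext1 i; fin_cases i <;> rfl
  let B₀ : Tan x →ₗ[ℝ] Tan x →ₗ[ℝ] ℝ := LinearMap.mk₂ ℝ (fun c d => vol g o x ![a, b, c, d])
    (fun c c' d => by
      rw [← e2 c, (vol g o x).map_update_add, e2, e2])
    (fun r c d => by
      rw [← e2 c, (vol g o x).map_update_smul, e2])
    (fun c d d' => by
      rw [← e3 c d, (vol g o x).map_update_add, e3, e3])
    (fun r c d => by
      rw [← e3 c d, (vol g o x).map_update_smul, e3])
  let B : Bilin x := LinearMap.toContinuousBilinearMap B₀
  have hB : ∀ c d, B c d = f.det ![a, b, c, d] := fun c d => hf.vol_eq a b c d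
  have h0 : hodge g o t a b = formInner g B t := rfl
  have hskew : ∀ i j, t (f i) (f j) = -t (f j) (f i) := fun i j => ht _ _
  have hdiag : ∀ i, t (f i) (f i) = 0 := fun i => by have := hskew i i; linarith
  have hBs : ∀ c d, B c d = -B d c := by
    intro c d
    rw [hB, hB]
    have := f.det.map_swap ![a, b, d, c] (i := 2) (j := 3) (by decide)
    rw [← this]
    congr 1
    ext1 i; fin_cases i <;> rfl
  have hdet : ∀ c d, B c d = (!![f.repr a 0, f.repr b 0, f.repr c 0, f.repr d 0;
      f.repr a 1, f.repr b 1, f.repr c 1, f.repr d 1;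
      f.repr a 2, f.repr b 2, f.repr c 2, f.repr d 2;
      f.repr a 3, f.repr b 3, f.repr c 3, f.repr d 3]).det := by
    intro c d
    rw [hB, Module.Basis.det_apply]
    congr 1
    ext i j
    fin_cases i <;> fin_cases j <;> rfl
  rw [h0, hf.formInner_eq B t ht]
  simp only [Fin.sum_univ_four, hdiag, hskew 1 0, hskew 2 0, hskew 3 0, hskew 2 1, hskew 3 1,
    hskew 3 2, hBs (f 1) (f 0), hBs (f 2) (f 0), hBs (f 3) (f 0), hBs (f 2) (f 1),
    hBs (f 3) (f 1), hBs (f 3) (f 2)]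
  have h01 : B (f 0) (f 1) = f.repr a 2 * f.repr b 3 - f.repr a 3 * f.repr b 2 := by
    rw [hdet]
    simp [Matrix.det_succ_row_zero, Fin.sum_univ_succ, Fin.succAbove]
    try ring
  have h02 : B (f 0) (f 2) = -(f.repr a 1 * f.repr b 3 - f.repr a 3 * f.repr b 1) := by
    rw [hdet]
    simp [Matrix.det_succ_row_zero, Fin.sum_univ_succ, Fin.succAbove]
    try ring
  have h03 : B (f 0) (f 3) = f.repr a 1 * f.repr b 2 - f.repr a 2 * f.repr b 1 := by
    rw [hdet]
    simp [Matrix.det_succ_row_zero, Fin.sum_univ_succ, Fin.succAbove]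
    try ring
  have h12 : B (f 1) (f 2) = f.repr a 0 * f.repr b 3 - f.repr a 3 * f.repr b 0 := by
    rw [hdet]
    simp [Matrix.det_succ_row_zero, Fin.sum_univ_succ, Fin.succAbove]
    try ring
  have h13 : B (f 1) (f 3) = -(f.repr a 0 * f.repr b 2 - f.repr a 2 * f.repr b 0) := by
    rw [hdet]
    simp [Matrix.det_succ_row_zero, Fin.sum_univ_succ, Fin.succAbove]
    try ring
  have h23 : B (f 2) (f 3) = f.repr a 0 * f.repr b 1 - f.repr a 1 * f.repr b 0 := by
    rw [hdet]
    simp [Matrix.det_succ_row_zero, Fin.sum_univ_succ, Fin.succAbove]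
    try ring
  have s0 : sgn 0 = -1 := by simp [sgn]
  have s1 : sgn 1 = -1 := by simp [sgn]
  have s2 : sgn 2 = 1 := by simp [sgn]
  have s3 : sgn 3 = 1 := by simp [sgn]
  rw [h01, h02, h03, h12, h13, h23, s0, s1, s2, s3]
  ring

omit hf in
theorem twoForm_eq (f : Module.Basis (Fin 4) ℝ (Tan x)) (t : Bilin x) (ht : IsTwoForm t)
    (a b : Tan x) :
    t a b =
      (f.repr a 0 * f.repr b 1 - f.repr a 1 * f.repr b 0) * t (f 0) (f 1)
      + (f.repr a 0 * f.repr b 2 - f.repr a 2 * f.repr b 0) * t (f 0) (f 2)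
      + (f.repr a 0 * f.repr b 3 - f.repr a 3 * f.repr b 0) * t (f 0) (f 3)
      + (f.repr a 1 * f.repr b 2 - f.repr a 2 * f.repr b 1) * t (f 1) (f 2)
      + (f.repr a 1 * f.repr b 3 - f.repr a 3 * f.repr b 1) * t (f 1) (f 3)
      + (f.repr a 2 * f.repr b 3 - f.repr a 3 * f.repr b 2) * t (f 2) (f 3) := by
  have hskew : ∀ i j, t (f i) (f j) = -t (f j) (f i) := fun i j => ht _ _
  have hdiag : ∀ i, t (f i) (f i) = 0 := fun i => by have := hskew i i; linarith
  conv_lhs => rw [← f.sum_repr a, ← f.sum_repr b]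
  simp only [Fin.sum_univ_four, map_add, map_smul, add_apply, smul_apply, smul_eq_mul, hdiag,
    hskew 1 0, hskew 2 0, hskew 3 0, hskew 2 1, hskew 3 1, hskew 3 2]
  ring

theorem IsAdapted.isSD_iff (t : Bilin x) : IsSD g o t ↔ IsTwoForm t ∧
    t (f 0) (f 1) = t (f 2) (f 3) ∧ t (f 0) (f 2) = t (f 1) (f 3) ∧
      t (f 0) (f 3) = -t (f 1) (f 2) := by
  refine and_congr_right fun ht => ⟨fun h => ?_, fun h a b => ?_⟩
  · have h1 := h (f 0) (f 1)
    have h2 := h (f 0) (f 2)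
    have h3 := h (f 0) (f 3)
    rw [hf.hodge_eq t ht] at h1 h2 h3
    simp at h1 h2 h3
    exact ⟨h1.symm, h2.symm, h3.symm⟩
  · rw [hf.hodge_eq t ht, twoForm_eq f t ht a b, h.1, h.2.1, h.2.2]
    ring

theorem IsAdapted.isASD_iff (t : Bilin x) : IsASD g o t ↔ IsTwoForm t ∧
    t (f 0) (f 1) = -t (f 2) (f 3) ∧ t (f 0) (f 2) = -t (f 1) (f 3) ∧
      t (f 0) (f 3) = t (f 1) (f 2) := by
  refine and_congr_right fun ht => ⟨fun h => ?_, fun h a b => ?_⟩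
  · have h1 := h (f 0) (f 1)
    have h2 := h (f 0) (f 2)
    have h3 := h (f 0) (f 3)
    rw [hf.hodge_eq t ht] at h1 h2 h3
    simp at h1 h2 h3
    exact ⟨by linarith, by linarith, by linarith⟩
  · rw [hf.hodge_eq t ht, twoForm_eq f t ht a b, h.1, h.2.1, h.2.2]
    ring

end PointwiseAlgebra

/-! ### The algebra of self-dual and anti-self-dual forms -/

section SelfDualAlgebra

variable {M : Type*} [TopologicalSpace M] [ChartedSpace E4 M] [IsManifold (𝓡 4) ∞ M]
variable (g : NeutralMetric M) (o : MOrientation M) {x : M}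

/-- Endomorphisms corresponding to self-dual `2`-forms. -/
def SD (A : Module.End ℝ (Tan x)) : Prop := IsSD g o (form g A)

/-- Endomorphisms corresponding to anti-self-dual `2`-forms. -/
def ASD (A : Module.End ℝ (Tan x)) : Prop := IsASD g o (form g A)

/-- The matrices of self-dual forms in adapted bases. -/
def sdMatrix (p q r : ℝ) : Matrix (Fin 4) (Fin 4) ℝ :=
  !![0, p, q, r; -p, 0, -r, q; q, -r, 0, -p; r, q, p, 0]

/-- The matrices of anti-self-dual forms in adapted bases. -/
def asdMatrix (p q r : ℝ) : Matrix (Fin 4) (Fin 4) ℝ :=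
  !![0, p, q, r; -p, 0, r, -q; q, r, 0, p; r, -q, -p, 0]

theorem sdMatrix_anticomm (p q r p' q' r' : ℝ) :
    sdMatrix p q r * sdMatrix p' q' r' + sdMatrix p' q' r' * sdMatrix p q r =
      (-(2 * (p * p' - q * q' - r * r'))) • (1 : Matrix (Fin 4) (Fin 4) ℝ) := by
  ext i j
  fin_cases i <;> fin_cases j <;>
    simp [sdMatrix] <;> ring

theorem sdMatrix_comm (p q r p' q' r' : ℝ) :
    sdMatrix p q r * sdMatrix p' q' r' - sdMatrix p' q' r' * sdMatrix p q r =
      sdMatrix (2 * (r * q' - q * r')) (2 * (r * p' - p * r')) (2 * (p * q' - q * p')) := by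
  ext i j
  fin_cases i <;> fin_cases j <;>
    simp [sdMatrix] <;> ring

theorem sdMatrix_asdMatrix_comm (p q r p' q' r' : ℝ) :
    sdMatrix p q r * asdMatrix p' q' r' = asdMatrix p' q' r' * sdMatrix p q r := by
  ext i j
  fin_cases i <;> fin_cases j <;>
    simp [sdMatrix, asdMatrix] <;> ring

theorem trace_sdMatrix_mul_asdMatrix (p q r p' q' r' : ℝ) :
    (sdMatrix p q r * asdMatrix p' q' r').trace = 0 := by
  simp [sdMatrix, asdMatrix, Matrix.trace, Fin.sum_univ_four]; ring

theorem trace_sdMatrix_mul_sdMatrix (p q r p' q' r' : ℝ) :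
    (sdMatrix p q r * sdMatrix p' q' r').trace = -4 * (p * p' - q * q' - r * r') := by
  simp [sdMatrix, Matrix.trace, Fin.sum_univ_four]; ring

theorem trace_asdMatrix_mul_asdMatrix (p q r p' q' r' : ℝ) :
    (asdMatrix p q r * asdMatrix p' q' r').trace = -4 * (p * p' - q * q' - r * r') := by
  simp [asdMatrix, Matrix.trace, Fin.sum_univ_four]; ring

section Coordinates

variable {g o} {f : Module.Basis (Fin 4) ℝ (Tan x)} (hf : IsAdapted g o f)
include hf

theorem IsAdapted.toMatrix_apply (A : Module.End ℝ (Tan x)) (i j : Fin 4) :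
    LinearMap.toMatrixAlgEquiv f A i j = sgn i * form g A (f j) (f i) := by
  rw [LinearMap.toMatrixAlgEquiv_apply, hf.repr_eq, form_apply]

/-- The matrix of a skew-adjoint endomorphism is the sum of a self-dual and an anti-self-dual
one. -/
theorem IsAdapted.toMatrix_of_skew {A : Module.End ℝ (Tan x)} (hA : IsSkew g A) :
    LinearMap.toMatrixAlgEquiv f A =
      sdMatrix ((form g A (f 0) (f 1) + form g A (f 2) (f 3)) / 2)
        ((form g A (f 0) (f 2) + form g A (f 1) (f 3)) / 2)
        ((form g A (f 0) (f 3) - form g A (f 1) (f 2)) / 2)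
      + asdMatrix ((form g A (f 0) (f 1) - form g A (f 2) (f 3)) / 2)
        ((form g A (f 0) (f 2) - form g A (f 1) (f 3)) / 2)
        ((form g A (f 0) (f 3) + form g A (f 1) (f 2)) / 2) := by
  have hskew : ∀ i j, form g A (f i) (f j) = -form g A (f j) (f i) := fun i j => hA _ _
  have hdiag : ∀ i, form g A (f i) (f i) = 0 := fun i => by have := hskew i i; linarith
  have h10 := hskew 1 0
  have h20 := hskew 2 0
  have h30 := hskew 3 0
  have h21 := hskew 2 1
  have h31 := hskew 3 1
  have h32 := hskew 3 2
  have s0 : sgn 0 = -1 := by simp [sgn]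
  have s1 : sgn 1 = -1 := by simp [sgn]
  have s2 : sgn 2 = 1 := by simp [sgn]
  have s3 : sgn 3 = 1 := by simp [sgn]
  ext i j
  rw [hf.toMatrix_apply]
  generalize form g A = t at *
  fin_cases i <;> fin_cases j <;>
    simp [sdMatrix, asdMatrix, s0, s1, s2, s3, hdiag, h10, h20, h30, h21, h31, h32] <;> ring

theorem IsAdapted.form_eq_toMatrix (A : Module.End ℝ (Tan x)) (i j : Fin 4) :
    form g A (f j) (f i) = sgn i * LinearMap.toMatrixAlgEquiv f A i j := by
  rw [hf.toMatrix_apply, ← mul_assoc, sgn_mul_self, one_mul]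

theorem IsAdapted.isSkew_of_toMatrix {A : Module.End ℝ (Tan x)}
    (hA : ∀ i j, sgn i * LinearMap.toMatrixAlgEquiv f A i j =
      -(sgn j * LinearMap.toMatrixAlgEquiv f A j i)) : IsSkew g A := by
  intro a b
  rw [← f.sum_repr a, ← f.sum_repr b]
  simp only [map_sum, map_smul, sum_apply, smul_apply, smul_eq_mul, Finset.mul_sum,
    hf.form_eq_toMatrix]
  rw [Finset.sum_comm, ← Finset.sum_neg_distrib]
  refine Finset.sum_congr rfl fun i _ => ?_
  rw [← Finset.sum_neg_distrib]
  refine Finset.sum_congr rfl fun j _ => ?_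
  rw [hA j i]
  ring

theorem IsAdapted.sd_iff (A : Module.End ℝ (Tan x)) :
    SD g o A ↔ ∃ p q r, LinearMap.toMatrixAlgEquiv f A = sdMatrix p q r := by
  constructor
  · intro h
    obtain ⟨h0, h1, h2, h3⟩ := (hf.isSD_iff _).1 h
    refine ⟨form g A (f 0) (f 1), form g A (f 0) (f 2), form g A (f 0) (f 3), ?_⟩
    rw [hf.toMatrix_of_skew h0, h1, h2, h3]
    ext i j
    fin_cases i <;> fin_cases j <;> simp [sdMatrix, asdMatrix] <;> ring
  · rintro ⟨p, q, r, h⟩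
    refine (hf.isSD_iff _).2 ⟨hf.isSkew_of_toMatrix fun i j => ?_, ?_, ?_, ?_⟩
    · rw [h]
      fin_cases i <;> fin_cases j <;> simp [sdMatrix, sgn]
    all_goals simp [hf.form_eq_toMatrix, -form_apply, h, sdMatrix, sgn]

theorem IsAdapted.asd_iff (A : Module.End ℝ (Tan x)) :
    ASD g o A ↔ ∃ p q r, LinearMap.toMatrixAlgEquiv f A = asdMatrix p q r := by
  constructor
  · intro h
    obtain ⟨h0, h1, h2, h3⟩ := (hf.isASD_iff _).1 h
    refine ⟨form g A (f 0) (f 1), form g A (f 0) (f 2), form g A (f 0) (f 3), ?_⟩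
    rw [hf.toMatrix_of_skew h0, h1, h2, h3]
    ext i j
    fin_cases i <;> fin_cases j <;> simp [sdMatrix, asdMatrix] <;> ring
  · rintro ⟨p, q, r, h⟩
    refine (hf.isASD_iff _).2 ⟨hf.isSkew_of_toMatrix fun i j => ?_, ?_, ?_, ?_⟩
    · rw [h]
      fin_cases i <;> fin_cases j <;> simp [asdMatrix, sgn]
    all_goals simp [hf.form_eq_toMatrix, -form_apply, h, asdMatrix, sgn]

omit hf in
theorem ip_eq_toMatrix (f : Module.Basis (Fin 4) ℝ (Tan x)) (A B : Module.End ℝ (Tan x)) :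
    ip A B =
      -(1 / 2) * (LinearMap.toMatrixAlgEquiv f A * LinearMap.toMatrixAlgEquiv f B).trace := by
  rw [ip, LinearMap.trace_eq_matrix_trace ℝ f, ← map_mul]
  rfl

end Coordinates

variable {g o}

theorem SD.skew {A : Module.End ℝ (Tan x)} (hA : SD g o A) : IsSkew g A := hA.1

theorem ASD.skew {A : Module.End ℝ (Tan x)} (hA : ASD g o A) : IsSkew g A := hA.1

theorem IsSkew.add {A B : Module.End ℝ (Tan x)} (hA : IsSkew g A) (hB : IsSkew g B) :
    IsSkew g (A + B) := by
  rw [isSkew_iff] at *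
  intro v w
  simp only [LinearMap.add_apply, map_add, add_apply, hA v w, hB v w]; ring

theorem IsSkew.smul {A : Module.End ℝ (Tan x)} (r : ℝ) (hA : IsSkew g A) :
    IsSkew g (r • A) := by
  rw [isSkew_iff] at *
  intro v w
  simp only [LinearMap.smul_apply, map_smul, smul_apply, hA v w, smul_eq_mul]; ring

theorem SD.add {A B : Module.End ℝ (Tan x)} (hA : SD g o A) (hB : SD g o B) :
    SD g o (A + B) := by
  obtain ⟨f, hf⟩ := exists_adapted g o x
  rw [hf.sd_iff] at *
  obtain ⟨p, q, r, h⟩ := hA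
  obtain ⟨p', q', r', h'⟩ := hB
  refine ⟨p + p', q + q', r + r', ?_⟩
  rw [map_add, h, h']
  ext i j
  fin_cases i <;> fin_cases j <;> simp [sdMatrix] <;> ring

theorem SD.smul {A : Module.End ℝ (Tan x)} (c : ℝ) (hA : SD g o A) : SD g o (c • A) := by
  obtain ⟨f, hf⟩ := exists_adapted g o x
  rw [hf.sd_iff] at *
  obtain ⟨p, q, r, h⟩ := hA
  refine ⟨c * p, c * q, c * r, ?_⟩
  rw [map_smul, h]
  ext i j
  fin_cases i <;> fin_cases j <;> simp [sdMatrix]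

/-- The Clifford relations for self-dual forms. -/
theorem SD.anticomm {A B : Module.End ℝ (Tan x)} (hA : SD g o A) (hB : SD g o B) :
    A * B + B * A = -ip A B • 1 := by
  obtain ⟨f, hf⟩ := exists_adapted g o x
  rw [hf.sd_iff] at *
  obtain ⟨p, q, r, h⟩ := hA
  obtain ⟨p', q', r', h'⟩ := hB
  apply (LinearMap.toMatrixAlgEquiv f).injective
  rw [ip_eq_toMatrix f, map_add, map_mul, map_mul, h, h', sdMatrix_anticomm, map_smul, map_one,
    trace_sdMatrix_mul_sdMatrix]
  congr 1
  ring

theorem SD.commutator {A B : Module.End ℝ (Tan x)} (hA : SD g o A) (hB : SD g o B) :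
    SD g o (A * B - B * A) := by
  obtain ⟨f, hf⟩ := exists_adapted g o x
  rw [hf.sd_iff] at *
  obtain ⟨p, q, r, h⟩ := hA
  obtain ⟨p', q', r', h'⟩ := hB
  exact ⟨_, _, _, by rw [map_sub, map_mul, map_mul, h, h', sdMatrix_comm]⟩

theorem SD.comm_asd {A C : Module.End ℝ (Tan x)} (hA : SD g o A) (hC : ASD g o C) :
    A * C = C * A := by
  obtain ⟨f, hf⟩ := exists_adapted g o x
  rw [hf.sd_iff] at hA
  rw [hf.asd_iff] at hC
  obtain ⟨p, q, r, h⟩ := hA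
  obtain ⟨p', q', r', h'⟩ := hC
  apply (LinearMap.toMatrixAlgEquiv f).injective
  rw [map_mul, map_mul, h, h', sdMatrix_asdMatrix_comm]

theorem SD.ip_asd {A C : Module.End ℝ (Tan x)} (hA : SD g o A) (hC : ASD g o C) :
    ip A C = 0 := by
  obtain ⟨f, hf⟩ := exists_adapted g o x
  rw [hf.sd_iff] at hA
  rw [hf.asd_iff] at hC
  obtain ⟨p, q, r, h⟩ := hA
  obtain ⟨p', q', r', h'⟩ := hC
  rw [ip_eq_toMatrix f, h, h', trace_sdMatrix_mul_asdMatrix, mul_zero]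

variable (o) in
theorem IsSkew.exists_sd_add_asd {A : Module.End ℝ (Tan x)} (hA : IsSkew g A) :
    ∃ B C, SD g o B ∧ ASD g o C ∧ A = B + C := by
  obtain ⟨f, hf⟩ := exists_adapted g o x
  obtain ⟨p, q, r, p', q', r', h⟩ : ∃ p q r p' q' r',
      LinearMap.toMatrixAlgEquiv f A = sdMatrix p q r + asdMatrix p' q' r' :=
    ⟨_, _, _, _, _, _, hf.toMatrix_of_skew hA⟩
  refine ⟨(LinearMap.toMatrixAlgEquiv f).symm (sdMatrix p q r),
    (LinearMap.toMatrixAlgEquiv f).symm (asdMatrix p' q' r'),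
    (hf.sd_iff _).2 ⟨_, _, _, AlgEquiv.apply_symm_apply _ _⟩,
    (hf.asd_iff _).2 ⟨_, _, _, AlgEquiv.apply_symm_apply _ _⟩, ?_⟩
  apply (LinearMap.toMatrixAlgEquiv f).injective
  rw [map_add, AlgEquiv.apply_symm_apply, AlgEquiv.apply_symm_apply, h]

/-- The inner product is nondegenerate on self-dual forms. -/
theorem SD.eq_zero {A : Module.End ℝ (Tan x)} (hA : SD g o A)
    (h0 : ∀ B, SD g o B → ip A B = 0) : A = 0 := by
  obtain ⟨f, hf⟩ := exists_adapted g o x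
  obtain ⟨p, q, r, h⟩ := (hf.sd_iff _).1 hA
  have key : ∀ p' q' r', p * p' - q * q' - r * r' = 0 := by
    intro p' q' r'
    have := h0 ((LinearMap.toMatrixAlgEquiv f).symm (sdMatrix p' q' r'))
      ((hf.sd_iff _).2 ⟨_, _, _, AlgEquiv.apply_symm_apply _ _⟩)
    rw [ip_eq_toMatrix f, AlgEquiv.apply_symm_apply, h, trace_sdMatrix_mul_sdMatrix] at this
    linarith
  have hp : p = 0 := by simpa using key 1 0 0
  have hq : q = 0 := by simpa using key 0 1 0
  have hr : r = 0 := by simpa using key 0 0 1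
  apply (LinearMap.toMatrixAlgEquiv f).injective
  rw [h, hp, hq, hr, map_zero]
  ext i j
  fin_cases i <;> fin_cases j <;> simp [sdMatrix]

theorem ASD.eq_zero {A : Module.End ℝ (Tan x)} (hA : ASD g o A)
    (h0 : ∀ B, ASD g o B → ip A B = 0) : A = 0 := by
  obtain ⟨f, hf⟩ := exists_adapted g o x
  obtain ⟨p, q, r, h⟩ := (hf.asd_iff _).1 hA
  have key : ∀ p' q' r', p * p' - q * q' - r * r' = 0 := by
    intro p' q' r'
    have := h0 ((LinearMap.toMatrixAlgEquiv f).symm (asdMatrix p' q' r'))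
      ((hf.asd_iff _).2 ⟨_, _, _, AlgEquiv.apply_symm_apply _ _⟩)
    rw [ip_eq_toMatrix f, AlgEquiv.apply_symm_apply, h, trace_asdMatrix_mul_asdMatrix] at this
    linarith
  have hp : p = 0 := by simpa using key 1 0 0
  have hq : q = 0 := by simpa using key 0 1 0
  have hr : r = 0 := by simpa using key 0 0 1
  apply (LinearMap.toMatrixAlgEquiv f).injective
  rw [h, hp, hq, hr, map_zero]
  ext i j
  fin_cases i <;> fin_cases j <;> simp [asdMatrix]

theorem IsSkew.eq_zero (o : MOrientation M) {A : Module.End ℝ (Tan x)} (hA : IsSkew g A)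
    (h0 : ∀ B, IsSkew g B → ip A B = 0) : A = 0 := by
  obtain ⟨B, C, hB, hC, rfl⟩ := hA.exists_sd_add_asd o
  have h1 : B = 0 := hB.eq_zero fun S hS => by
    have := h0 S hS.skew
    rwa [ip_add_left, ip_comm C, hS.ip_asd hC, add_zero] at this
  have h2 : C = 0 := hC.eq_zero fun S hS => by
    have := h0 S hS.skew
    rwa [ip_add_left, hB.ip_asd hS, zero_add] at this
  rw [h1, h2, add_zero]

end SelfDualAlgebra

/-! ### The Weyl tensor as an operator on endomorphisms -/

section TypeIII

variable {M : Type*} [TopologicalSpace M] [ChartedSpace E4 M] [IsManifold (𝓡 4) ∞ M]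
variable (g : NeutralMetric M) (o : MOrientation M) {x : M}

instance (x : M) : Nontrivial (Tan x) :=
  Module.nontrivial_of_finrank_pos (R := ℝ) (by rw [finrank_tan]; norm_num)

/-- The curvature operator minus that of constant curvature type with factor `k`.  For an Einstein
metric and the appropriate `k`, this is the Weyl tensor. -/
def weylEnd (k : ℝ) (a b : Tan x) : Module.End ℝ (Tan x) where
  toFun c := curv g x a b c - k • (g.inner x a c • b - g.inner x b c • a)
  map_add' c d := by simp only [curv_add_right, map_add]; module
  map_smul' r c := by simp only [curv_smul_right, map_smul, smul_eq_mul, RingHom.id_apply]; module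

theorem weylEnd_apply (k : ℝ) (a b c : Tan x) :
    weylEnd g k a b c = curv g x a b c - k • (g.inner x a c • b - g.inner x b c • a) := rfl

theorem weylEnd_skew (k : ℝ) (a b : Tan x) : IsSkew g (weylEnd g k a b) := by
  rw [isSkew_iff]
  intro c d
  simp only [weylEnd_apply, map_sub, map_smul, sub_apply, smul_apply, smul_eq_mul,
    inner_curv_skew g a b c d, g.symm x c a, g.symm x c b]
  ring

theorem weylEnd_add_left (k : ℝ) (a a' b : Tan x) :
    weylEnd g k (a + a') b = weylEnd g k a b + weylEnd g k a' b := by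
  ext1 c
  simp only [weylEnd_apply, curv_add_left, map_add, add_apply, LinearMap.add_apply]
  module

theorem weylEnd_smul_left (k r : ℝ) (a b : Tan x) :
    weylEnd g k (r • a) b = r • weylEnd g k a b := by
  ext1 c
  simp only [weylEnd_apply, curv_smul_left, map_smul, smul_apply, LinearMap.smul_apply, smul_eq_mul]
  module

theorem weylEnd_add_right (k : ℝ) (a b b' : Tan x) :
    weylEnd g k a (b + b') = weylEnd g k a b + weylEnd g k a b' := by
  ext1 c
  simp only [weylEnd_apply, curv_add_mid, map_add, add_apply, LinearMap.add_apply]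
  module

theorem weylEnd_smul_right (k r : ℝ) (a b : Tan x) :
    weylEnd g k a (r • b) = r • weylEnd g k a b := by
  ext1 c
  simp only [weylEnd_apply, curv_smul_mid, map_smul, smul_apply, LinearMap.smul_apply, smul_eq_mul]
  module

/-- The bilinear form `(a, b) ↦ ⟨W(a, b), T⟩`. -/
def weylBilin (k : ℝ) (x : M) (T : Module.End ℝ (Tan x)) : Bilin x :=
  LinearMap.toContinuousBilinearMap <| LinearMap.mk₂ ℝ
    (fun a b => ip (weylEnd g k a b) T)
    (fun a a' b => by rw [weylEnd_add_left, ip_add_left])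
    (fun r a b => by rw [weylEnd_smul_left, ip_smul_left, smul_eq_mul])
    (fun a b b' => by rw [weylEnd_add_right, ip_add_left])
    (fun r a b => by rw [weylEnd_smul_right, ip_smul_left, smul_eq_mul])

theorem weylBilin_apply (k : ℝ) (T : Module.End ℝ (Tan x)) (a b : Tan x) :
    weylBilin g k x T a b = ip (weylEnd g k a b) T := rfl

/-- The Weyl tensor acting on endomorphisms. -/
def weylMap (k : ℝ) (x : M) : Module.End ℝ (Tan x) →ₗ[ℝ] Module.End ℝ (Tan x) where
  toFun T := op g (weylBilin g k x T)
  map_add' T T' := LinearMap.ext fun a => inner_ext g fun b => by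
    simp only [LinearMap.add_apply, map_add, add_apply, inner_op, weylBilin_apply, ip_add_right]
  map_smul' r T := LinearMap.ext fun a => inner_ext g fun b => by
    simp only [LinearMap.smul_apply, map_smul, smul_apply, inner_op, weylBilin_apply,
      ip_smul_right, RingHom.id_apply, smul_eq_mul]

theorem inner_weylMap (k : ℝ) (T : Module.End ℝ (Tan x)) (a b : Tan x) :
    g.inner x (weylMap g k x T a) b = ip (weylEnd g k a b) T :=
  inner_op g (weylBilin g k x T) a b

variable {g}

/-- For an Einstein metric, the Weyl tensor is the curvature tensor up to a constant multiple of
the curvature tensor of constant curvature. -/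
theorem IsEinstein.exists_weyl_eq (hE : IsEinstein g) : ∃ k : ℝ, ∀ (x : M) (a b c d : Tan x),
    weyl g x a b c d = g.inner x (weylEnd g k a b c) d := by
  obtain ⟨r, hr⟩ := hE
  refine ⟨r / 3, fun x a b c d => ?_⟩
  have hs : scal g x = 4 * r := by
    have h1 := contraction_eq_trace g (1 : Module.End ℝ (Tan x))
    rw [LinearMap.trace_one, finrank_tan] at h1
    simp only [Module.End.one_apply] at h1
    simp only [scal, hr]
    calc _ = r * ∑ k, ∑ p, gInv g x k p * g.inner x (coordBasis x k) (coordBasis x p) := by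
          simp only [Finset.mul_sum]
          exact Finset.sum_congr rfl fun _ _ => Finset.sum_congr rfl fun _ _ => by ring
      _ = 4 * r := by rw [h1]; push_cast; ring
  simp only [weyl, hs, hr, curv4, weylEnd_apply, map_sub, map_smul, sub_apply, smul_apply,
    smul_eq_mul]
  ring

/-- The operator `weylOp` on `2`-forms corresponds to `weylMap` on endomorphisms. -/
theorem weylOp_eq {k : ℝ} (hk : ∀ (a b c d : Tan x),
    weyl g x a b c d = g.inner x (weylEnd g k a b c) d) (t : Bilin x) (ht : IsTwoForm t)
    (a b : Tan x) : weylOp g t a b = form g (weylMap g k x (op g t)) a b := by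
  have h1 : weylOp g t a b = formInner g (form g (weylEnd g k a b)) t := by
    simp only [weylOp, formInner, form_apply, hk]
  rw [h1, formInner_eq_ip g _ t ht, op_form, form_apply, inner_weylMap]

/-! ### Type III endomorphisms of the bundle of self-dual forms -/

variable (g) in
/-- At the point `x`, the Weyl tensor, given by the endomorphism `W`, vanishes on anti-self-dual
forms and is of Petrov type III on self-dual ones. -/
structure IsTypeIII (W : Module.End ℝ (Tan x) →ₗ[ℝ] Module.End ℝ (Tan x)) : Prop where
  asd : ∀ C, ASD g o C → W C = 0
  selfAdjoint : ∀ A B, SD g o A → SD g o B → ip (W A) B = ip A (W B)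
  exists_basis : ∃ X Y Z, SD g o X ∧ SD g o Y ∧ SD g o Z ∧ X ≠ 0 ∧
    (∀ A, SD g o A → ∃ p q r : ℝ, A = p • X + q • Y + r • Z) ∧ W X = 0 ∧ W Y = X ∧ W Z = Y

variable {o}

/-- The hypotheses on the Weyl tensor, translated into endomorphisms. -/
theorem isTypeIII_weylMap {k : ℝ} (hk : ∀ (a b c d : Tan x),
    weyl g x a b c d = g.inner x (weylEnd g k a b c) d) (hSD : IsSelfDual g o)
    (hP : IsPetrovIIIAt g o x) : IsTypeIII g o (weylMap g k x) := by
  obtain ⟨hsa, X, Y, Z, hX, hY, hZ, hli, hspan, hWX, hWY, hWZ⟩ := hP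
  have hop : ∀ {t : Bilin x}, IsSD g o t → SD g o (op g t) := fun h => by
    rwa [SD, form_op]
  have hWX' : weylMap g k x (op g X) = 0 := by
    refine LinearMap.ext fun a => inner_ext g fun b => ?_
    have := weylOp_eq hk X hX.1 a b
    rw [hWX] at this
    simpa using this.symm
  have hWY' : weylMap g k x (op g Y) = op g X := by
    refine LinearMap.ext fun a => inner_ext g fun b => ?_
    have := weylOp_eq hk Y hY.1 a b
    rw [hWY] at this
    simpa using this.symm
  have hWZ' : weylMap g k x (op g Z) = op g Y := by
    refine LinearMap.ext fun a => inner_ext g fun b => ?_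
    have := weylOp_eq hk Z hZ.1 a b
    rw [hWZ] at this
    simpa using this.symm
  have hdec : ∀ A, SD g o A → ∃ p q r : ℝ, A = p • op g X + q • op g Y + r • op g Z := by
    intro A hA
    have h := hspan (form g A) hA
    rw [Submodule.mem_span_insert] at h
    obtain ⟨p, z, hz, h⟩ := h
    obtain ⟨q, r, rfl⟩ := Submodule.mem_span_pair.1 hz
    refine ⟨p, q, r, ?_⟩
    rw [← op_form g A, h]
    simp only [op_add, op_smul, add_assoc]
  have hWsd : ∀ A, SD g o A → SD g o (weylMap g k x A) := by
    intro A hA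
    obtain ⟨p, q, r, rfl⟩ := hdec A hA
    simp only [map_add, map_smul, hWX', hWY', hWZ']
    have h0 : SD g o ((0 : ℝ) • op g X) := (hop hX).smul 0
    rw [zero_smul] at h0
    exact ((h0.smul p).add ((hop hX).smul q)).add ((hop hY).smul r)
  refine ⟨fun C hC => ?_, fun A B hA hB => ?_, op g X, op g Y, op g Z, hop hX, hop hY, hop hZ, ?_,
    hdec, hWX', hWY', hWZ'⟩
  · refine LinearMap.ext fun a => inner_ext g fun b => ?_
    have h := weylOp_eq hk (form g C) hC.1 a b
    rw [hSD x _ hC, op_form, form_apply] at h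
    simpa using h.symm
  · have h := hsa (form g A) (form g (weylMap g k x A)) (form g B) (form g (weylMap g k x B)) hA hB
      (hWsd A hA) (hWsd B hB)
      (fun a b => by rw [weylOp_eq hk _ hA.1, op_form])
      (fun a b => by rw [weylOp_eq hk _ hB.1, op_form])
    rwa [formInner_eq_ip g _ _ hB.1, formInner_eq_ip g _ _ (hWsd B hB).1, op_form, op_form,
      op_form, op_form] at h
  · intro h0
    have h1 := hli.ne_zero 0
    simp only [Matrix.cons_val_zero] at h1
    apply h1
    rw [← form_op g X, h0]
    ext a b
    simp

/-- The algebraic conditions on `ζ, η, θ` at a point, `ζ, η, θ` being viewed as endomorphisms of the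
tangent space. -/
structure IsTriple (g : NeutralMetric M) (o : MOrientation M)
    (W : Module.End ℝ (Tan x) →ₗ[ℝ] Module.End ℝ (Tan x))
    (ζ η θ : Module.End ℝ (Tan x)) : Prop where
  sdζ : SD g o ζ
  sdη : SD g o η
  sdθ : SD g o θ
  Wζ : W ζ = 0
  Wη : W η = -ζ
  Wθ : W θ = η
  ipζθ : ip ζ θ = 2
  ipηη : ip η η = -2
  ipζζ : ip ζ ζ = 0
  ipζη : ip ζ η = 0
  ipηθ : ip η θ = 0
  ipθθ : ip θ θ = 0
  /-- This is equivalent to `ηv = v` for `v` in `Ker ζ`, as `Ker ζ` is the image of `ζ`. -/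
  ηζ : η * ζ = ζ

theorem SD.sq {A : Module.End ℝ (Tan x)} (hA : SD g o A) : A * A = (-ip A A / 2) • 1 := by
  have h := hA.anticomm hA
  have h2 : (2 : ℝ) • (A * A) = (2 : ℝ) • ((-ip A A / 2) • (1 : Module.End ℝ (Tan x))) := by
    rw [two_smul, h, smul_smul]; congr 1; ring
  exact smul_right_injective _ two_ne_zero h2

theorem SD.anticomm_zero {A B : Module.End ℝ (Tan x)} (hA : SD g o A) (hB : SD g o B)
    (h : ip A B = 0) : A * B = -(B * A) := by
  have h1 := hA.anticomm hB
  rw [h, neg_zero, zero_smul] at h1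
  exact eq_neg_of_add_eq_zero_left h1

namespace IsTriple

variable {W : Module.End ℝ (Tan x) →ₗ[ℝ] Module.End ℝ (Tan x)} {ζ η θ : Module.End ℝ (Tan x)}
  (h : IsTriple g o W ζ η θ)
include h

theorem ζζ : ζ * ζ = 0 := by rw [h.sdζ.sq, h.ipζζ]; simp

theorem ηη : η * η = 1 := by rw [h.sdη.sq, h.ipηη]; norm_num

theorem θθ : θ * θ = 0 := by rw [h.sdθ.sq, h.ipθθ]; simp

theorem ζθ_add : ζ * θ + θ * ζ = (-2 : ℝ) • 1 := by rw [h.sdζ.anticomm h.sdθ, h.ipζθ]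

theorem ηθ : η * θ = -θ := by
  have h1 : θ * ζ * θ = (-2 : ℝ) • θ := by
    have h2 : θ * (ζ * θ + θ * ζ) = θ * ((-2 : ℝ) • 1) := by rw [h.ζθ_add]
    rw [mul_add, ← mul_assoc θ θ, h.θθ, zero_mul, add_zero, mul_smul_comm, mul_one,
      ← mul_assoc] at h2
    exact h2
  have h3 : η * θ = -(θ * η) := h.sdη.anticomm_zero h.sdθ h.ipηθ
  have h4 : η * (θ * ζ * θ) = -(θ * ζ * θ) := by
    rw [← mul_assoc, ← mul_assoc, h3, neg_mul, neg_mul, mul_assoc θ η, h.ηζ]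
  rw [h1, mul_smul_comm, ← smul_neg] at h4
  exact smul_right_injective _ (by norm_num) h4

theorem ζ_ne_zero : ζ ≠ 0 := by
  rintro rfl
  have := h.ipζθ
  simp [ip] at this

/-- `ζ, η, θ` span the self-dual forms. -/
theorem decomp {σ : Module.End ℝ (Tan x)} (hσ : SD g o σ) :
    σ = (ip σ θ / 2) • ζ - (ip σ η / 2) • η + (ip σ ζ / 2) • θ := by
  -- `τ` is orthogonal to `ζ, η, θ`, and hence anticommutes with them
  set τ := σ + ((-(ip σ θ / 2)) • ζ + (ip σ η / 2) • η + (-(ip σ ζ / 2)) • θ) with hτ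
  have hsd : SD g o τ :=
    hσ.add (((h.sdζ.smul _).add (h.sdη.smul _)).add (h.sdθ.smul _))
  have e1 := h.ipζθ
  have e2 := h.ipζη
  have e3 := h.ipηθ
  have a1 : τ * ζ = -(ζ * τ) := hsd.anticomm_zero h.sdζ (by
    simp only [hτ, ip_add_left, ip_smul_left, h.ipζζ, ip_comm η ζ, h.ipζη, ip_comm θ ζ, h.ipζθ]
    ring)
  have a2 : τ * η = -(η * τ) := hsd.anticomm_zero h.sdη (by
    simp only [hτ, ip_add_left, ip_smul_left, h.ipηη, h.ipζη, ip_comm θ η, h.ipηθ]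
    ring)
  have a3 : τ * θ = -(θ * τ) := hsd.anticomm_zero h.sdθ (by
    simp only [hτ, ip_add_left, ip_smul_left, h.ipθθ, h.ipζθ, h.ipηθ]
    ring)
  have b1 : ζ * τ = 0 := by
    have c1 : τ * (η * ζ) = ζ * τ := by
      rw [← mul_assoc, a2, neg_mul, mul_assoc, a1, mul_neg, neg_neg, ← mul_assoc, h.ηζ]
    rw [h.ηζ, a1] at c1
    have c2 : (2 : ℝ) • (ζ * τ) = 0 := by linear_combination (norm := module) -c1
    exact (smul_eq_zero.1 c2).resolve_left two_ne_zero
  have b2 : (ζ * θ + θ * ζ) * τ = 0 := by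
    rw [add_mul, mul_assoc, mul_assoc, b1, mul_zero, add_zero]
    have : θ * τ = -(τ * θ) := by rw [a3, neg_neg]
    rw [this, mul_neg, ← mul_assoc, b1, zero_mul, neg_zero]
  rw [h.ζθ_add, smul_mul_assoc, one_mul] at b2
  have b3 : τ = 0 := (smul_eq_zero.1 b2).resolve_left (by norm_num)
  rw [hτ] at b3
  linear_combination (norm := module) b3

/-- The kernel of `ζ` coincides with its image. -/
theorem mem_range_of_ker {v : Tan x} (hv : ζ v = 0) : ζ ((-(1 / 2) : ℝ) • θ v) = v := by
  have h1 := LinearMap.congr_fun h.ζθ_add v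
  simp only [LinearMap.add_apply, Module.End.mul_apply, hv, map_zero, add_zero,
    LinearMap.smul_apply, Module.End.one_apply] at h1
  rw [map_smul, h1, smul_smul]
  norm_num

theorem ζζ_apply (v : Tan x) : ζ (ζ v) = 0 := LinearMap.congr_fun h.ζζ v

theorem ηζ_apply (v : Tan x) : η (ζ v) = ζ v := LinearMap.congr_fun h.ηζ v

theorem eig_ker_ζ {v : Tan x} (hv : ζ v = 0) : η v = v := by
  rw [← h.mem_range_of_ker hv, h.ηζ_apply]

theorem eig_ker_θ {v : Tan x} (hv : θ v = 0) : η v = -v := by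
  have h1 := LinearMap.congr_fun h.ζθ_add v
  simp only [LinearMap.add_apply, Module.End.mul_apply, hv, map_zero, zero_add,
    LinearMap.smul_apply, Module.End.one_apply] at h1
  have h2 : η (θ (ζ v)) = -θ (ζ v) := LinearMap.congr_fun h.ηθ (ζ v)
  rw [h1, map_smul, ← smul_neg] at h2
  exact smul_right_injective _ (by norm_num) h2

/-- The action of the Weyl tensor on `2`-forms. -/
theorem W_apply (hW : IsTypeIII g o W) {A : Module.End ℝ (Tan x)} (hA : IsSkew g A) :
    W A = (ip η A / 2) • ζ + (ip ζ A / 2) • η := by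
  obtain ⟨S, C, hS, hC, rfl⟩ := hA.exists_sd_add_asd o
  rw [map_add, hW.asd C hC, ip_add_right, ip_add_right, h.sdη.ip_asd hC, h.sdζ.ip_asd hC, add_zero,
    add_zero, add_zero]
  conv_lhs => rw [h.decomp hS]
  simp only [map_add, map_sub, map_smul, h.Wζ, h.Wη, h.Wθ, ip_comm S]
  module

/-- The triple `ζ, η, θ` is unique. -/
theorem unique {ζ' η' θ' : Module.End ℝ (Tan x)} (h' : IsTriple g o W ζ' η' θ') :
    ζ' = ζ ∧ η' = η ∧ θ' = θ := by
  obtain ⟨a, b, c, hθ⟩ : ∃ a b c : ℝ, θ' = a • ζ + b • η + c • θ :=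
    ⟨_, _, _, (h.decomp h'.sdθ).trans (by rw [sub_eq_add_neg, ← neg_smul])⟩
  have hη : η' = (-b) • ζ + c • η := by
    rw [← h'.Wθ, hθ]
    simp only [map_add, map_smul, h.Wζ, h.Wη, h.Wθ]
    module
  have hζ : ζ' = c • ζ := by
    rw [← neg_neg ζ', ← h'.Wη, hη]
    simp only [map_add, map_smul, h.Wζ, h.Wη]
    module
  have e1 : c = 1 := by
    have h1 := h'.ηζ
    rw [hη, hζ] at h1
    simp only [add_mul, smul_mul_assoc, mul_smul_comm, h.ζζ, h.ηζ, smul_zero, zero_add] at h1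
    have h2 : c * c = c := smul_left_injective ℝ h.ζ_ne_zero (by simpa [smul_smul] using h1)
    have hc : c ≠ 0 := by
      rintro rfl
      apply h'.ζ_ne_zero
      rw [hζ, zero_smul]
    exact mul_left_cancel₀ hc (by rw [h2, mul_one])
  subst e1
  have e2 : b = 0 := by
    have h1 := h'.ipηθ
    rw [hη, hθ] at h1
    simp only [ip_add_left, ip_add_right, ip_smul_left, ip_smul_right, h.ipζζ, h.ipζη, h.ipζθ,
      ip_comm η ζ, h.ipηη, h.ipηθ] at h1
    linarith
  subst e2
  have e3 : a = 0 := by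
    have h1 := h'.ipθθ
    rw [hθ] at h1
    simp only [ip_add_left, ip_add_right, ip_smul_left, ip_smul_right, h.ipζζ, h.ipζη, h.ipζθ,
      ip_comm η ζ, ip_comm θ ζ, ip_comm θ η, h.ipηη, h.ipηθ, h.ipθθ] at h1
    linarith
  subst e3
  refine ⟨by rw [hζ, one_smul], by rw [hη]; simp, by rw [hθ]; simp⟩

end IsTriple

/-! ### Explicit construction of the triple -/

section Construction

variable (W : Module.End ℝ (Tan x) →ₗ[ℝ] Module.End ℝ (Tan x)) (T : Module.End ℝ (Tan x)) (c : ℝ)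

/-- The form `ζ` obtained from a `2`-form `T` with `W(WT) ≠ 0` and the normalizing factor `c`. -/
def zetaOf : Module.End ℝ (Tan x) := (-c) • W (W T)

/-- The form `η` obtained from `T`. -/
def etaOf : Module.End ℝ (Tan x) := c • W T - (c * (c * ip (W T) T) / 4) • zetaOf W T c

/-- Up to a multiple of `η`, the self-dual part of `cT`, as extracted by commutators with `η`. -/
def thetaAux : Module.End ℝ (Tan x) :=
  (c / 4) • ((T * etaOf W T c - etaOf W T c * T) * etaOf W T c
    - etaOf W T c * (T * etaOf W T c - etaOf W T c * T))

/-- The form `θ` obtained from `T`. -/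
def thetaOf : Module.End ℝ (Tan x) :=
  thetaAux W T c - (ip (thetaAux W T c) (thetaAux W T c) / 4) • zetaOf W T c

/-- If `W(WT) ≠ 0`, then `(WT)(W(WT))` is a nonzero multiple `ν` of `W(WT)`, and the inverse of `ν`
is the factor for which the above formulas give the triple. -/
theorem IsTypeIII.isTriple {W : Module.End ℝ (Tan x) →ₗ[ℝ] Module.End ℝ (Tan x)}
    (hW : IsTypeIII g o W) {T : Module.End ℝ (Tan x)} (hT : IsSkew g T) (hT0 : W (W T) ≠ 0) :
    ∃ ν : ℝ, ν ≠ 0 ∧ W T * W (W T) = ν • W (W T) ∧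
      IsTriple g o W (zetaOf W T ν⁻¹) (etaOf W T ν⁻¹) (thetaOf W T ν⁻¹) := by
  obtain ⟨X', Y', Z', hX', hY', hZ', hX0, hspan, hWX, hWY, hWZ⟩ := hW.exists_basis
  obtain ⟨S, C, hS, hC, hTS⟩ := hT.exists_sd_add_asd o
  obtain ⟨p, q, r, hSe⟩ := hspan S hS
  have hWT : W T = q • X' + r • Y' := by
    rw [hTS, map_add, hW.asd C hC, hSe]
    simp only [map_add, map_smul, hWX, hWY, hWZ]
    module
  have hWWT : W (W T) = r • X' := by
    rw [hWT]
    simp only [map_add, map_smul, hWX, hWY]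
    module
  have hr : r ≠ 0 := by
    rintro rfl
    apply hT0
    rw [hWWT, zero_smul]
  have i1 : ip X' X' = 0 := by
    have := hW.selfAdjoint Y' X' hY' hX'
    rw [hWY, hWX] at this
    rw [this]; simp [ip]
  have i2 : ip X' Y' = 0 := by
    have := hW.selfAdjoint X' Z' hX' hZ'
    rw [hWX, hWZ] at this
    rw [← this]; simp [ip]
  have i3 : ip X' Z' = ip Y' Y' := by
    have := hW.selfAdjoint Y' Z' hY' hZ'
    rwa [hWY, hWZ] at this
  have ha : ip Y' Y' ≠ 0 := by
    intro ha
    apply hX0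
    refine hX'.eq_zero fun B hB => ?_
    obtain ⟨p, q, r, rfl⟩ := hspan B hB
    simp only [ip_add_right, ip_smul_right, i1, i2, i3, ha]
    ring
  set a := ip Y' Y' with ha_def
  set X := W (W T) with hX_def
  set Y := W T with hY_def
  have hX : SD g o X := by rw [hWWT]; exact hX'.smul r
  have hY : SD g o Y := by rw [hWT]; exact (hX'.smul q).add (hY'.smul r)
  have hWX0 : W X = 0 := by rw [hWWT, map_smul, hWX, smul_zero]
  have jXX : ip X X = 0 := by
    rw [hWWT]; simp only [ip_smul_left, ip_smul_right, i1]; ring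
  have jXY : ip X Y = 0 := by
    rw [hWWT, hWT]; simp only [ip_add_right, ip_smul_left, ip_smul_right, i1, i2]; ring
  have jYY : ip Y Y = r ^ 2 * a := by
    rw [hWT]
    simp only [ip_add_left, ip_add_right, ip_smul_left, ip_smul_right, i1, i2, ip_comm Y' X',
      ← ha_def]
    ring
  have jXS : ip X S = r ^ 2 * a := by
    rw [hWWT, hSe]
    simp only [ip_add_right, ip_smul_left, ip_smul_right, i1, i2, i3]
    ring
  have hXXmul : X * X = 0 := by rw [hX.sq, jXX]; simp
  have hXYmul : X * Y = -(Y * X) := hX.anticomm_zero hY jXY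
  -- the product `YX` is half of a commutator, hence self-dual, and it is orthogonal to `X` and `Y`
  have hYX : SD g o (Y * X) := by
    have h1 := (hY.commutator hX).smul (1 / 2)
    rw [hXYmul] at h1
    convert h1 using 1
    module
  obtain ⟨p₁, q₁, r₁, hYXe⟩ := hspan _ hYX
  have one_ne : (1 : Module.End ℝ (Tan x)) ≠ 0 := one_ne_zero
  have k1 : ip (Y * X) X = 0 := by
    have h1 := hYX.anticomm hX
    rw [mul_assoc, hXXmul, mul_zero, ← mul_assoc, hXYmul, neg_mul, mul_assoc, hXXmul, mul_zero,
      neg_zero, add_zero] at h1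
    have := (smul_eq_zero.1 h1.symm).resolve_right one_ne
    linarith
  have k2 : ip (Y * X) Y = 0 := by
    have h1 := hYX.anticomm hY
    rw [mul_assoc, hXYmul, mul_neg, neg_add_cancel] at h1
    have := (smul_eq_zero.1 h1.symm).resolve_right one_ne
    linarith
  have hr₁ : r₁ = 0 := by
    rw [hYXe, hWWT] at k1
    simp only [ip_add_left, ip_smul_left, ip_smul_right, i1, i2, ip_comm Y' X', ip_comm Z' X',
      i3] at k1
    have : r * (r₁ * a) = 0 := by linarith
    simpa [hr, ha] using this
  have hq₁ : q₁ = 0 := by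
    rw [hYXe, hWT, hr₁] at k2
    simp only [ip_add_left, ip_add_right, ip_smul_left, ip_smul_right, i1, i2, ip_comm Y' X',
      ← ha_def] at k2
    have : r * (q₁ * a) = 0 := by linarith
    simpa [hr, ha] using this
  -- as `YX` is orthogonal to `X` and `Y`, only its `X'` component remains
  obtain ⟨ν, hν⟩ : ∃ ν : ℝ, Y * X = ν • X := by
    refine ⟨p₁ / r, ?_⟩
    rw [hYXe, hr₁, hq₁, hWWT, smul_smul, div_mul_cancel₀ _ hr]
    simp
  -- from `Y²X = ν²X` and `Y² = -⟨Y,Y⟩/2`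
  have hνa : r ^ 2 * a = -2 * ν ^ 2 := by
    have h1 : Y * Y * X = (ν * ν) • X := by
      rw [mul_assoc, hν, mul_smul_comm, hν, smul_smul]
    rw [hY.sq, smul_mul_assoc, one_mul, jYY] at h1
    have := smul_left_injective ℝ hT0 h1
    linarith
  have hν0 : ν ≠ 0 := by
    rintro rfl
    have : r ^ 2 * a = 0 := by rw [hνa]; ring
    simp [hr, ha] at this
  refine ⟨ν, hν0, hν, ?_⟩
  set c := ν⁻¹ with hc
  have hcν : c * ν = 1 := inv_mul_cancel₀ hν0
  have hc2 : c ^ 2 * (r ^ 2 * a) = -2 := by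
    rw [hνa]; linear_combination (-2) * (c * ν + 1) * hcν
  have hζdef : zetaOf W T c = (-c) • X := rfl
  set ζ := zetaOf W T c with hζ
  set m := c * (c * ip Y S) with hm
  have hYT : ip Y T = ip Y S := by rw [hTS, ip_add_right, hY.ip_asd hC, add_zero]
  have hηdef : etaOf W T c = c • Y - (m / 4) • ζ := by
    rw [etaOf, ← hY_def, hYT]
  set η := etaOf W T c with hη
  have sdζ : SD g o ζ := by rw [hζdef]; exact hX.smul _
  have sdη : SD g o η := by
    rw [hηdef, sub_eq_add_neg, ← neg_smul]; exact (hY.smul _).add (sdζ.smul _)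
  have ζζ : ip ζ ζ = 0 := by
    rw [hζdef]; simp only [ip_smul_left, ip_smul_right, jXX]; ring
  have ζY : ip ζ Y = 0 := by rw [hζdef]; simp only [ip_smul_left, jXY]; ring
  have ζη : ip ζ η = 0 := by
    rw [hηdef, sub_eq_add_neg, ← neg_smul]
    simp only [ip_add_right, ip_smul_right, ζζ, ζY]; ring
  have ηη : ip η η = -2 := by
    rw [hηdef, sub_eq_add_neg, ← neg_smul]
    simp only [ip_add_right, ip_add_left, ip_smul_left, ip_smul_right, ζζ, ζY, ip_comm Y ζ, jYY]
    linear_combination hc2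
  have ζS : ip ζ (c • S) = 2 := by
    rw [hζdef]; simp only [ip_smul_left, ip_smul_right, jXS]
    linear_combination -hc2
  have ηS : ip η (c • S) = m / 2 := by
    rw [hηdef, sub_eq_add_neg, ← neg_smul, ip_add_left, ip_smul_left (-(m / 4)), ζS, ip_smul_left,
      ip_smul_right, hm]
    ring
  have ηsq : η * η = 1 := by rw [sdη.sq, ηη]; norm_num
  have hηζ : η * ζ = ζ := by
    have h1 : ζ * ζ = 0 := by rw [sdζ.sq, ζζ]; simp
    have h2 : Y * ζ = ν • ζ := by rw [hζdef, mul_smul_comm, hν, smul_comm]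
    rw [hηdef, sub_mul, smul_mul_assoc, smul_mul_assoc, h1, h2, smul_smul, hcν]
    simp
  -- the commutator with `η` removes the anti-self-dual part `C` of `T`, and a second one restores
  -- the component of `S` orthogonal to `η`, multiplied by `4`
  have hθ₀ : thetaAux W T c = c • S + (m / 4) • η := by
    have e1 : η * C = C * η := sdη.comm_asd hC
    have e2 : S * η = -(c⁻¹ * (m / 2)) • 1 - η * S := by
      have h1 := hS.anticomm sdη
      have h2 : ip S η = c⁻¹ * (m / 2) := by
        rw [← ηS, ip_smul_right, ip_comm S, ← mul_assoc, inv_mul_cancel₀ (inv_ne_zero hν0), one_mul]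
      rw [h2] at h1
      rw [← h1]; abel
    have e3 : η * (S * η) = -(c⁻¹ * (m / 2)) • η - S := by
      rw [e2, mul_sub, mul_smul_comm, mul_one, ← mul_assoc, ηsq, one_mul]
    have e4 : (T * η - η * T) * η - η * (T * η - η * T) =
        (4 : ℝ) • S + (c⁻¹ * m) • η := by
      have f1 : T * η - η * T = S * η - η * S := by
        rw [hTS, add_mul, mul_add, e1]; abel
      rw [f1, sub_mul, mul_sub, mul_assoc S, ηsq, mul_one, mul_assoc η S, e3, ← mul_assoc η η, ηsq,
        one_mul]
      module
    have hcc : c * c⁻¹ = 1 := mul_inv_cancel₀ (inv_ne_zero hν0)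
    rw [thetaAux, ← hη, e4, smul_add, smul_smul, smul_smul]
    congr 2
    · ring
    · linear_combination (m / 4) * hcc
  have hθdef : thetaOf W T c = thetaAux W T c
      + (-(ip (thetaAux W T c) (thetaAux W T c) / 4)) • ζ := by
    rw [thetaOf, neg_smul, sub_eq_add_neg]
  set θ₀ := thetaAux W T c with hθ₀'
  have sdθ₀ : SD g o θ₀ := by rw [hθ₀]; exact (hS.smul c).add (sdη.smul _)
  have ζθ₀ : ip ζ θ₀ = 2 := by
    rw [hθ₀, ip_add_right, ζS, ip_smul_right, ζη]; ring
  have ηθ₀ : ip η θ₀ = 0 := by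
    rw [hθ₀, ip_add_right, ηS, ip_smul_right, ηη]; ring
  have Wζ : W ζ = 0 := by rw [hζdef, map_smul, hWX0, smul_zero]
  have Wη : W η = -ζ := by
    rw [hηdef, map_sub, map_smul, map_smul, Wζ, hζdef, ← hX_def]; simp
  rw [hθdef]
  refine ⟨sdζ, sdη, sdθ₀.add (sdζ.smul _), Wζ, Wη, ?_, ?_, ηη, ζζ, ζη, ?_, ?_, hηζ⟩
  · have hWS : W S = Y := by rw [hY_def, hTS, map_add, hW.asd C hC, add_zero]
    rw [hθ₀]
    simp only [map_add, map_smul, hWS, Wη, Wζ]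
    rw [hηdef]
    module
  · rw [ip_add_right, ip_smul_right, ζθ₀, ζζ]; ring
  · rw [ip_add_right, ip_smul_right, ηθ₀, ip_comm η ζ, ζη]; ring
  · simp only [ip_add_right, ip_add_left, ip_smul_right, ip_smul_left, ζζ, ζθ₀, ip_comm θ₀ ζ]
    ring

end Construction

theorem IsTypeIII.exists_weylSq_ne_zero {W : Module.End ℝ (Tan x) →ₗ[ℝ] Module.End ℝ (Tan x)}
    (hW : IsTypeIII g o W) : ∃ T, IsSkew g T ∧ W (W T) ≠ 0 := by
  obtain ⟨X, Y, Z, hX, hY, hZ, hX0, -, hWX, hWY, hWZ⟩ := hW.exists_basis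
  exact ⟨Z, hZ.skew, by rwa [hWZ, hWY]⟩

/-- The Weyl tensor in terms of the triple. -/
theorem IsTriple.weylEnd_eq {k : ℝ} {ζ η θ : Module.End ℝ (Tan x)}
    (h : IsTriple g o (weylMap g k x) ζ η θ) (hW : IsTypeIII g o (weylMap g k x)) (a b : Tan x) :
    weylEnd g k a b = (g.inner x (ζ a) b / 2) • η + (g.inner x (η a) b / 2) • ζ := by
  have hs : IsSkew g (weylEnd g k a b + ((-(g.inner x (ζ a) b / 2)) • η
      + (-(g.inner x (η a) b / 2)) • ζ)) :=
    (weylEnd_skew g k a b).add ((h.sdη.skew.smul _).add (h.sdζ.skew.smul _))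
  have h0 := hs.eq_zero o fun B hB => by
    have h1 := inner_weylMap g k B a b
    rw [h.W_apply hW hB] at h1
    simp only [LinearMap.add_apply, LinearMap.smul_apply, map_add, map_smul, add_apply, smul_apply,
      smul_eq_mul] at h1
    simp only [ip_add_left, ip_smul_left]
    linarith
  rw [eq_neg_of_add_eq_zero_left h0]
  module

end TypeIII

/-! ### Smooth families of triples -/

section EndFields

variable {M : Type*} [TopologicalSpace M] [ChartedSpace E4 M] [IsManifold (𝓡 4) ∞ M]
variable (g : NeutralMetric M) {o : MOrientation M} {x : M}

/-- Fields of endomorphisms of the tangent spaces. -/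
abbrev EndField (M : Type*) [TopologicalSpace M] [ChartedSpace E4 M] : Type _ :=
  (x : M) → Module.End ℝ (Tan x)

/-- The field of endomorphisms `A` is of class `C^∞` in some neighbourhood of `x`, in the sense that
it sends fields which are smooth near `x` to such fields. -/
def SmoothEndNear (A : EndField M) (x : M) : Prop :=
  ∀ X : VField M, SmoothFieldNear X x → SmoothFieldNear (fun y => A y (X y)) x

variable {A B : EndField M} {f : M → ℝ}

theorem SmoothEndNear.congr (hA : SmoothEndNear A x) (h : ∀ᶠ y in 𝓝 x, B y = A y) :
    SmoothEndNear B x :=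
  fun X hX => (hA X hX).congr (h.mono fun y hy => by rw [hy])

theorem SmoothEndNear.sub (hA : SmoothEndNear A x) (hB : SmoothEndNear B x) :
    SmoothEndNear (fun y => A y - B y) x := fun X hX => (hA X hX).sub (hB X hX)

theorem SmoothEndNear.mul (hA : SmoothEndNear A x) (hB : SmoothEndNear B x) :
    SmoothEndNear (fun y => A y * B y) x := fun X hX => hA _ (hB X hX)

theorem SmoothFunNear.smul_end (hf : SmoothFunNear f x) (hA : SmoothEndNear A x) :
    SmoothEndNear (fun y => f y • A y) x := fun X hX => hf.smul (hA X hX)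

theorem SmoothEndNear.trace (hA : SmoothEndNear A x) :
    SmoothFunNear (fun y => LinearMap.trace ℝ _ (A y)) x := by
  refine (SmoothFunNear.sum (s := Finset.univ) fun i =>
    smooth_frameCoeff x i (hA _ (smooth_frame x i))).congr ?_
  filter_upwards [frameDom_mem x] with y hy
  rw [LinearMap.trace_eq_matrix_trace ℝ (frameBasis hy), Matrix.trace]
  refine Finset.sum_congr rfl fun i _ => ?_
  rw [Matrix.diag_apply, LinearMap.toMatrix_apply, frameCoeff_eq hy, frameBasis_apply]

theorem SmoothEndNear.ip (hA : SmoothEndNear A x) (hB : SmoothEndNear B x) :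
    SmoothFunNear (fun y => ip (A y) (B y)) x :=
  (smoothFunNear_const _).mul (hA.mul hB).trace

theorem smooth_weylEnd (k : ℝ) {X Y : VField M} (hX : SmoothFieldNear X x)
    (hY : SmoothFieldNear Y x) : SmoothEndNear (fun y => weylEnd g k (X y) (Y y)) x := by
  intro Z hZ
  refine ((hX.curvField g hY hZ).sub (SmoothFunNear.smul (smoothFunNear_const k)
    (((hX.inner g hZ).smul hY).sub ((hY.inner g hZ).smul hX)))).congr ?_
  filter_upwards [hX.eventually, hY.eventually, hZ.eventually] with y h1 h2 h3
  rw [weylEnd_apply, curv_eq g h1 h2 h3]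
  rfl

theorem SmoothEndNear.weylMap (k : ℝ) (hA : SmoothEndNear A x) :
    SmoothEndNear (fun y => weylMap g k y (A y)) x := by
  intro X hX
  refine smoothFieldNear_of_inner g fun Y hY => ?_
  simp only [inner_weylMap]
  exact (smooth_weylEnd g k hX hY).ip hA

/-- The `2`-form `a ∧ b`, viewed as an endomorphism. -/
def wedge (a b : Tan x) : Module.End ℝ (Tan x) :=
  (g.inner x a).toLinearMap.smulRight b - (g.inner x b).toLinearMap.smulRight a

theorem wedge_apply (a b c : Tan x) : wedge g a b c = g.inner x a c • b - g.inner x b c • a := rfl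

theorem wedge_skew (a b : Tan x) : IsSkew g (wedge g a b) := by
  rw [isSkew_iff]
  intro c d
  simp only [wedge_apply, map_sub, map_smul, sub_apply, smul_apply, smul_eq_mul, g.symm x c]
  ring

theorem smooth_wedge {X Y : VField M} (hX : SmoothFieldNear X x) (hY : SmoothFieldNear Y x) :
    SmoothEndNear (fun y => wedge g (X y) (Y y)) x :=
  fun _ hZ => ((hX.inner g hZ).smul hY).sub ((hY.inner g hZ).smul hX)

variable {g}

theorem IsSkew.ip_wedge {A : Module.End ℝ (Tan x)} (hA : IsSkew g A) (a b : Tan x) :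
    ip A (wedge g a b) = g.inner x (A a) b := by
  have h1 : A * wedge g a b = (g.inner x a).toLinearMap.smulRight (A b)
      - (g.inner x b).toLinearMap.smulRight (A a) := by
    ext1 c
    simp [wedge_apply, Module.End.mul_apply]
  have h2 := (isSkew_iff g A).1 hA a b
  rw [ip, h1, map_sub, LinearMap.trace_smulRight, LinearMap.trace_smulRight]
  simp only [ContinuousLinearMap.coe_coe]
  rw [g.symm x b]
  linarith

theorem IsTypeIII.exists_triple {W : Module.End ℝ (Tan x) →ₗ[ℝ] Module.End ℝ (Tan x)}
    (hW : IsTypeIII g o W) : ∃ ζ η θ, IsTriple g o W ζ η θ := by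
  obtain ⟨T, hT, hT0⟩ := hW.exists_weylSq_ne_zero
  obtain ⟨ν, -, -, h⟩ := hW.isTriple hT hT0
  exact ⟨_, _, _, h⟩

/-- Some decomposable form has a nonzero image under `W²`.  Such a form, unlike an arbitrary one, is
easily extended to a smooth field. -/
theorem IsTypeIII.exists_wedge {W : Module.End ℝ (Tan x) →ₗ[ℝ] Module.End ℝ (Tan x)}
    (hW : IsTypeIII g o W) : ∃ a b : Tan x, W (W (wedge g a b)) ≠ 0 := by
  obtain ⟨ζ, η, θ, h⟩ := hW.exists_triple
  obtain ⟨a, b, hab⟩ : ∃ a b : Tan x, g.inner x (ζ a) b ≠ 0 := by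
    by_contra! h0
    exact h.ζ_ne_zero (LinearMap.ext fun a => inner_nondegenerate g (h0 a))
  refine ⟨a, b, ?_⟩
  rw [h.W_apply hW (wedge_skew g a b), h.sdη.skew.ip_wedge, h.sdζ.skew.ip_wedge, map_add, map_smul,
    map_smul, h.Wζ, h.Wη, smul_zero, zero_add, smul_neg, neg_ne_zero]
  exact smul_ne_zero (div_ne_zero hab two_ne_zero) h.ζ_ne_zero

/-- Near each point there is a smooth field of triples, given by the explicit formulas applied to a
smooth field of decomposable forms. -/
theorem exists_smooth_triple {k : ℝ} (hW : ∀ x, IsTypeIII g o (weylMap g k x)) (x : M) :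
    ∃ ζ η θ : EndField M, SmoothEndNear ζ x ∧ SmoothEndNear η x ∧ SmoothEndNear θ x ∧
      ∀ᶠ y in 𝓝 x, IsTriple g o (weylMap g k y) (ζ y) (η y) (θ y) := by
  obtain ⟨a, b, hab⟩ := (hW x).exists_wedge
  obtain ⟨T, hT, hTs, hT0⟩ : ∃ T : EndField M, SmoothEndNear T x ∧ (∀ y, IsSkew g (T y)) ∧
      weylMap g k x (weylMap g k x (T x)) ≠ 0 :=
    ⟨fun y => wedge g (FiberBundle.extend E4 a y) (FiberBundle.extend E4 b y),
      smooth_wedge g (smooth_extend a) (smooth_extend b), fun y => wedge_skew g _ _,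
      by simpa only [FiberBundle.extend_apply_self] using hab⟩
  have hWT := hT.weylMap g k
  have hWWT := hWT.weylMap g k
  obtain ⟨c, d, hcd⟩ : ∃ c d : Tan x,
      g.inner x (weylMap g k x (weylMap g k x (T x)) c) d ≠ 0 := by
    by_contra! h0
    exact hT0 (LinearMap.ext fun a => inner_nondegenerate g (h0 a))
  have hc := smooth_extend c
  have hd := smooth_extend d
  have hden := (hWWT _ hc).inner g hd
  have hnum := ((hWT.mul hWWT) _ hc).inner g hd
  -- the reciprocal of the factor `ν` with `(WT)(W(WT)) = ν W(WT)`
  set f : M → ℝ := fun y => g.inner y (weylMap g k y (weylMap g k y (T y))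
      (FiberBundle.extend E4 c y)) (FiberBundle.extend E4 d y) *
    (g.inner y ((weylMap g k y (T y) * weylMap g k y (weylMap g k y (T y)))
      (FiberBundle.extend E4 c y)) (FiberBundle.extend E4 d y))⁻¹ with hf_def
  have hden0 := hden.continuousAt.eventually_ne (by simpa using hcd)
  have key : ∀ᶠ y in 𝓝 x, ∃ ν : ℝ, ν ≠ 0 ∧ f y = ν⁻¹ ∧
      weylMap g k y (T y) * weylMap g k y (weylMap g k y (T y)) =
        ν • weylMap g k y (weylMap g k y (T y)) ∧
      IsTriple g o (weylMap g k y) (zetaOf (weylMap g k y) (T y) ν⁻¹)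
        (etaOf (weylMap g k y) (T y) ν⁻¹) (thetaOf (weylMap g k y) (T y) ν⁻¹) := by
    filter_upwards [hden0] with y hy
    have hy0 : weylMap g k y (weylMap g k y (T y)) ≠ 0 := fun h0 => hy (by simp [h0])
    obtain ⟨ν, hν, h1, h2⟩ := (hW y).isTriple (hTs y) hy0
    refine ⟨ν, hν, ?_, h1, h2⟩
    simp only [hf_def, h1, LinearMap.smul_apply, map_smul, smul_apply, smul_eq_mul, mul_inv]
    rw [mul_comm ν⁻¹, mul_inv_cancel_left₀ hy]
  have hf : SmoothFunNear f x := by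
    refine hden.mul (hnum.inv ?_)
    obtain ⟨ν, hν, -, h1, -⟩ := key.self_of_nhds
    simp only [h1, LinearMap.smul_apply, map_smul, smul_apply, smul_eq_mul]
    exact mul_ne_zero hν hden0.self_of_nhds
  have hζ : SmoothEndNear (fun y => zetaOf (weylMap g k y) (T y) (f y)) x := hf.neg.smul_end hWWT
  have hη : SmoothEndNear (fun y => etaOf (weylMap g k y) (T y) (f y)) x :=
    (hf.smul_end hWT).sub (((hf.mul (hf.mul (hWT.ip hT))).mul
      (smoothFunNear_const (1 / 4))).smul_end hζ |>.congr (Filter.Eventually.of_forall fun y => by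
        rw [mul_one_div]))
  have hTη := (hT.mul hη).sub (hη.mul hT)
  have hθ' : SmoothEndNear (fun y => thetaAux (weylMap g k y) (T y) (f y)) x :=
    ((hf.mul (smoothFunNear_const (1 / 4))).smul_end ((hTη.mul hη).sub (hη.mul hTη))).congr
      (Filter.Eventually.of_forall fun y => by rw [mul_one_div]; rfl)
  have hθ : SmoothEndNear (fun y => thetaOf (weylMap g k y) (T y) (f y)) x :=
    hθ'.sub (((hθ'.ip hθ').mul (smoothFunNear_const (1 / 4))).smul_end hζ |>.congr
      (Filter.Eventually.of_forall fun y => by rw [mul_one_div]))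
  refine ⟨_, _, _, hζ, hη, hθ, ?_⟩
  filter_upwards [key] with y hy
  obtain ⟨ν, -, hν, -, h⟩ := hy
  rwa [hν]

/-- A smooth family of triples `ζ, η, θ`, where the forms are viewed as endomorphisms of the tangent
spaces and the Weyl tensor is given by `weylMap g k`. -/
structure TripleField (g : NeutralMetric M) (o : MOrientation M) (k : ℝ) where
  /-- The form with `Wζ = 0`. -/
  ζ : EndField M
  /-- The form with `Wη = -ζ`. -/
  η : EndField M
  /-- The form with `Wθ = η`. -/
  θ : EndField M
  isTriple : ∀ x, IsTriple g o (weylMap g k x) (ζ x) (η x) (θ x)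
  smooth_ζ : ∀ x, SmoothEndNear ζ x
  smooth_η : ∀ x, SmoothEndNear η x
  smooth_θ : ∀ x, SmoothEndNear θ x

/-- By uniqueness, the triples at the individual points form a smooth field. -/
theorem exists_tripleField {k : ℝ} (hW : ∀ x, IsTypeIII g o (weylMap g k x)) :
    Nonempty (TripleField g o k) := by
  choose ζ η θ h using fun x => (hW x).exists_triple
  have key : ∀ x, ∃ ζ' η' θ' : EndField M, SmoothEndNear ζ' x ∧ SmoothEndNear η' x ∧
      SmoothEndNear θ' x ∧ ∀ᶠ y in 𝓝 x, ζ y = ζ' y ∧ η y = η' y ∧ θ y = θ' y := by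
    intro x
    obtain ⟨ζ', η', θ', h1, h2, h3, h4⟩ := exists_smooth_triple hW x
    exact ⟨ζ', η', θ', h1, h2, h3, h4.mono fun y hy => hy.unique (h y)⟩
  refine ⟨ζ, η, θ, h, fun x => ?_, fun x => ?_, fun x => ?_⟩ <;>
    obtain ⟨ζ', η', θ', h1, h2, h3, h4⟩ := key x
  · exact h1.congr (h4.mono fun y hy => hy.1)
  · exact h2.congr (h4.mono fun y hy => hy.2.1)
  · exact h3.congr (h4.mono fun y hy => hy.2.2)

end EndFields

/-! ### Covariant derivatives of endomorphism fields -/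

section CovariantDerivative

variable {M : Type*} [TopologicalSpace M] [ChartedSpace E4 M] [IsManifold (𝓡 4) ∞ M]
variable (g : NeutralMetric M) {o : MOrientation M} {x : M}

/-- The covariant derivative of a field of endomorphisms, evaluated on vector fields. -/
def nablaEnd (A : EndField M) (u w : VField M) : VField M :=
  fun x => nabla g u (fun y => A y (w y)) x - A x (nabla g u w x)

variable {A B : EndField M} {u v w X Y : VField M} {f : M → ℝ}

theorem SmoothEndNear.nablaEnd (hA : SmoothEndNear A x) (hu : SmoothFieldNear u x)
    (hw : SmoothFieldNear w x) : SmoothFieldNear (nablaEnd g A u w) x :=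
  (hu.nabla g (hA w hw)).sub (hA _ (hu.nabla g hw))

theorem nablaEnd_add_left (hA : SmoothEndNear A x) (hX : SmoothFieldNear X x)
    (hY : SmoothFieldNear Y x) (hw : SmoothFieldNear w x) :
    nablaEnd g A (X + Y) w x = nablaEnd g A X w x + nablaEnd g A Y w x := by
  simp only [nablaEnd, nabla_add_left g hX hY (hA w hw), nabla_add_left g hX hY hw, map_add]
  abel

theorem nablaEnd_smul_left (hA : SmoothEndNear A x) (hf : SmoothFunNear f x)
    (hX : SmoothFieldNear X x) (hw : SmoothFieldNear w x) :
    nablaEnd g A (f • X) w x = f x • nablaEnd g A X w x := by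
  simp only [nablaEnd, nabla_smul_left g hf hX (hA w hw), nabla_smul_left g hf hX hw, map_smul,
    smul_sub]

theorem nablaEnd_add_right (hA : SmoothEndNear A x) (hu : SmoothFieldNear u x)
    (hX : SmoothFieldNear X x) (hY : SmoothFieldNear Y x) :
    nablaEnd g A u (X + Y) x = nablaEnd g A u X x + nablaEnd g A u Y x := by
  have h : (fun y => A y ((X + Y) y)) = (fun y => A y (X y)) + fun y => A y (Y y) :=
    funext fun y => map_add _ _ _
  simp only [nablaEnd, h, nabla_add_right g hu (hA X hX) (hA Y hY), nabla_add_right g hu hX hY,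
    map_add]
  abel

theorem nablaEnd_smul_right (hA : SmoothEndNear A x) (hf : SmoothFunNear f x)
    (hu : SmoothFieldNear u x) (hX : SmoothFieldNear X x) :
    nablaEnd g A u (f • X) x = f x • nablaEnd g A u X x := by
  have h : (fun y => A y ((f • X) y)) = f • fun y => A y (X y) :=
    funext fun y => (A y).map_smul _ _
  simp only [nablaEnd, h, nabla_leibniz g hu hf (hA X hX), nabla_leibniz g hu hf hX, map_add,
    map_smul]
  module

theorem nablaEnd_congr (hA : SmoothEndNear A x) {u' w' : VField M} (hu : SmoothFieldNear u x)
    (hw : SmoothFieldNear w x) (hu' : SmoothFieldNear u' x) (hw' : SmoothFieldNear w' x)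
    (huu' : u x = u' x) (hww' : w x = w' x) : nablaEnd g A u w x = nablaEnd g A u' w' x :=
  (tensorial_pointwise (fun u => nablaEnd g A u w x)
    (fun _ _ hX hY => nablaEnd_add_left g hA hX hY hw)
    (fun _ _ hf hX => nablaEnd_smul_left g hA hf hX hw) hu hu' huu').trans
  (tensorial_pointwise (fun w => nablaEnd g A u' w x)
    (fun _ _ hX hY => nablaEnd_add_right g hA hu' hX hY)
    (fun _ _ hf hX => nablaEnd_smul_right g hA hf hu' hX) hw hw' hww')

/-- The covariant derivative of a field of endomorphisms, as a tensor. -/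
def endDer (hA : SmoothEndNear A x) : Tan x →ₗ[ℝ] Module.End ℝ (Tan x) :=
  LinearMap.mk₂ ℝ
    (fun a b => nablaEnd g A (FiberBundle.extend E4 a) (FiberBundle.extend E4 b) x)
    (fun a a' b => by
      rw [← nablaEnd_add_left g hA (smooth_extend a) (smooth_extend a') (smooth_extend b)]
      exact nablaEnd_congr g hA (smooth_extend _) (smooth_extend b)
        ((smooth_extend a).add (smooth_extend a')) (smooth_extend b) (by simp) rfl)
    (fun c a b => by
      rw [← nablaEnd_smul_left g hA (smoothFunNear_const c) (smooth_extend a) (smooth_extend b)]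
      exact nablaEnd_congr g hA (smooth_extend _) (smooth_extend b)
        ((smoothFunNear_const c).smul (smooth_extend a)) (smooth_extend b) (by simp) rfl)
    (fun a b b' => by
      rw [← nablaEnd_add_right g hA (smooth_extend a) (smooth_extend b) (smooth_extend b')]
      exact nablaEnd_congr g hA (smooth_extend a) (smooth_extend _) (smooth_extend a)
        ((smooth_extend b).add (smooth_extend b')) rfl (by simp))
    (fun c a b => by
      rw [← nablaEnd_smul_right g hA (smoothFunNear_const c) (smooth_extend a) (smooth_extend b)]
      exact nablaEnd_congr g hA (smooth_extend a) (smooth_extend _) (smooth_extend a)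
        ((smoothFunNear_const c).smul (smooth_extend b)) rfl (by simp))

theorem endDer_apply (hA : SmoothEndNear A x) (hu : SmoothFieldNear u x)
    (hw : SmoothFieldNear w x) : endDer g hA (u x) (w x) = nablaEnd g A u w x :=
  nablaEnd_congr g hA (smooth_extend _) (smooth_extend _) hu hw (by simp) (by simp)

theorem nabla_end (hA : SmoothEndNear A x) (hu : SmoothFieldNear u x)
    (hw : SmoothFieldNear w x) : nabla g u (fun y => A y (w y)) x =
      A x (nabla g u w x) + endDer g hA (u x) (w x) := by
  rw [endDer_apply g hA hu hw, nablaEnd]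
  abel

theorem endDer_skew (hA : SmoothEndNear A x) (hs : ∀ y, IsSkew g (A y)) (a : Tan x) :
    IsSkew g (endDer g hA a) := by
  rw [isSkew_iff]
  intro b c
  obtain ⟨u, rfl, hu⟩ : ∃ u : VField M, u x = a ∧ SmoothFieldNear u x :=
    ⟨_, FiberBundle.extend_apply_self E4 a, smooth_extend a⟩
  obtain ⟨v, rfl, hv⟩ : ∃ u : VField M, u x = b ∧ SmoothFieldNear u x :=
    ⟨_, FiberBundle.extend_apply_self E4 b, smooth_extend b⟩
  obtain ⟨w, rfl, hw⟩ : ∃ u : VField M, u x = c ∧ SmoothFieldNear u x :=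
    ⟨_, FiberBundle.extend_apply_self E4 c, smooth_extend c⟩
  have h1 := nabla_metric g hu (hA v hv) hw
  have h2 := nabla_metric g hu hv (hA w hw)
  have h3 : (fun y => g.inner y (A y (v y)) (w y)) = fun y => -g.inner y (v y) (A y (w y)) :=
    funext fun y => (isSkew_iff g _).1 (hs y) _ _
  rw [h3, dirDeriv_neg, h2, nabla_end g hA hu hv, nabla_end g hA hu hw] at h1
  simp only [map_add, add_apply] at h1
  have h4 := (isSkew_iff g _).1 (hs x)
  rw [h4, h4] at h1
  linarith

/-- The product rule for the anticommutator. -/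
theorem endDer_anticomm (hA : SmoothEndNear A x) (hB : SmoothEndNear B x) {c : ℝ}
    (h : ∀ y, A y * B y + B y * A y = c • 1) (a : Tan x) :
    endDer g hA a * B x + A x * endDer g hB a + (endDer g hB a * A x + B x * endDer g hA a)
      = 0 := by
  ext1 b
  obtain ⟨u, rfl, hu⟩ : ∃ u : VField M, u x = a ∧ SmoothFieldNear u x :=
    ⟨_, FiberBundle.extend_apply_self E4 a, smooth_extend a⟩
  obtain ⟨w, rfl, hw⟩ : ∃ u : VField M, u x = b ∧ SmoothFieldNear u x :=
    ⟨_, FiberBundle.extend_apply_self E4 b, smooth_extend b⟩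
  have h1 := nabla_end g hA hu (hB w hw)
  have h2 := nabla_end g hB hu (hA w hw)
  rw [nabla_end g hB hu hw] at h1
  rw [nabla_end g hA hu hw] at h2
  have h3 : (fun y => A y (B y (w y))) + (fun y => B y (A y (w y))) = (fun _ : M => c) • w :=
    funext fun y => LinearMap.congr_fun (h y) (w y)
  have h4 := nabla_add_right g hu (hA _ (hB w hw)) (hB _ (hA w hw))
  rw [h3, nabla_leibniz g hu (smoothFunNear_const c) hw, dirDeriv_const, h1, h2] at h4
  have h5 := LinearMap.congr_fun (h x) (nabla g u w x)
  simp only [LinearMap.add_apply, Module.End.mul_apply, LinearMap.smul_apply,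
    Module.End.one_apply] at h5
  simp only [LinearMap.add_apply, Module.End.mul_apply, LinearMap.zero_apply]
  simp only [map_add] at h4
  linear_combination (norm := module) -h4 - h5

/-- The covariant derivative of a field of bilinear forms in terms of endomorphisms. -/
theorem nablaBilin_form (hA : SmoothEndNear A x) (hu : SmoothFieldNear u x)
    (hv : SmoothFieldNear v x) (hw : SmoothFieldNear w x) :
    nablaBilin g (fun y => form g (A y)) u v w x = g.inner x (endDer g hA (u x) (v x)) (w x) := by
  simp only [nablaBilin, form_apply]
  rw [nabla_metric g hu (hA v hv) hw, nabla_end g hA hu hv]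
  simp only [map_add, add_apply]
  ring

end CovariantDerivative

/-! ### The covariant derivatives of a triple -/

section TripleDerivative

variable {M : Type*} [TopologicalSpace M] [ChartedSpace E4 M] [IsManifold (𝓡 4) ∞ M]
variable {g : NeutralMetric M} {o : MOrientation M} {x : M}

/-- A form that is both anti-self-dual and a multiple of `η` is zero. -/
theorem ASD.eq_zero_of_mul_eq {η C : Module.End ℝ (Tan x)} (hη : SD g o η) (hηη : η * η = 1)
    (hC : ASD g o C) {c : ℝ} (h : C * η = c • 1) : C = 0 := by
  have h1 : C = c • η := by
    rw [← mul_one C, ← hηη, ← mul_assoc, h, smul_mul_assoc, one_mul]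
  refine hC.eq_zero fun B hB => ?_
  rw [h1, ip_smul_left, hη.ip_asd hB, mul_zero]

/-- The anticommutator of a self-dual form `A` and an arbitrary one with the parts `S` and `C`. -/
theorem SD.anticomm_skew {A S C : Module.End ℝ (Tan x)} (hA : SD g o A) (hS : SD g o S)
    (hC : ASD g o C) :
    (S + C) * A + A * (S + C) = (-ip S A) • 1 + (2 : ℝ) • (C * A) := by
  rw [← hS.anticomm hA, add_mul, mul_add, hA.comm_asd hC]
  module

/-- The relations obtained by differentiating the anticommutators of `ζ, η, θ` force the derivatives
`Z, E, T` of `ζ, η, θ` to be self-dual and determine them up to three coefficients.  That the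
anti-self-dual parts vanish follows from the relations involving `η`, since `η` is invertible. -/
theorem IsTriple.derivative {W : Module.End ℝ (Tan x) →ₗ[ℝ] Module.End ℝ (Tan x)}
    {ζ η θ Z E T : Module.End ℝ (Tan x)} (h : IsTriple g o W ζ η θ)
    (hZ : IsSkew g Z) (hE : IsSkew g E) (hT : IsSkew g T)
    (hζζ : Z * ζ + ζ * Z = 0) (hηη : E * η + η * E = 0) (hθθ : T * θ + θ * T = 0)
    (hζη : (Z * η + η * Z) + (E * ζ + ζ * E) = 0) (hζθ : (Z * θ + θ * Z) + (T * ζ + ζ * T) = 0)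
    (hηθ : (E * θ + θ * E) + (T * η + η * T) = 0) :
    Z = (ip Z θ / 2) • ζ + (-(ip Z η / 2)) • η ∧ E = (ip E θ / 2) • ζ + (-(ip Z η / 2)) • θ ∧
      T = (ip E θ / 2) • η - (ip Z θ / 2) • θ := by
  have cancel : ∀ {c : ℝ}, (-c) • (1 : Module.End ℝ (Tan x)) = 0 → c = 0 := fun h0 =>
    neg_eq_zero.1 ((smul_eq_zero.1 h0).resolve_right one_ne_zero)
  obtain ⟨E', C, hE', hC, rfl⟩ := hE.exists_sd_add_asd o
  obtain rfl : C = 0 := by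
    rw [h.sdη.anticomm_skew hE' hC] at hηη
    refine hC.eq_zero_of_mul_eq h.sdη h.ηη (c := ip E' η / 2) ?_
    linear_combination (norm := module) (1 / 2 : ℝ) • hηη
  rw [add_zero] at *
  obtain ⟨Z', C, hZ', hC, rfl⟩ := hZ.exists_sd_add_asd o
  obtain rfl : C = 0 := by
    rw [h.sdη.anticomm_skew hZ' hC, hE'.anticomm h.sdζ] at hζη
    refine hC.eq_zero_of_mul_eq h.sdη h.ηη (c := (ip Z' η + ip E' ζ) / 2) ?_
    linear_combination (norm := module) (1 / 2 : ℝ) • hζη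
  rw [add_zero] at *
  obtain ⟨T', C, hT', hC, rfl⟩ := hT.exists_sd_add_asd o
  obtain rfl : C = 0 := by
    rw [h.sdη.anticomm_skew hT' hC, hE'.anticomm h.sdθ] at hηθ
    refine hC.eq_zero_of_mul_eq h.sdη h.ηη (c := (ip T' η + ip E' θ) / 2) ?_
    linear_combination (norm := module) (1 / 2 : ℝ) • hηθ
  rw [add_zero] at *
  rw [hZ'.anticomm h.sdζ] at hζζ
  rw [hE'.anticomm h.sdη] at hηη
  rw [hT'.anticomm h.sdθ] at hθθ
  rw [hZ'.anticomm h.sdη, hE'.anticomm h.sdζ, ← add_smul, ← neg_add] at hζη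
  rw [hZ'.anticomm h.sdθ, hT'.anticomm h.sdζ, ← add_smul, ← neg_add] at hζθ
  rw [hE'.anticomm h.sdθ, hT'.anticomm h.sdη, ← add_smul, ← neg_add] at hηθ
  have e1 := cancel hζζ
  have e2 := cancel hηη
  have e3 := cancel hθθ
  have e4 := cancel hζη
  have e5 := cancel hζθ
  have e6 := cancel hηθ
  refine ⟨?_, ?_, ?_⟩
  · conv_lhs => rw [h.decomp hZ', e1]
    module
  · conv_lhs => rw [h.decomp hE', e2, show ip E' ζ = -ip Z' η by linarith]
    module
  · conv_lhs => rw [h.decomp hT', e3, show ip T' ζ = -ip Z' θ by linarith,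
      show ip T' η = -ip E' θ by linarith]
    module

namespace TripleField

variable {k : ℝ} (t : TripleField g o k)

/-- The `1`-form `α` in `∇ζ = 2α ⊗ ζ + 2β ⊗ η`. -/
def α (x : M) : Tan x →L[ℝ] ℝ := LinearMap.toContinuousLinearMap
  { toFun a := ip (endDer g (t.smooth_ζ x) a) (t.θ x) / 4
    map_add' a b := by rw [map_add, ip_add_left, add_div]
    map_smul' c a := by rw [map_smul, ip_smul_left, mul_div_assoc]; rfl }

/-- The `1`-form `β` in `∇ζ = 2α ⊗ ζ + 2β ⊗ η`. -/
def β (x : M) : Tan x →L[ℝ] ℝ := LinearMap.toContinuousLinearMap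
  { toFun a := -ip (endDer g (t.smooth_ζ x) a) (t.η x) / 4
    map_add' a b := by rw [map_add, ip_add_left]; ring
    map_smul' c a := by rw [map_smul, ip_smul_left, RingHom.id_apply, smul_eq_mul]; ring }

/-- The `1`-form `γ` in `∇η = 2γ ⊗ ζ + 2β ⊗ θ`. -/
def γ (x : M) : Tan x →L[ℝ] ℝ := LinearMap.toContinuousLinearMap
  { toFun a := ip (endDer g (t.smooth_η x) a) (t.θ x) / 4
    map_add' a b := by rw [map_add, ip_add_left, add_div]
    map_smul' c a := by rw [map_smul, ip_smul_left, mul_div_assoc]; rfl }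

theorem α_apply (a : Tan x) : t.α x a = ip (endDer g (t.smooth_ζ x) a) (t.θ x) / 4 := rfl

theorem β_apply (a : Tan x) : t.β x a = -ip (endDer g (t.smooth_ζ x) a) (t.η x) / 4 := rfl

theorem γ_apply (a : Tan x) : t.γ x a = ip (endDer g (t.smooth_η x) a) (t.θ x) / 4 := rfl

/-- The formulas for `∇ζ, ∇η, ∇θ`. -/
theorem endDer_eq (a : Tan x) :
    endDer g (t.smooth_ζ x) a = (2 * t.α x a) • t.ζ x + (2 * t.β x a) • t.η x ∧
    endDer g (t.smooth_η x) a = (2 * t.γ x a) • t.ζ x + (2 * t.β x a) • t.θ x ∧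
    endDer g (t.smooth_θ x) a = (2 * t.γ x a) • t.η x - (2 * t.α x a) • t.θ x := by
  have hsq : ∀ {A : EndField M} (hA : SmoothEndNear A x) {c : ℝ}, (∀ y, A y * A y = c • 1) →
      endDer g hA a * A x + A x * endDer g hA a = 0 := by
    intro A hA c h
    have h1 := endDer_anticomm g hA hA (c := 2 * c) (fun y => by rw [h]; module) a
    have h2 : (2 : ℝ) • (endDer g hA a * A x + A x * endDer g hA a) = 0 := by
      rw [← h1]; module
    exact (smul_eq_zero.1 h2).resolve_left two_ne_zero
  obtain ⟨h1, h2, h3⟩ := (t.isTriple x).derivative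
    (endDer_skew g (t.smooth_ζ x) (fun y => (t.isTriple y).sdζ.skew) a)
    (endDer_skew g (t.smooth_η x) (fun y => (t.isTriple y).sdη.skew) a)
    (endDer_skew g (t.smooth_θ x) (fun y => (t.isTriple y).sdθ.skew) a)
    (hsq _ (c := 0) fun y => by rw [(t.isTriple y).ζζ, zero_smul])
    (hsq _ (c := 1) fun y => by rw [(t.isTriple y).ηη, one_smul])
    (hsq _ (c := 0) fun y => by rw [(t.isTriple y).θθ, zero_smul])
    (by
      rw [← endDer_anticomm g (t.smooth_ζ x) (t.smooth_η x)
        (fun y => (t.isTriple y).sdζ.anticomm (t.isTriple y).sdη |>.trans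
          (by rw [(t.isTriple y).ipζη])) a]
      abel)
    (by
      rw [← endDer_anticomm g (t.smooth_ζ x) (t.smooth_θ x)
        (fun y => (t.isTriple y).sdζ.anticomm (t.isTriple y).sdθ |>.trans
          (by rw [(t.isTriple y).ipζθ])) a]
      abel)
    (by
      rw [← endDer_anticomm g (t.smooth_η x) (t.smooth_θ x)
        (fun y => (t.isTriple y).sdη.anticomm (t.isTriple y).sdθ |>.trans
          (by rw [(t.isTriple y).ipηθ])) a]
      abel)
  have e1 : 2 * t.α x a = ip (endDer g (t.smooth_ζ x) a) (t.θ x) / 2 := by rw [α_apply]; ring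
  have e2 : 2 * t.β x a = -(ip (endDer g (t.smooth_ζ x) a) (t.η x) / 2) := by rw [β_apply]; ring
  have e3 : 2 * t.γ x a = ip (endDer g (t.smooth_η x) a) (t.θ x) / 2 := by rw [γ_apply]; ring
  rw [e1, e2, e3]
  exact ⟨h1, h2, h3⟩

variable {u w : VField M}

theorem nabla_ζ (hu : SmoothFieldNear u x) (hw : SmoothFieldNear w x) :
    nabla g u (fun y => t.ζ y (w y)) x = t.ζ x (nabla g u w x)
      + ((2 * t.α x (u x)) • t.ζ x (w x) + (2 * t.β x (u x)) • t.η x (w x)) := by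
  rw [nabla_end g (t.smooth_ζ x) hu hw, (t.endDer_eq (u x)).1]
  rfl

theorem nabla_θ (hu : SmoothFieldNear u x) (hw : SmoothFieldNear w x) :
    nabla g u (fun y => t.θ y (w y)) x = t.θ x (nabla g u w x)
      + ((2 * t.γ x (u x)) • t.η x (w x) - (2 * t.α x (u x)) • t.θ x (w x)) := by
  rw [nabla_end g (t.smooth_θ x) hu hw, (t.endDer_eq (u x)).2.2]
  rfl

theorem smooth_endDer {A : EndField M} (hA : ∀ x, SmoothEndNear A x) (hu : SmoothFieldNear u x) :
    SmoothEndNear (fun y => endDer g (hA y) (u y)) x := by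
  intro w hw
  refine ((hA x).nablaEnd g hu hw).congr ?_
  filter_upwards [hu.eventually, hw.eventually] with y h1 h2 using endDer_apply g (hA y) h1 h2

theorem smooth_α (hu : SmoothFieldNear u x) : SmoothFunNear (fun y => t.α y (u y)) x :=
  (((smooth_endDer t.smooth_ζ hu).ip (t.smooth_θ x)).mul (smoothFunNear_const (1 / 4))).congr
    (Filter.Eventually.of_forall fun y => by rw [α_apply]; ring)

theorem smooth_β (hu : SmoothFieldNear u x) : SmoothFunNear (fun y => t.β y (u y)) x :=
  (((smooth_endDer t.smooth_ζ hu).ip (t.smooth_η x)).mul (smoothFunNear_const (-1 / 4))).congr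
    (Filter.Eventually.of_forall fun y => by rw [β_apply]; ring)

theorem smooth_γ (hu : SmoothFieldNear u x) : SmoothFunNear (fun y => t.γ y (u y)) x :=
  (((smooth_endDer t.smooth_η hu).ip (t.smooth_θ x)).mul (smoothFunNear_const (1 / 4))).congr
    (Filter.Eventually.of_forall fun y => by rw [γ_apply]; ring)

end TripleField

end TripleDerivative

/-! ### The associated system and its uniqueness -/

section Associated

variable {M : Type*} [TopologicalSpace M] [ChartedSpace E4 M] [IsManifold (𝓡 4) ∞ M]
variable {g : NeutralMetric M} {o : MOrientation M} {x : M} {k : ℝ}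

theorem smoothBilin_form {A : EndField M} (hA : ∀ x, SmoothEndNear A x) :
    SmoothBilin (fun x => form g (A x)) := fun _ X _ hU hX hY =>
  smoothFunOn_of_near fun x hx => (hA x X (hX.near hU hx)).inner g (hY.near hU hx)

theorem form_eq_zero_iff {A : Module.End ℝ (Tan x)} {v : Tan x} : form g A v = 0 ↔ A v = 0 := by
  constructor
  · intro h
    exact inner_nondegenerate g fun a => by rw [← form_apply, h]; rfl
  · intro h
    ext a
    simp [h]

theorem formInner_form (A : Module.End ℝ (Tan x)) {B : Module.End ℝ (Tan x)} (hB : IsSkew g B) :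
    formInner g (form g A) (form g B) = ip A B := by
  rw [formInner_eq_ip g _ _ hB, op_form, op_form]

theorem weylOp_form (hk : ∀ (a b c d : Tan x), weyl g x a b c d = g.inner x (weylEnd g k a b c) d)
    {A : Module.End ℝ (Tan x)} (hA : IsSkew g A) (a b : Tan x) :
    weylOp g (form g A) a b = g.inner x (weylMap g k x A a) b := by
  rw [weylOp_eq hk _ hA, op_form, form_apply]

namespace TripleField

variable (t : TripleField g o k)

/-- The system of forms on `M` given by a family of triples. -/
def toFormData : FormData M where
  ζ x := form g (t.ζ x)
  η x := form g (t.η x)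
  θ x := form g (t.θ x)
  α := t.α
  β := t.β
  γ := t.γ

theorem isAssociated (hk : ∀ (x : M) (a b c d : Tan x),
    weyl g x a b c d = g.inner x (weylEnd g k a b c) d) : t.toFormData.IsAssociated g o where
  smooth_ζ := smoothBilin_form t.smooth_ζ
  smooth_η := smoothBilin_form t.smooth_η
  smooth_θ := smoothBilin_form t.smooth_θ
  smooth_α _ _ hU hX := smoothFunOn_of_near fun _ hx => t.smooth_α (hX.near hU hx)
  smooth_β _ _ hU hX := smoothFunOn_of_near fun _ hx => t.smooth_β (hX.near hU hx)
  smooth_γ _ _ hU hX := smoothFunOn_of_near fun _ hx => t.smooth_γ (hX.near hU hx)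
  sd_ζ x := (t.isTriple x).sdζ
  sd_η x := (t.isTriple x).sdη
  sd_θ x := (t.isTriple x).sdθ
  weyl_ζ x a b := (weylOp_form (hk x) (t.isTriple x).sdζ.skew a b).trans <| by
    simp [(t.isTriple x).Wζ]
  weyl_η x a b := (weylOp_form (hk x) (t.isTriple x).sdη.skew a b).trans <| by
    simp [toFormData, (t.isTriple x).Wη]
  weyl_θ x a b := (weylOp_form (hk x) (t.isTriple x).sdθ.skew a b).trans <| by
    simp [toFormData, (t.isTriple x).Wθ]
  inner_ζθ x := (formInner_form _ (t.isTriple x).sdθ.skew).trans (t.isTriple x).ipζθ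
  inner_ηη x := (formInner_form _ (t.isTriple x).sdη.skew).trans (t.isTriple x).ipηη
  inner_ζζ x := (formInner_form _ (t.isTriple x).sdζ.skew).trans (t.isTriple x).ipζζ
  inner_ζη x := (formInner_form _ (t.isTriple x).sdη.skew).trans (t.isTriple x).ipζη
  inner_ηθ x := (formInner_form _ (t.isTriple x).sdθ.skew).trans (t.isTriple x).ipηθ
  inner_θθ x := (formInner_form _ (t.isTriple x).sdθ.skew).trans (t.isTriple x).ipθθ
  eig_ker_ζ x v hv := by
    ext a
    simp [toFormData, (t.isTriple x).eig_ker_ζ (form_eq_zero_iff.1 hv)]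
  eig_ker_θ x v hv := by
    ext a
    simp [toFormData, (t.isTriple x).eig_ker_θ (form_eq_zero_iff.1 hv)]
  nabla_ζ U u w w' hU hu hw hw' x hx := by
    refine (nablaBilin_form g (t.smooth_ζ x) (hu.near hU hx) (hw.near hU hx)
      (hw'.near hU hx)).trans ?_
    rw [(t.endDer_eq _).1]
    simp [toFormData]
  nabla_η U u w w' hU hu hw hw' x hx := by
    refine (nablaBilin_form g (t.smooth_η x) (hu.near hU hx) (hw.near hU hx)
      (hw'.near hU hx)).trans ?_
    rw [(t.endDer_eq _).2.1]
    simp [toFormData]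
  nabla_θ U u w w' hU hu hw hw' x hx := by
    refine (nablaBilin_form g (t.smooth_θ x) (hu.near hU hx) (hw.near hU hx)
      (hw'.near hU hx)).trans ?_
    rw [(t.endDer_eq _).2.2]
    simp [toFormData]

end TripleField

/-- The forms of an associated system constitute a triple at each point. -/
theorem FormData.IsAssociated.isTriple {d : FormData M} (hd : d.IsAssociated g o)
    (hk : ∀ (x : M) (a b c d : Tan x), weyl g x a b c d = g.inner x (weylEnd g k a b c) d) (x : M) :
    IsTriple g o (weylMap g k x) (op g (d.ζ x)) (op g (d.η x)) (op g (d.θ x)) := by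
  have sdζ : SD g o (op g (d.ζ x)) := by rw [SD, form_op]; exact hd.sd_ζ x
  have ipζζ : ip (op g (d.ζ x)) (op g (d.ζ x)) = 0 := by
    rw [← formInner_eq_ip g _ _ (hd.sd_ζ x).1, hd.inner_ζζ]
  have ζζ : op g (d.ζ x) * op g (d.ζ x) = 0 := by rw [sdζ.sq, ipζζ]; simp
  refine ⟨sdζ, by rw [SD, form_op]; exact hd.sd_η x, by rw [SD, form_op]; exact hd.sd_θ x,
    ?_, ?_, ?_, ?_, ?_, ipζζ, ?_, ?_, ?_, ?_⟩
  · refine LinearMap.ext fun a => inner_ext g fun b => ?_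
    have h := weylOp_eq (hk x) _ (hd.sd_ζ x).1 a b
    rw [hd.weyl_ζ] at h
    simpa using h.symm
  · refine LinearMap.ext fun a => inner_ext g fun b => ?_
    have h := weylOp_eq (hk x) _ (hd.sd_η x).1 a b
    rw [hd.weyl_η] at h
    simpa using h.symm
  · refine LinearMap.ext fun a => inner_ext g fun b => ?_
    have h := weylOp_eq (hk x) _ (hd.sd_θ x).1 a b
    rw [hd.weyl_θ] at h
    simpa using h.symm
  · rw [← formInner_eq_ip g _ _ (hd.sd_θ x).1, hd.inner_ζθ]
  · rw [← formInner_eq_ip g _ _ (hd.sd_η x).1, hd.inner_ηη]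
  · rw [← formInner_eq_ip g _ _ (hd.sd_η x).1, hd.inner_ζη]
  · rw [← formInner_eq_ip g _ _ (hd.sd_θ x).1, hd.inner_ηθ]
  · rw [← formInner_eq_ip g _ _ (hd.sd_θ x).1, hd.inner_θθ]
  · refine LinearMap.ext fun v => inner_ext g fun a => ?_
    -- `ζv` lies in the kernel of `ζ`
    have h0 : d.ζ x (op g (d.ζ x) v) = 0 := by
      ext a
      rw [← inner_op g]
      simpa using congrArg (fun z => g.inner x z a) (LinearMap.congr_fun ζζ v)
    have h1 := congrArg (fun φ => φ a) (hd.eig_ker_ζ x _ h0)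
    simpa [Module.End.mul_apply] using h1

/-- Uniqueness of the associated system: the forms are unique at each point, and the `1`-forms are
inner products of the derivatives of `ζ, η` with `η, θ`. -/
theorem TripleField.eq_toFormData (t : TripleField g o k) {d : FormData M}
    (hd : d.IsAssociated g o)
    (hk : ∀ (x : M) (a b c d : Tan x), weyl g x a b c d = g.inner x (weylEnd g k a b c) d) :
    d = t.toFormData := by
  have hu : ∀ x, d.ζ x = t.toFormData.ζ x ∧ d.η x = t.toFormData.η x ∧
      d.θ x = t.toFormData.θ x := by
    intro x
    obtain ⟨h1, h2, h3⟩ := (t.isTriple x).unique (hd.isTriple hk x)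
    refine ⟨?_, ?_, ?_⟩
    · rw [← form_op g (d.ζ x), h1]; rfl
    · rw [← form_op g (d.η x), h2]; rfl
    · rw [← form_op g (d.θ x), h3]; rfl
  have eζ : d.ζ = t.toFormData.ζ := funext fun x => (hu x).1
  have eη : d.η = t.toFormData.η := funext fun x => (hu x).2.1
  have eθ : d.θ = t.toFormData.θ := funext fun x => (hu x).2.2
  have hder : ∀ (x : M) (a : Tan x),
      endDer g (t.smooth_ζ x) a = (2 * d.α x a) • t.ζ x + (2 * d.β x a) • t.η x ∧
      endDer g (t.smooth_η x) a = (2 * d.γ x a) • t.ζ x + (2 * d.β x a) • t.θ x := by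
    intro x a
    constructor <;> refine LinearMap.ext fun b => inner_ext g fun c => ?_
    all_goals
      obtain ⟨u, rfl, hu⟩ : ∃ u : VField M, u x = a ∧ SmoothFieldNear u x :=
        ⟨_, FiberBundle.extend_apply_self E4 a, smooth_extend a⟩
      obtain ⟨v, rfl, hv⟩ : ∃ u : VField M, u x = b ∧ SmoothFieldNear u x :=
        ⟨_, FiberBundle.extend_apply_self E4 b, smooth_extend b⟩
      obtain ⟨w, rfl, hw⟩ : ∃ u : VField M, u x = c ∧ SmoothFieldNear u x :=
        ⟨_, FiberBundle.extend_apply_self E4 c, smooth_extend c⟩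
      obtain ⟨U₁, ho₁, hx₁, h₁⟩ := hu.exists_open
      obtain ⟨U₂, ho₂, hx₂, h₂⟩ := hv.exists_open
      obtain ⟨U₃, ho₃, hx₃, h₃⟩ := hw.exists_open
      have hsub₁ : U₁ ∩ (U₂ ∩ U₃) ⊆ U₁ := fun y hy => hy.1
      have hsub₂ : U₁ ∩ (U₂ ∩ U₃) ⊆ U₂ := fun y hy => hy.2.1
      have hsub₃ : U₁ ∩ (U₂ ∩ U₃) ⊆ U₃ := fun y hy => hy.2.2
    · have h := hd.nabla_ζ _ u v w (ho₁.inter (ho₂.inter ho₃)) (h₁.mono hsub₁) (h₂.mono hsub₂)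
        (h₃.mono hsub₃) x ⟨hx₁, hx₂, hx₃⟩
      rw [eζ, eη] at h
      have h' := (nablaBilin_form g (t.smooth_ζ x) hu hv hw).symm.trans h
      simpa [toFormData] using h'
    · have h := hd.nabla_η _ u v w (ho₁.inter (ho₂.inter ho₃)) (h₁.mono hsub₁) (h₂.mono hsub₂)
        (h₃.mono hsub₃) x ⟨hx₁, hx₂, hx₃⟩
      rw [eζ, eη, eθ] at h
      have h' := (nablaBilin_form g (t.smooth_η x) hu hv hw).symm.trans h
      simpa [toFormData] using h'
  have eα : d.α = t.α := by
    ext x a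
    have h := t.isTriple x
    rw [t.α_apply, (hder x a).1, ip_add_left, ip_smul_left, ip_smul_left, h.ipζθ, h.ipηθ]
    ring
  have eβ : d.β = t.β := by
    ext x a
    have h := t.isTriple x
    rw [t.β_apply, (hder x a).1, ip_add_left, ip_smul_left, ip_smul_left, h.ipζη, h.ipηη]
    ring
  have eγ : d.γ = t.γ := by
    ext x a
    have h := t.isTriple x
    rw [t.γ_apply, (hder x a).2, ip_add_left, ip_smul_left, ip_smul_left, h.ipζθ, h.ipθθ]
    ring
  cases d
  simp only at eζ eη eθ eα eβ eγ
  subst eζ eη eθ eα eβ eγ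
  rfl

end Associated

/-! ### The Bianchi identity and the kernel of `ζ` -/

section Kernel

variable {M : Type*} [TopologicalSpace M] [ChartedSpace E4 M] [IsManifold (𝓡 4) ∞ M]
variable {g : NeutralMetric M} {o : MOrientation M} {x : M} {k : ℝ}

namespace IsTriple

variable {W : Module.End ℝ (Tan x) →ₗ[ℝ] Module.End ℝ (Tan x)} {ζ η θ : Module.End ℝ (Tan x)}
  (h : IsTriple g o W ζ η θ)
include h

theorem inner_ζ (a b : Tan x) : g.inner x (ζ a) b = -g.inner x a (ζ b) :=
  (isSkew_iff g _).1 h.sdζ.skew a b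

theorem inner_ker {a b : Tan x} (ha : ζ a = 0) (hb : ζ b = 0) : g.inner x a b = 0 := by
  rw [← h.mem_range_of_ker ha, h.inner_ζ, hb, map_zero, neg_zero]

theorem mem_ker_iff {w : Tan x} : (∀ v, ζ v = 0 → g.inner x v w = 0) ↔ ζ w = 0 := by
  refine ⟨fun h0 => inner_nondegenerate g fun a => ?_, fun hw v hv => h.inner_ker hv hw⟩
  rw [h.inner_ζ, g.symm, h0 _ (h.ζζ_apply a), neg_zero]

theorem finrank_ker : Module.finrank ℝ (LinearMap.ker ζ) = 2 := by
  have h1 : LinearMap.range ζ = LinearMap.ker ζ := by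
    ext v
    constructor
    · rintro ⟨a, rfl⟩
      exact h.ζζ_apply a
    · intro hv
      exact ⟨_, h.mem_range_of_ker hv⟩
  have h2 := LinearMap.finrank_range_add_finrank_ker ζ
  rw [h1, finrank_tan] at h2
  omega

theorem exists_inner_ne_zero : ∃ a b : Tan x, g.inner x (ζ a) b ≠ 0 := by
  by_contra! h0
  exact h.ζ_ne_zero (LinearMap.ext fun a => inner_nondegenerate g (h0 a))

theorem inner_η_ker {v : Tan x} (hv : ζ v = 0) (w : Tan x) :
    g.inner x (η v) w = g.inner x v w := by rw [h.eig_ker_ζ hv]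

theorem inner_η_ker' {v : Tan x} (hv : ζ v = 0) (w : Tan x) :
    g.inner x (η w) v = -g.inner x v w := by
  rw [(isSkew_iff g _).1 h.sdη.skew, h.eig_ker_ζ hv, g.symm]

end IsTriple

namespace TripleField

variable (t : TripleField g o k) (hW : ∀ x, IsTypeIII g o (weylMap g k x))
variable {u v w w' X Y Z : VField M}

include hW

/-- The curvature tensor in terms of the triple. -/
theorem curv_eq_triple (a b c : Tan x) : curv g x a b c =
    k • (g.inner x a c • b - g.inner x b c • a) + ((g.inner x (t.ζ x a) b / 2) • t.η x c
      + (g.inner x (t.η x a) b / 2) • t.ζ x c) := by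
  have h := LinearMap.congr_fun ((t.isTriple x).weylEnd_eq (hW x) a b) c
  rw [weylEnd_apply] at h
  simp only [LinearMap.add_apply, LinearMap.smul_apply] at h
  rw [← h]
  abel

/-- The covariant derivative of the curvature tensor. -/
theorem nabla_curvField (hX : SmoothFieldNear X x) (hY : SmoothFieldNear Y x)
    (hZ : SmoothFieldNear Z x) (hw : SmoothFieldNear w x) :
    nabla g X (curvField g Y Z w) x = curv g x (nabla g X Y x) (Z x) (w x)
      + curv g x (Y x) (nabla g X Z x) (w x) + curv g x (Y x) (Z x) (nabla g X w x)
      + ((g.inner x (endDer g (t.smooth_ζ x) (X x) (Y x)) (Z x) / 2) • t.η x (w x)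
        + (g.inner x (t.ζ x (Y x)) (Z x) / 2) • endDer g (t.smooth_η x) (X x) (w x)
        + (g.inner x (endDer g (t.smooth_η x) (X x) (Y x)) (Z x) / 2) • t.ζ x (w x)
        + (g.inner x (t.η x (Y x)) (Z x) / 2) • endDer g (t.smooth_ζ x) (X x) (w x)) := by
  have hζY := t.smooth_ζ x Y hY
  have hηY := t.smooth_η x Y hY
  have hζw := t.smooth_ζ x w hw
  have hηw := t.smooth_η x w hw
  have hhalf : SmoothFunNear (fun _ : M => (1 / 2 : ℝ)) x := smoothFunNear_const _
  have hk : SmoothFunNear (fun _ : M => k) x := smoothFunNear_const _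
  have f₁ := hk.mul (hY.inner g hw)
  have f₂ := hk.mul (hZ.inner g hw)
  have f₃ := hhalf.mul (hζY.inner g hZ)
  have f₄ := hhalf.mul (hηY.inner g hZ)
  have hR : ∀ᶠ y in 𝓝 x, curvField g Y Z w y =
      (((fun y => k * g.inner y (Y y) (w y)) • Z - (fun y => k * g.inner y (Z y) (w y)) • Y)
      + ((fun y => 1 / 2 * g.inner y (t.ζ y (Y y)) (Z y)) • (fun y => t.η y (w y))
        + (fun y => 1 / 2 * g.inner y (t.η y (Y y)) (Z y)) • (fun y => t.ζ y (w y)))) y := by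
    filter_upwards [hY.eventually, hZ.eventually, hw.eventually] with y h1 h2 h3
    rw [← curv_eq g h1 h2 h3, t.curv_eq_triple hW]
    simp only [Pi.add_apply, Pi.sub_apply, Pi.smul_apply']
    module
  rw [nabla_congr_right g hR, nabla_add_right g hX ((f₁.smul hZ).sub (f₂.smul hY))
      ((f₃.smul hηw).add (f₄.smul hζw)),
    nabla_sub_right g hX (f₁.smul hZ) (f₂.smul hY),
    nabla_add_right g hX (f₃.smul hηw) (f₄.smul hζw),
    nabla_leibniz g hX f₁ hZ, nabla_leibniz g hX f₂ hY, nabla_leibniz g hX f₃ hηw,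
    nabla_leibniz g hX f₄ hζw,
    dirDeriv_const_mul _ (hY.inner g hw), dirDeriv_const_mul _ (hZ.inner g hw),
    dirDeriv_const_mul _ (hζY.inner g hZ), dirDeriv_const_mul _ (hηY.inner g hZ),
    nabla_metric g hX hY hw, nabla_metric g hX hZ hw, nabla_metric g hX hζY hZ,
    nabla_metric g hX hηY hZ, nabla_end g (t.smooth_ζ x) hX hY, nabla_end g (t.smooth_η x) hX hY,
    nabla_end g (t.smooth_ζ x) hX hw, nabla_end g (t.smooth_η x) hX hw]
  simp only [t.curv_eq_triple hW, map_add, add_apply]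
  module

/-- The second Bianchi identity in terms of the triple: `β ∧ ζ = 0` and `α ∧ ζ + 2β ∧ η = 0`. -/
theorem bianchi (a b c : Tan x) :
    (t.β x a * g.inner x (t.ζ x b) c + t.β x b * g.inner x (t.ζ x c) a
      + t.β x c * g.inner x (t.ζ x a) b = 0) ∧
    (t.α x a * g.inner x (t.ζ x b) c + t.α x b * g.inner x (t.ζ x c) a
      + t.α x c * g.inner x (t.ζ x a) b + 2 * (t.β x a * g.inner x (t.η x b) c
      + t.β x b * g.inner x (t.η x c) a + t.β x c * g.inner x (t.η x a) b) = 0) := by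
  obtain ⟨X, rfl, hX⟩ : ∃ u : VField M, u x = a ∧ SmoothFieldNear u x :=
    ⟨_, FiberBundle.extend_apply_self E4 a, smooth_extend a⟩
  obtain ⟨Y, rfl, hY⟩ : ∃ u : VField M, u x = b ∧ SmoothFieldNear u x :=
    ⟨_, FiberBundle.extend_apply_self E4 b, smooth_extend b⟩
  obtain ⟨Z, rfl, hZ⟩ : ∃ u : VField M, u x = c ∧ SmoothFieldNear u x :=
    ⟨_, FiberBundle.extend_apply_self E4 c, smooth_extend c⟩
  obtain ⟨P, hP⟩ : ∃ P : ℝ, P • t.ζ x +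
      (t.α x (X x) * g.inner x (t.ζ x (Y x)) (Z x) + t.α x (Y x) * g.inner x (t.ζ x (Z x)) (X x)
      + t.α x (Z x) * g.inner x (t.ζ x (X x)) (Y x)
      + 2 * (t.β x (X x) * g.inner x (t.η x (Y x)) (Z x)
      + t.β x (Y x) * g.inner x (t.η x (Z x)) (X x)
      + t.β x (Z x) * g.inner x (t.η x (X x)) (Y x))) • t.η x +
      (t.β x (X x) * g.inner x (t.ζ x (Y x)) (Z x) + t.β x (Y x) * g.inner x (t.ζ x (Z x)) (X x)
      + t.β x (Z x) * g.inner x (t.ζ x (X x)) (Y x)) • t.θ x = 0 := by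
    refine ⟨2 * (t.γ x (X x) * g.inner x (t.ζ x (Y x)) (Z x)
      + t.γ x (Y x) * g.inner x (t.ζ x (Z x)) (X x) + t.γ x (Z x) * g.inner x (t.ζ x (X x)) (Y x))
      + (t.β x (X x) * g.inner x (t.θ x (Y x)) (Z x) + t.β x (Y x) * g.inner x (t.θ x (Z x)) (X x)
      + t.β x (Z x) * g.inner x (t.θ x (X x)) (Y x))
      + (t.α x (X x) * g.inner x (t.η x (Y x)) (Z x) + t.α x (Y x) * g.inner x (t.η x (Z x)) (X x)
      + t.α x (Z x) * g.inner x (t.η x (X x)) (Y x)), ?_⟩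
    ext1 d
    obtain ⟨w, rfl, hw⟩ : ∃ u : VField M, u x = d ∧ SmoothFieldNear u x :=
      ⟨_, FiberBundle.extend_apply_self E4 d, smooth_extend d⟩
    have h := second_bianchi g hX hY hZ hw
    have key : ∀ {X Y Z : VField M}, SmoothFieldNear X x → SmoothFieldNear Y x →
        SmoothFieldNear Z x → nabla g X (curvField g Y Z w) x - curvField g Y Z (nabla g X w) x
          - curvField g (bracket X Y) Z w x =
        curv g x (nabla g Y X x) (Z x) (w x) - curv g x (nabla g X Z x) (Y x) (w x)
        + ((g.inner x (endDer g (t.smooth_ζ x) (X x) (Y x)) (Z x) / 2) • t.η x (w x)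
        + (g.inner x (t.ζ x (Y x)) (Z x) / 2) • endDer g (t.smooth_η x) (X x) (w x)
        + (g.inner x (endDer g (t.smooth_η x) (X x) (Y x)) (Z x) / 2) • t.ζ x (w x)
        + (g.inner x (t.η x (Y x)) (Z x) / 2) • endDer g (t.smooth_ζ x) (X x) (w x)) := by
      intro X Y Z hX hY hZ
      have h1 : curv g x (nabla g X Y x) (Z x) (w x) =
          curv g x (bracket X Y x) (Z x) (w x) + curv g x (nabla g Y X x) (Z x) (w x) := by
        rw [← curv_add_left, ← nabla_torsionfree g hX hY, sub_add_cancel]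
      rw [t.nabla_curvField hW hX hY hZ hw, ← curv_eq g hY hZ (hX.nabla g hw),
        ← curv_eq g (hX.bracket hY) hZ hw, h1, curv_swap g (nabla g X Z x)]
      abel
    rw [key hX hY hZ, key hY hZ hX, key hZ hX hY] at h
    simp only [(t.endDer_eq _).1, (t.endDer_eq _).2.1, LinearMap.add_apply, LinearMap.smul_apply,
      map_add, map_smul, add_apply, smul_apply, smul_eq_mul] at h
    simp only [LinearMap.add_apply, LinearMap.smul_apply, LinearMap.zero_apply]
    linear_combination (norm := module) h
  have ht := t.isTriple x
  have e1 := congrArg (ip (t.ζ x)) hP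
  have e2 := congrArg (ip (t.η x)) hP
  simp only [ip_add_right, ip_smul_right, ht.ipζζ, ht.ipζη, ht.ipζθ] at e1
  simp only [ip_add_right, ip_smul_right, ip_comm (t.η x) (t.ζ x), ht.ipζη, ht.ipηη, ht.ipηθ] at e2
  have hz : ∀ A : Module.End ℝ (Tan x), ip A 0 = 0 := fun A => by
    simpa using ip_smul_right 0 0 A
  rw [hz] at e1 e2
  constructor <;> linarith

/-- As `β ∧ ζ = 0`, the form `β` vanishes on the kernel of `ζ`. -/
theorem β_ker {a : Tan x} (ha : t.ζ x a = 0) : t.β x a = 0 := by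
  have ht := t.isTriple x
  obtain ⟨b, c, hbc⟩ := ht.exists_inner_ne_zero
  have h := (t.bianchi hW a b c).1
  rw [ht.inner_ζ c a, ha] at h
  simp only [map_zero, zero_apply, neg_zero, mul_zero, add_zero] at h
  exact (mul_eq_zero.1 h).resolve_right hbc

/-- The contraction of `α ∧ ζ + 2β ∧ η = 0` with a vector in the kernel of `ζ`. -/
theorem α_ker {a : Tan x} (ha : t.ζ x a = 0) (b c : Tan x) :
    t.α x a * g.inner x (t.ζ x b) c = 2 * (t.β x b * g.inner x a c - t.β x c * g.inner x a b) := by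
  have ht := t.isTriple x
  have h := (t.bianchi hW a b c).2
  rw [ht.inner_ζ c a, ha, t.β_ker hW ha, ht.inner_η_ker' ha, ht.inner_η_ker ha] at h
  simp only [map_zero, zero_apply, neg_zero, mul_zero, add_zero, zero_mul] at h
  linarith

theorem α_ζ (a : Tan x) : t.α x (t.ζ x a) = 2 * t.β x a := by
  have ht := t.isTriple x
  by_cases ha : t.ζ x a = 0
  · rw [ha, map_zero, t.β_ker hW ha, mul_zero]
  · obtain ⟨c, hc⟩ : ∃ c, g.inner x (t.ζ x a) c ≠ 0 := by
      by_contra! h0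
      exact ha (inner_nondegenerate g h0)
    have h := t.α_ker hW (ht.ζζ_apply a) a c
    rw [ht.inner_ζ a a, g.symm x a] at h
    have h0 : g.inner x (t.ζ x a) a = 0 := by
      have := ht.inner_ζ a a
      rw [g.symm x a] at this
      linarith
    rw [h0] at h
    exact mul_right_cancel₀ hc (by linarith)

omit hW in
/-- The derivative of a section of the kernel of `ζ`. -/
theorem ζ_nabla_ker (hw : SmoothFieldNear w x) (hv : SmoothFieldNear v x)
    (hv0 : ∀ᶠ y in 𝓝 x, t.ζ y (v y) = 0) :
    t.ζ x (nabla g w v x) = (-2 * t.β x (w x)) • v x := by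
  have h1 := t.nabla_ζ hw hv
  have h2 : nabla g w (fun y => t.ζ y (v y)) x = 0 := by
    rw [nabla_congr_right g (X' := (fun _ : M => (0 : ℝ)) • v) (hv0.mono fun y hy => by simp [hy]),
      nabla_leibniz g hw (smoothFunNear_const 0) hv, dirDeriv_const]
    simp
  rw [h2, hv0.self_of_nhds, (t.isTriple x).eig_ker_ζ hv0.self_of_nhds] at h1
  linear_combination (norm := module) -h1

theorem ζ_nabla_ker_ker (hu : SmoothFieldNear u x) (hu0 : ∀ᶠ y in 𝓝 x, t.ζ y (u y) = 0)
    (hv : SmoothFieldNear v x) (hv0 : ∀ᶠ y in 𝓝 x, t.ζ y (v y) = 0) :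
    t.ζ x (nabla g u v x) = 0 := by
  rw [t.ζ_nabla_ker hu hv hv0, t.β_ker hW hu0.self_of_nhds]
  simp

/-- The connection is flat along the kernel of `ζ`. -/
theorem curv_ker {a b c : Tan x} (ha : t.ζ x a = 0) (hb : t.ζ x b = 0) (hc : t.ζ x c = 0) :
    curv g x a b c = 0 := by
  have ht := t.isTriple x
  rw [t.curv_eq_triple hW, ht.inner_ker ha hc, ht.inner_ker hb hc, ha, hc, ht.inner_η_ker ha,
    ht.inner_ker ha hb]
  simp

/-- The derivative of `β(w)` in the direction of the kernel of `ζ`, obtained from the curvature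
tensor. -/
theorem dirDeriv_β (hu : SmoothFieldNear u x) (hu0 : ∀ᶠ y in 𝓝 x, t.ζ y (u y) = 0)
    (hw : SmoothFieldNear w x) : dirDeriv (fun y => t.β y (w y)) x (u x) =
      2 * t.α x (u x) * t.β x (w x) + t.β x (bracket u w x) := by
  have ht := t.isTriple x
  obtain ⟨a, b, hab⟩ := ht.exists_inner_ne_zero
  -- an auxiliary section `v` of the kernel of `ζ` with `v(x) ≠ 0`
  obtain ⟨v, hv, hv0, hvx⟩ : ∃ v : VField M, SmoothFieldNear v x ∧
      (∀ᶠ y in 𝓝 x, t.ζ y (v y) = 0) ∧ v x ≠ 0 := by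
    refine ⟨_, t.smooth_ζ x _ (smooth_extend a),
      Filter.Eventually.of_forall fun y => (t.isTriple y).ζζ_apply _, fun h0 => hab ?_⟩
    simp only [FiberBundle.extend_apply_self] at h0
    rw [h0, map_zero, zero_apply]
  have huv := hu.nabla g hv
  have huv0 : ∀ᶠ y in 𝓝 x, t.ζ y (nabla g u v y) = 0 := by
    filter_upwards [hu.eventually, hu0.eventually_nhds, hv.eventually, hv0.eventually_nhds]
      with y h1 h2 h3 h4 using t.ζ_nabla_ker_ker hW h1 h2 h3 h4
  have hβw := (smoothFunNear_const (-2)).mul (t.smooth_β hw)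
  have h1 := t.ζ_nabla_ker hw huv huv0
  have h2 := t.ζ_nabla_ker (hu.bracket hw) hv hv0
  have h3 := t.nabla_ζ hu (hw.nabla g hv)
  have h4 : ∀ᶠ y in 𝓝 x, t.ζ y (nabla g w v y) = ((fun y => -2 * t.β y (w y)) • v) y := by
    filter_upwards [hw.eventually, hv.eventually, hv0.eventually_nhds] with y h5 h6 h7
      using t.ζ_nabla_ker h5 h6 h7
  rw [nabla_congr_right g h4, nabla_leibniz g hu hβw hv, dirDeriv_const_mul _ (t.smooth_β hw),
    t.ζ_nabla_ker hw hv hv0, t.β_ker hW hu0.self_of_nhds] at h3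
  have h5 : t.ζ x (curvField g u w v x) = 0 := by
    rw [← curv_eq g hu hw hv, t.curv_eq_triple hW, hv0.self_of_nhds,
      ht.inner_ker hu0.self_of_nhds hv0.self_of_nhds, ht.inner_ζ, ht.eig_ker_ζ hv0.self_of_nhds]
    simp [hu0.self_of_nhds, hv0.self_of_nhds]
  rw [curvField, map_add, map_sub, h1, h2] at h5
  have h6 : (dirDeriv (fun y => t.β y (w y)) x (u x) -
      (2 * t.α x (u x) * t.β x (w x) + t.β x (bracket u w x))) • v x = 0 := by
    linear_combination (norm := module) (1 / 2 : ℝ) • h5 - (1 / 2 : ℝ) • h3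
  exact sub_eq_zero.1 ((smul_eq_zero.1 h6).resolve_right hvx)

end TripleField

end Kernel

/-! ### The basic octuple -/

section Octuple

variable {M : Type*} [TopologicalSpace M] [ChartedSpace E4 M] [IsManifold (𝓡 4) ∞ M]
variable {g : NeutralMetric M} {o : MOrientation M} {x : M} {k : ℝ}

theorem IsSectionOn.near {V : Plane M} {U : Set M} {v : VField M} (hv : IsSectionOn V U v)
    (hU : IsOpen U) (hx : x ∈ U) : SmoothFieldNear v x := hv.1.near hU hx

namespace TripleField

variable (t : TripleField g o k) (hW : ∀ x, IsTypeIII g o (weylMap g k x))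
variable {u v w w' X Y Z : VField M} {U : Set M}

/-- The distribution `Ker ζ`. -/
abbrev V : Plane M := kerField (fun x => form g (t.ζ x))

theorem mem_V {a : Tan x} : a ∈ t.V x ↔ t.ζ x a = 0 := form_eq_zero_iff

theorem ζ_section (hv : IsSectionOn t.V U v) (hU : IsOpen U) (hx : x ∈ U) :
    ∀ᶠ y in 𝓝 x, t.ζ y (v y) = 0 :=
  Filter.eventually_of_mem (hU.mem_nhds hx) fun y hy => t.mem_V.1 (hv.2 y hy)

theorem isTwoDistribution_V : IsTwoDistribution t.V := by
  intro x₀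
  obtain ⟨a, b, hab⟩ := (t.isTriple x₀).exists_inner_ne_zero
  obtain ⟨A, hA, hAx⟩ : ∃ u : VField M, SmoothFieldNear u x₀ ∧ u x₀ = a :=
    ⟨_, smooth_extend a, FiberBundle.extend_apply_self E4 a⟩
  obtain ⟨B, hB, hBx⟩ : ∃ u : VField M, SmoothFieldNear u x₀ ∧ u x₀ = b :=
    ⟨_, smooth_extend b, FiberBundle.extend_apply_self E4 b⟩
  have hζA := t.smooth_ζ x₀ A hA
  have hζB := t.smooth_ζ x₀ B hB
  have h0 := ((hζA.inner g hB).continuousAt).eventually_ne (by rwa [hAx, hBx])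
  obtain ⟨U, hU, hUo, hx⟩ := eventually_nhds_iff.1 (h0.and (hζA.and hζB))
  refine ⟨U, _, _, hUo, hx, fun y hy => (hU y hy).2.1.contMDiffWithinAt,
    fun y hy => (hU y hy).2.2.contMDiffWithinAt, fun y hy => ?_⟩
  have ht := t.isTriple y
  have hy0 := (hU y hy).1
  have hskew : ∀ c, g.inner y (t.ζ y c) c = 0 := fun c => by
    have := ht.inner_ζ c c
    rw [g.symm y c] at this
    linarith
  have hli : LinearIndependent ℝ ![t.ζ y (A y), t.ζ y (B y)] := by
    rw [LinearIndependent.pair_iff]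
    intro p q hpq
    have h1 := congrArg (fun z => g.inner y z (B y)) hpq
    have h2 := congrArg (fun z => g.inner y z (A y)) hpq
    simp only [map_add, map_smul, add_apply, smul_apply, hskew, smul_eq_mul, mul_zero, add_zero,
      zero_add, map_zero, zero_apply] at h1 h2
    rw [ht.inner_ζ, g.symm] at h2
    exact ⟨(mul_eq_zero.1 h1).resolve_right hy0,
      (mul_eq_zero.1 h2).resolve_right (neg_ne_zero.2 hy0)⟩
  refine ⟨hli, ?_⟩
  have hV : t.V y = LinearMap.ker (t.ζ y) := by
    ext c
    rw [t.mem_V, LinearMap.mem_ker]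
  rw [hV]
  symm
  refine Submodule.eq_of_le_of_finrank_eq ?_ ?_
  · rw [Submodule.span_le]
    rintro _ (rfl | rfl)
    · exact ht.ζζ_apply _
    · exact ht.ζζ_apply _
  · have h := finrank_span_eq_card hli
    rw [Matrix.range_cons_cons_empty] at h
    rw [ht.finrank_ker, h, Fintype.card_fin]

theorem isPartialMetric : IsPartialMetric t.V (restrictLeft g.inner t.V) where
  smooth _ _ _ hU hv hw := smoothFunOn_of_near fun _ hx =>
    (hv.near hU hx).inner g (hw.near hU hx)
  kernel x w := by
    rw [t.mem_V, ← (t.isTriple x).mem_ker_iff]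
    exact ⟨fun h v hv => h ⟨v, t.mem_V.2 hv⟩, fun h v => h v (t.mem_V.1 v.2)⟩

include hW

theorem nabla_mem_V (hU : IsOpen U) (hu : IsSectionOn t.V U u) (hv : IsSectionOn t.V U v)
    (hx : x ∈ U) : nabla g u v x ∈ t.V x :=
  t.mem_V.2 <| t.ζ_nabla_ker_ker hW (hu.near hU hx) (t.ζ_section hu hU hx) (hv.near hU hx)
    (t.ζ_section hv hU hx)

theorem isAffineFoliation : IsAffineFoliation t.V (nabla g) where
  distribution := t.isTwoDistribution_V
  integrable U u v hU hu hv x hx := by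
    rw [← nabla_torsionfree g (hu.near hU hx) (hv.near hU hx)]
    exact Submodule.sub_mem _ (t.nabla_mem_V hW hU hu hv hx) (t.nabla_mem_V hW hU hv hu hx)
  isSection U u v hU hu hv :=
    ⟨smoothFieldOn_of_near fun x hx => (hu.near hU hx).nabla g (hv.near hU hx),
      fun x hx => t.nabla_mem_V hW hU hu hv hx⟩
  congr U u v u' v' hU _ _ huu' hvv' x hx :=
    nabla_congr g (Filter.eventually_of_mem (hU.mem_nhds hx) hvv')
      (Filter.eventually_of_mem (hU.mem_nhds hx) huu')
  add_left U u u' v hU hu hu' hv x hx :=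
    nabla_add_left g (hu.near hU hx) (hu'.near hU hx) (hv.near hU hx)
  smul_left U f u v hU hf hu hv x hx :=
    nabla_smul_left g (hf.near hU hx) (hu.near hU hx) (hv.near hU hx)
  add_right U u v v' hU hu hv hv' x hx :=
    nabla_add_right g (hu.near hU hx) (hv.near hU hx) (hv'.near hU hx)
  leibniz U f u v hU hf hu hv x hx :=
    nabla_leibniz g (hu.near hU hx) (hf.near hU hx) (hv.near hU hx)
  torsionfree U u v hU hu hv x hx := nabla_torsionfree g (hu.near hU hx) (hv.near hU hx)
  flat U u v w hU hu hv hw x hx := by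
    have h := curv_eq g (hu.near hU hx) (hv.near hU hx) (hw.near hU hx)
    rw [t.curv_ker hW (t.mem_V.1 (hu.2 x hx)) (t.mem_V.1 (hv.2 x hx)) (t.mem_V.1 (hw.2 x hx))] at h
    exact h.symm

omit hW in
theorem bracket_mem_V (hu : IsSectionOn t.V U u) (hw : IsProjectableOn t.V U w) (hx : x ∈ U) :
    t.ζ x (bracket u w x) = 0 := by
  rw [bracket_swap, map_neg, t.mem_V.1 ((hw.2 u hu).2 x hx), neg_zero]

/-- The effect of `ζ` on the derivative of a projectable field along `Ker ζ`. -/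
theorem ζ_nabla_projectable (hU : IsOpen U) (hu : IsSectionOn t.V U u)
    (hw : IsProjectableOn t.V U w) (hx : x ∈ U) :
    t.ζ x (nabla g u w x) = (-2 * t.β x (w x)) • u x := by
  have h := nabla_torsionfree g (hu.near hU hx) (hw.1.near hU hx)
  rw [sub_eq_iff_eq_add.1 h, map_add, t.bracket_mem_V hu hw hx, zero_add,
    t.ζ_nabla_ker (hw.1.near hU hx) (hu.near hU hx) (t.ζ_section hu hU hx)]

theorem d_h (hU : IsOpen U) (hu : IsSectionOn t.V U u) (hv : IsParallelOn t.V (nabla g) U v)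
    (hw : IsProjectableOn t.V U w) (hx : x ∈ U) :
    dirDeriv (fun y => g.inner y (v y) (w y)) x (u x) =
      t.β x (w x) * g.inner x (t.θ x (u x)) (v x) := by
  have ht := t.isTriple x
  have hv0 := t.mem_V.1 (hv.1.2 x hx)
  rw [nabla_metric g (hu.near hU hx) (hv.1.near hU hx) (hw.1.near hU hx), hv.2 u hu x hx]
  conv_lhs => rw [← ht.mem_range_of_ker hv0]
  rw [ht.inner_ζ, t.ζ_nabla_projectable hW hU hu hw hx, (isSkew_iff g _).1 ht.sdθ.skew,
    g.symm x (u x)]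
  simp only [map_zero, zero_apply, map_smul, smul_apply, smul_eq_mul]
  ring

theorem d_ζ (hU : IsOpen U) (hu : IsSectionOn t.V U u) (hw : IsProjectableOn t.V U w)
    (hw' : IsProjectableOn t.V U w') (hx : x ∈ U) :
    dirDeriv (fun y => g.inner y (t.ζ y (w y)) (w' y)) x (u x) =
      t.α x (u x) * g.inner x (t.ζ x (w x)) (w' x) := by
  have ht := t.isTriple x
  have hu0 := t.mem_V.1 (hu.2 x hx)
  have hsw := hw.1.near hU hx
  rw [nabla_metric g (hu.near hU hx) (t.smooth_ζ x w hsw) (hw'.1.near hU hx),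
    t.nabla_ζ (hu.near hU hx) hsw, t.ζ_nabla_projectable hW hU hu hw hx, t.β_ker hW hu0,
    ht.inner_ζ (w x) (nabla g u w' x), t.ζ_nabla_projectable hW hU hu hw' hx]
  have h := t.α_ker hW hu0 (w x) (w' x)
  simp only [map_add, map_smul, add_apply, smul_apply, smul_eq_mul, g.symm x (w x)]
  linarith

theorem d_β (hU : IsOpen U) (hu : IsSectionOn t.V U u) (hw : IsProjectableOn t.V U w)
    (hx : x ∈ U) : dirDeriv (fun y => t.β y (w y)) x (u x) =
      2 * t.α x (u x) * t.β x (w x) := by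
  rw [t.dirDeriv_β hW (hu.near hU hx) (t.ζ_section hu hU hx) (hw.1.near hU hx),
    t.β_ker hW (t.bracket_mem_V hu hw hx), add_zero]

theorem d_α (hU : IsOpen U) (hu : IsSectionOn t.V U u) (hv : IsParallelOn t.V (nabla g) U v)
    (hx : x ∈ U) : dirDeriv (fun y => t.α y (v y)) x (u x) = t.α x (u x) * t.α x (v x) := by
  have ht := t.isTriple x
  have hsu := hu.near hU hx
  have hsv := hv.1.near hU hx
  -- a field `w` with `ζw = v`, so that `α(v) = 2β(w)`
  obtain ⟨w, hw, hζw⟩ : ∃ w : VField M, SmoothFieldNear w x ∧ ∀ᶠ y in 𝓝 x, t.ζ y (w y) = v y :=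
    ⟨_, (smoothFunNear_const (-(1 / 2))).smul (t.smooth_θ x v hsv),
      (t.ζ_section hv.1 hU hx).mono fun y hy => (t.isTriple y).mem_range_of_ker hy⟩
  have h1 : ∀ᶠ y in 𝓝 x, t.α y (v y) = 2 * t.β y (w y) :=
    hζw.mono fun y hy => by rw [← hy, t.α_ζ hW]
  have h2 := t.nabla_ζ hsu hw
  rw [nabla_congr_right g hζw, hv.2 u hu x hx, t.β_ker hW (t.mem_V.1 (hu.2 x hx)),
    hζw.self_of_nhds] at h2
  have h3 := t.ζ_nabla_ker hw hsu (t.ζ_section hu hU hx)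
  have h4 : t.ζ x (bracket u w x) =
      (-2 * t.α x (u x)) • v x + (2 * t.β x (w x)) • u x := by
    rw [← nabla_torsionfree g hsu hw, map_sub, h3]
    linear_combination (norm := module) -h2
  have h5 := t.α_ζ hW (bracket u w x)
  rw [h4, map_add, map_smul, map_smul, smul_eq_mul, smul_eq_mul] at h5
  rw [dirDeriv_congr h1, dirDeriv_const_mul _ (t.smooth_β hw),
    t.dirDeriv_β hW hsu (t.ζ_section hu hU hx) hw]
  have h6 := h1.self_of_nhds
  linear_combination -h5 - 3 * t.α x (u x) * h6

omit hW in
theorem d_θ (hU : IsOpen U) (hu : IsSectionOn t.V U u) (hv : IsParallelOn t.V (nabla g) U v)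
    (hw : IsParallelOn t.V (nabla g) U w) (hx : x ∈ U) :
    dirDeriv (fun y => g.inner y (t.θ y (v y)) (w y)) x (u x) =
      -2 * t.α x (u x) * g.inner x (t.θ x (v x)) (w x) := by
  have ht := t.isTriple x
  have hsv := hv.1.near hU hx
  have hv0 := t.mem_V.1 (hv.1.2 x hx)
  rw [nabla_metric g (hu.near hU hx) (t.smooth_θ x v hsv) (hw.1.near hU hx),
    t.nabla_θ (hu.near hU hx) hsv, hv.2 u hu x hx, hw.2 u hu x hx, ht.eig_ker_ζ hv0]
  simp only [map_zero, map_add, map_sub, map_smul, add_apply, sub_apply, smul_apply, smul_eq_mul,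
    zero_apply, ht.inner_ker hv0 (t.mem_V.1 (hw.1.2 x hx))]
  ring

omit hW in
/-- The vector denoted by `ζw` in the definition of a basic octuple is the value of the endomorphism
`ζ` at `w`. -/
theorem eq_ζ_of_inner {w : Tan x} {z : t.V x}
    (hz : ∀ w' : Tan x, restrictLeft g.inner t.V x z w' = form g (t.ζ x) w w') :
    (z : Tan x) = t.ζ x w := inner_ext g hz

/-- If `β` has no zeros, the forms given by the triples constitute a basic octuple. -/
theorem isBasicOctuple (hβ : ∀ x, t.β x ≠ 0) :
    IsBasicOctuple t.V (nabla g) (restrictLeft g.inner t.V) (restrictForm t.α t.V) t.β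
      (restrictBoth (fun x => form g (t.θ x)) t.V) (fun x => form g (t.ζ x)) where
  foliation := t.isAffineFoliation hW
  partialMetric := t.isPartialMetric
  skewAffine U v w hU hv hw x hx := by
    refine (t.d_h hW hU hv.1 hv hw hx).trans ?_
    have h := (isSkew_iff g _).1 (t.isTriple x).sdθ.skew (v x) (v x)
    rw [g.symm x (v x)] at h
    have h0 : g.inner x (t.θ x (v x)) (v x) = 0 := by linarith
    exact mul_eq_zero_of_right _ h0
  smooth_α U v hU hv := smoothFunOn_of_near fun x hx => t.smooth_α (hv.near hU hx)
  smooth_β U v hU hv := smoothFunOn_of_near fun x hx => t.smooth_β (hv.near hU hx)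
  smooth_θ U v v' hU hv hv' := smoothFunOn_of_near fun x hx =>
    (t.smooth_θ x _ (hv.near hU hx)).inner g (hv'.near hU hx)
  smooth_ζ := smoothBilin_form t.smooth_ζ
  skew_θ x v v' := (t.isTriple x).sdθ.1 v v'
  skew_ζ x := (t.isTriple x).sdζ.1
  β_ne_zero := hβ
  rank_ζ x := by
    have h := LinearMap.finrank_range_add_finrank_ker (form g (t.ζ x)).toLinearMap
    have h1 : LinearMap.ker (form g (t.ζ x)).toLinearMap = LinearMap.ker (t.ζ x) := by
      ext c
      exact form_eq_zero_iff
    rw [h1, (t.isTriple x).finrank_ker, finrank_tan] at h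
    omega
  d_h U u v w hU hu hv hw x hx := by
    have h := t.d_h hW hU hu.1 hv hw hx
    exact h
  d_α U u v hU hu hv x hx := by
    have h := t.d_α hW hU hu.1 hv hx
    exact h
  d_ζ U u w w' hU hu hw hw' x hx := t.d_ζ hW hU hu.1 hw hw' hx
  d_β U u w hU hu hw x hx := t.d_β hW hU hu.1 hw hx
  d_θ U u v v' hU hu hv hv' x hx := by
    have h := t.d_θ hU hu.1 hv hv' hx
    exact h
  sharp_exists x w :=
    ⟨⟨t.ζ x w, t.mem_V.2 ((t.isTriple x).ζζ_apply w)⟩, fun _ => rfl,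
      fun z hz => Subtype.ext (t.eq_ζ_of_inner hz)⟩
  θ_sharp x v w z hz := by
    have ht := t.isTriple x
    have hz' := t.eq_ζ_of_inner hz
    have h1 := ht.mem_range_of_ker (t.mem_V.1 v.2)
    have h2 : g.inner x (t.θ x v) (t.ζ x w) = 2 * g.inner x v w := by
      conv_rhs => rw [← h1]
      rw [ht.inner_ζ]
      simp only [map_smul, smul_apply, smul_eq_mul]
      ring
    rw [← hz'] at h2
    exact h2
  α_sharp x w z hz := by
    have h := t.α_ζ hW w
    rw [← t.eq_ζ_of_inner hz] at h
    exact h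
  ker_ζ x v := Iff.rfl

end TripleField

end Octuple

end NeutralGeometry

end

theorem theorem8p4 {M : Type*} [TopologicalSpace M] [ChartedSpace NeutralGeometry.E4 M]
    [IsManifold (𝓡 4) ∞ M] [T2Space M] [SecondCountableTopology M] [ConnectedSpace M]
    (g : NeutralGeometry.NeutralMetric M) (o : NeutralGeometry.MOrientation M)
    (hE : NeutralGeometry.IsEinstein g) (hSD : NeutralGeometry.IsSelfDual g o)
    (hIII : ∀ x : M, NeutralGeometry.IsPetrovIIIAt g o x) :
    ∃ d : NeutralGeometry.FormData M, d.IsAssociated g o ∧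
      (∀ d' : NeutralGeometry.FormData M, d'.IsAssociated g o → d' = d) ∧
      ((∀ x, d.β x ≠ 0) →
        NeutralGeometry.IsBasicOctuple (NeutralGeometry.kerField d.ζ) (NeutralGeometry.nabla g)
          (NeutralGeometry.restrictLeft g.inner (NeutralGeometry.kerField d.ζ))
          (NeutralGeometry.restrictForm d.α (NeutralGeometry.kerField d.ζ)) d.β
          (NeutralGeometry.restrictBoth d.θ (NeutralGeometry.kerField d.ζ)) d.ζ) := by
  obtain ⟨k, hk⟩ := hE.exists_weyl_eq
  have hW : ∀ x, NeutralGeometry.IsTypeIII g o (NeutralGeometry.weylMap g k x) := fun x =>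
    NeutralGeometry.isTypeIII_weylMap (hk x) hSD (hIII x)
  obtain ⟨t⟩ := NeutralGeometry.exists_tripleField hW
  exact ⟨t.toFormData, t.isAssociated hk, fun d' hd' => t.eq_toFormData hd' hk,
    t.isBasicOctuple hW⟩
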